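/- **Setting.** Let $R$ be a ring object and $G$ a group object in a category with finite products. Let $Mod$ be either the category $Mod_R$ of $R$-module objects or the category $Mod_R(G)$ of $R$-module objects with a compatible ($R$-linear) $G$-action, assumed abelian, and let $\otimes_R$ be a tensor product on $Mod$: a bi-additive associative bifunctor with natural isomorphisms $R\otimes_R M\cong M\cong M\otimes_R R$ ($G$ acting trivially on $R$) such that $P\otimes_R Q$ is projective whenever $P,Q$ are. For a projective resolution $M_\bullet$ of $M$ put $\widetilde M_0=M$, $\widetilde M_{k+1}=\mathrm{Ker}(M_k\to\widetilde M_k)$. With $\mathrm{Ext}^n(A,B)=H^n(\mathrm{Hom}(A_\bullet,B))$ (zero for $n<0$), the completed unenriched Ext group $\widehat{\mathrm{Ext}}^n(A,B)$, $n\in\mathbb Z$, is given * by the *resolution construction* as $\varinjlim_{k\ge0}\mathrm{Ext}^{n+k}(A,\widetilde B_k)$ along the connecting homomorphisms $\delta$ of $0\to\widetilde B_{k+1}\to B_k\to\widetilde B_k\to0$ (formed with the differential $u\mapsto-(-1)^n u\circ d$ on $\mathrm{Hom}(A_n,-)$); * by the *hypercohomology construction* as $H^n$ of the quotient of $\prod_k\mathrm{Hom}(A_{k+n},B_k)$,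 with differential $\varphi\mapsto d\circ\varphi-(-1)^n\varphi\circ d$, by the subcomplex $\bigoplus_k\mathrm{Hom}(A_{k+n},B_k)$. There is a canonical isomorphism between the two: a cochain $\varphi$ that satisfies the cocycle condition in all degrees $\ge k$ is sent to the image of $(-1)^{k(k+1)/2}\,[A_{n+k}\xrightarrow{\varphi}B_k\to\widetilde B_k]\in\mathrm{Ext}^{n+k}(A,\widetilde B_k)$. The external product of ordinary Ext groups is $[u]\vee[v]=(-1)^{mn}[(u\otimes_R v)\circ p]$ with $p:(A_\bullet\otimes_R C_\bullet)_{m+n}\to A_m\otimes_R C_n$ the projection. **Theorem.** Let $A_\bullet,C_\bullet$ be projective resolutions of $A,C$ in $Mod$ such that $A_\bullet\otimes_R C_\bullet$ is a projective resolution of $A\otimes_R C$. Let $B_\bullet,E_\bullet$ be projective resolutions of $B,E$ such that for all their syzygies $\widetilde F_k\in\{\widetilde B_k,\widetilde E_k\}$, $k\ge 0$, the functors $-\otimes_R\widetilde F_k$ and $\widetilde F_k\otimes_R-$ are exact and preserve projectives. 1. For all $m,n\in\mathbb Z$ there are external products $$\vee:\widehat{\mathrm{Ext}}^m(A,B)\otimes\widehat{\mathrm{Ext}}^n(C,E)\to\widehat{\mathrm{Ext}}^{m+n}(A\otimes_R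 C,B\otimes_R E),$$ which can be defined equivalently through the resolution and the hypercohomology construction. Precisely, let $o$ be a sequence of steps "$B$" and "$E$" in which both occur infinitely often, and let $P_k,D_k$ be the numbers of $B$- and $E$-steps among the first $k$ steps. Let $B_\bullet\otimes^o_R E_\bullet$ be the complex whose $k$-th term is $B_{P_k}\otimes_R\widetilde E_{D_k}$ if the next step is a $B$-step and $\widetilde B_{P_k}\otimes_R E_{D_k}$ if it is an $E$-step, with the differentials that factor through $\widetilde B_{P_k}\otimes_R\widetilde E_{D_k}$. It is a projective resolution of $B\otimes_R E$ with these objects as syzygies. Compute $\widehat{\mathrm{Ext}}^{*}(A\otimes_R C,B\otimes_R E)$ with any projective resolution $Q_\bullet$ of $B\otimes_R E$, and compare $B_\bullet\otimes^o_RE_\bullet$ with $Q_\bullet$ by lifts of the identity of $B\otimes_R E$. Then there is exactly one biadditive map that, for all $o$, all lifts and all $k$, sends the images of $x\in\mathrm{Ext}^{m+P_k}(A,\widetilde B_{P_k})$ and $y\in\mathrm{Ext}^{n+D_k}(C,\widetilde E_{D_k})$ to the image of $\varepsilon_k\,(x\vee y)$, where $\varepsilon_0=1$, $\varepsilon_{k+1}=\varepsilon_k$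 if step $k+1$ is a $B$-step and $\varepsilon_{k+1}=(-1)^{m+P_k}\varepsilon_k$ if it is an $E$-step. There is exactly one biadditive map that, for all $o$ and all lifts, sends the hypercohomology classes of $\varphi,\psi$ to the class of $\varphi\otimes^o\psi$, whose component in degree $k$ is $\eta_k$ times $(\varphi_{m+P_k}\otimes_R\pi\psi_{n+D_k})\circ p$ or $(\pi\varphi_{m+P_k}\otimes_R\psi_{n+D_k})\circ p$ according to the form of the $k$-th term (and zero if $m+P_k<0$ or $n+D_k<0$); here $\pi$ denotes the projections to the syzygies, $\eta_0=(-1)^{mn}$, $\eta_{k+1}=(-1)^n\eta_k$ for a $B$-step and $\eta_{k+1}=(-1)^{P_k}\eta_k$ for an $E$-step. The canonical isomorphisms between the two constructions identify these two maps. 2. Suppose $\otimes_R$ is given on both $Mod_R$ and $Mod_R(G)$ and the restriction functor $Mod_R(G)\to Mod_R$, which forgets the $G$-action, is exact and compatible with $\otimes_R$. Assume that it preserves projectives and that $R$ is projective in $Mod_R$. Then the tensor product of any two projective resolutions of $R$ in $Mod_R(G)$ is a projective resolution of $R\otimes_RR\cong R$. With $\widehat H^n_R(G,M)=\widehat{\mathrm{Ext}}^n(R,M)$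 in $Mod_R(G)$, for $M,N\in Mod_R(G)$ with projective resolutions that satisfy the condition on syzygies above, the external products descend to cup products $$\smile:\widehat H^m_R(G,M)\otimes\widehat H^n_R(G,N)\to\widehat H^{m+n}_R(G,M\otimes_RN),\qquad m,n\in\mathbb Z,$$ namely to $\Delta^*(x\vee y)$ for any chain map $\Delta$ from a projective resolution of $R$ to the tensor product of two projective resolutions of $R$ that lifts $R\cong R\otimes_RR$. They agree in both constructions. -/

import Mathlib

open CategoryTheory CategoryTheory.Limits

universe v u

set_option linter.unusedSectionVars false

namespace CompletedExt

noncomputable section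

/-! ### Module objects over a ring object, and module objects with a compatible group action -/

section ModuleObjects

open MonoidalCategory CartesianMonoidalCategory
open scoped MonObj AddMonObj

variable {S : Type u} [Category.{v} S] [CartesianMonoidalCategory S] [BraidedCategory S]

/-- An `R`-module object in a category `S` with finite products, for a ring object `R` in `S`:
a commutative group object with an action of the monoid object `R` that is additive in both
variables. The laws are written on generalised elements, i.e. on morphisms `Z ⟶ R`, `Z ⟶ X`. -/
structure RMod (R : S) [RingObj R] where
  /-- The underlying object. -/
  X : S
  [addGrp : AddGrpObj X]
  [addComm : IsCommAddMonObj X]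
  [smul : ModObj R X]
  smul_add : ∀ {Z : S} (r : Z ⟶ R) (x y : Z ⟶ X), r • (x + y) = r • x + r • y
  add_smul : ∀ {Z : S} (r s : Z ⟶ R) (x : Z ⟶ X), (r + s) • x = r • x + s • x

attribute [instance] RMod.addGrp RMod.addComm RMod.smul

namespace RMod

variable {R : S} [RingObj R]

/-- A morphism of `R`-module objects. -/
@[ext]
structure Hom (M N : RMod R) where
  /-- The underlying morphism. -/
  hom : M.X ⟶ N.X
  map_add : ∀ {Z : S} (x y : Z ⟶ M.X), (x + y) ≫ hom = x ≫ hom + y ≫ hom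
  map_smul : ∀ {Z : S} (r : Z ⟶ R) (x : Z ⟶ M.X), (r • x) ≫ hom = r • (x ≫ hom)

/-- The category `Mod_R`. -/
instance : Category (RMod R) where
  Hom := Hom
  id M := ⟨𝟙 _, by simp, by simp⟩
  comp f g := ⟨f.hom ≫ g.hom,
    fun x y => by simp only [← Category.assoc, f.map_add, g.map_add],
    fun r x => by simp only [← Category.assoc, f.map_smul, g.map_smul]⟩

variable (R) in
/-- `R` as a module object over itself. -/
def self : RMod R :=
  letI : ModObj R R := ModObj.regular R
  { X := R
    smul_add := fun r x y => Hom.mul_add r x y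
    add_smul := fun r s x => Hom.add_mul r s x }

end RMod

/-- An `R`-module object with a compatible action of the group object `G`: the action of `G` is by
`R`-linear automorphisms. -/
structure RGMod (R G : S) [RingObj R] [GrpObj G] extends RMod R where
  [act : ModObj G X]
  act_add : ∀ {Z : S} (g : Z ⟶ G) (x y : Z ⟶ X), g • (x + y) = g • x + g • y
  act_smul : ∀ {Z : S} (g : Z ⟶ G) (r : Z ⟶ R) (x : Z ⟶ X), g • (r • x) = r • (g • x)

attribute [instance] RGMod.act

namespace RGMod

variable {R G : S} [RingObj R] [GrpObj G]

/-- A `G`-equivariant morphism of `R`-module objects. -/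
@[ext]
structure Hom (M N : RGMod R G) extends RMod.Hom M.toRMod N.toRMod where
  map_act : ∀ {Z : S} (g : Z ⟶ G) (x : Z ⟶ M.X), (g • x) ≫ hom = g • (x ≫ hom)

/-- The category `Mod_R(G)`. -/
instance : Category (RGMod R G) where
  Hom := Hom
  id M := ⟨⟨𝟙 _, by simp, by simp⟩, by simp⟩
  comp f g := ⟨⟨f.hom ≫ g.hom,
    fun x y => by simp only [← Category.assoc, f.map_add, g.map_add],
    fun r x => by simp only [← Category.assoc, f.map_smul, g.map_smul]⟩,
    fun r x => by simp only [← Category.assoc, f.map_act, g.map_act]⟩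

variable (R G) in
/-- The restriction functor `Mod_R(G) ⥤ Mod_R` that forgets the action of `G`. -/
def forget : RGMod R G ⥤ RMod R where
  obj M := M.toRMod
  map f := f.toHom

lemma trivialAction_smul {Y Z : S} (g : Z ⟶ G) (x : Z ⟶ Y) :
    letI : ModObj G Y := ModObj.trivialAction G Y
    g • x = x :=
  lift_snd g x

variable (R G) in
/-- `R` with the trivial action of `G`. -/
def trivial : RGMod R G :=
  { RMod.self R with
    act := ModObj.trivialAction G R
    act_add := fun g x y => (trivialAction_smul g _).trans
      (congrArg₂ (· + ·) (trivialAction_smul g x).symm (trivialAction_smul g y).symm)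
    act_smul := fun g r x => (trivialAction_smul g _).trans
      (congrArg (fun t => lift r t ≫ (RMod.self R).smul.smul)
        (trivialAction_smul g x).symm) }

variable (R G) in
lemma forget_trivial : (forget R G).obj (trivial R G) = RMod.self R := rfl

end RGMod

end ModuleObjects

/-! ### Syzygies of projective resolutions -/

variable {C : Type u} [Category.{v} C] [Abelian C]

section Syzygies

variable {A : C} (P : ProjectiveResolution A)

/-- The augmentation `P₀ ⟶ A`, extended by zero in positive degrees. -/
def aug : ∀ i : ℕ, P.complex.X i ⟶ A
  | 0 => P.π.f 0
  | _ + 1 => 0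

lemma d_aug (i j : ℕ) : P.complex.d i j ≫ aug P j = 0 := by
  cases j with
  | succ j => simp [aug]
  | zero =>
    by_cases h : i = 1
    · subst h
      exact P.complex_d_comp_π_f_zero
    · rw [P.complex.shape i 0 (by simpa using fun h' => h h'.symm), zero_comp]

/-- The `k`-th syzygy `P̃ₖ` with the morphism `Pₖ ⟶ P̃ₖ`: `P̃₀ = A`, and
`P̃ₖ₊₁` is the kernel of `Pₖ ⟶ P̃ₖ`. -/
def syzAux : ∀ k : ℕ, Σ' (Z : C) (p : P.complex.X k ⟶ Z), P.complex.d (k + 1) k ≫ p = 0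
  | 0 => ⟨A, aug P 0, d_aug P 1 0⟩
  | k + 1 => ⟨kernel (syzAux k).2.1, kernel.lift _ (P.complex.d (k + 1) k) (syzAux k).2.2, by
      rw [← cancel_mono (kernel.ι _)]
      simp⟩

/-- The `k`-th syzygy `P̃ₖ`. -/
def syz (k : ℕ) : C := (syzAux P k).1

/-- The morphism `Pₖ ⟶ P̃ₖ`. -/
def syzPi (k : ℕ) : P.complex.X k ⟶ syz P k := (syzAux P k).2.1

/-- The inclusion `P̃ₖ₊₁ ⟶ Pₖ`. -/
def syzIota (k : ℕ) : syz P (k + 1) ⟶ P.complex.X k := kernel.ι (syzPi P k)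

lemma d_syzPi (k : ℕ) : P.complex.d (k + 1) k ≫ syzPi P k = 0 := (syzAux P k).2.2

@[simp]
lemma syzIota_syzPi (k : ℕ) : syzIota P k ≫ syzPi P k = 0 := kernel.condition _

lemma syzPi_syzIota (k : ℕ) : syzPi P (k + 1) ≫ syzIota P k = P.complex.d (k + 1) k :=
  kernel.lift_ι _ _ _

instance (k : ℕ) : Mono (syzIota P k) := inferInstanceAs (Mono (kernel.ι _))

lemma syz_exact (k : ℕ) :
    (ShortComplex.mk (P.complex.d (k + 1) k) (syzPi P k) (d_syzPi P k)).Exact := by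
  cases k with
  | zero => exact P.exact₀
  | succ k =>
    let f : ShortComplex.mk (P.complex.d (k + 1 + 1) (k + 1)) (syzPi P (k + 1))
        (d_syzPi P (k + 1)) ⟶ ShortComplex.mk _ _ (P.complex.d_comp_d (k + 2) (k + 1) k) :=
      { τ₁ := 𝟙 _, τ₂ := 𝟙 _, τ₃ := syzIota P k
        comm₂₃ := by simp [syzPi_syzIota] }
    have : Epi f.τ₁ := inferInstanceAs (Epi (𝟙 _))
    have : IsIso f.τ₂ := inferInstanceAs (IsIso (𝟙 _))
    have : Mono f.τ₃ := inferInstanceAs (Mono (syzIota P k))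
    exact (ShortComplex.exact_iff_of_epi_of_isIso_of_mono f).2 (P.exact_succ k)

instance (k : ℕ) : Epi (syzPi P k) := by
  cases k with
  | zero => exact inferInstanceAs (Epi (P.π.f 0))
  | succ k => exact (syz_exact P k).epi_kernelLift

/-- The sequence `0 ⟶ P̃ₖ₊₁ ⟶ Pₖ ⟶ P̃ₖ ⟶ 0`. -/
@[simps]
def syzSeq (k : ℕ) : ShortComplex C := ShortComplex.mk (syzIota P k) (syzPi P k) (by simp)

lemma syzSeq_shortExact (k : ℕ) : (syzSeq P k).ShortExact where
  exact := ShortComplex.exact_kernel (syzPi P k)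
  mono_f := inferInstanceAs (Mono (syzIota P k))
  epi_g := inferInstanceAs (Epi (syzPi P k))

end Syzygies

/-! ### Unenriched `Ext` groups -/

section Ext

/-- The degree `n` cochains of the complex `Hom(K, B)`, for `n : ℤ`: the group `Hom(Kₙ, B)`, which
is zero for `n < 0`. -/
abbrev HomCochain (K : ChainComplex C ℕ) (B : C) (n : ℤ) : Type v :=
  ∀ i : {i : ℕ // (i : ℤ) = n}, K.X i.1 ⟶ B

/-- The differential `u ↦ u ∘ d` of `Hom(K, B)`. -/
def homD (K : ChainComplex C ℕ) (B : C) (n m : ℤ) (h : n + 1 = m) :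
    HomCochain K B n →+ HomCochain K B m where
  toFun u i := match i with
    | ⟨0, _⟩ => 0
    | ⟨i + 1, hi⟩ => K.d (i + 1) i ≫ u ⟨i, by push_cast at hi; lia⟩
  map_zero' := by
    ext ⟨i, hi⟩
    cases i <;> simp
  map_add' u w := by
    ext ⟨i, hi⟩
    cases i <;> simp

/-- Postcomposition with `g : B ⟶ B'`. -/
def homPost (K : ChainComplex C ℕ) {B B' : C} (g : B ⟶ B') (n : ℤ) :
    HomCochain K B n →+ HomCochain K B' n where
  toFun u i := u i ≫ g
  map_zero' := by ext; simp
  map_add' u w := by ext; simp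

/-- Precomposition with a chain map `f : K' ⟶ K`. -/
def homPre {K' K : ChainComplex C ℕ} (f : K' ⟶ K) (B : C) (n : ℤ) :
    HomCochain K B n →+ HomCochain K' B n where
  toFun u i := f.f i.1 ≫ u i
  map_zero' := by ext; simp
  map_add' u w := by ext; simp

lemma homD_post (K : ChainComplex C ℕ) {B B' : C} (g : B ⟶ B') (n m : ℤ) (h : n + 1 = m)
    (u : HomCochain K B n) :
    homD K B' n m h (homPost K g n u) = homPost K g m (homD K B n m h u) := by
  ext ⟨i, hi⟩
  cases i <;> simp [homD, homPost]

lemma homD_pre {K' K : ChainComplex C ℕ} (f : K' ⟶ K) (B : C) (n m : ℤ) (h : n + 1 = m)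
    (u : HomCochain K B n) :
    homD K' B n m h (homPre f B n u) = homPre f B m (homD K B n m h u) := by
  ext ⟨i, hi⟩
  cases i <;> simp [homD, homPre]

lemma homD_homD (K : ChainComplex C ℕ) (B : C) (l n m : ℤ) (h : l + 1 = n) (h' : n + 1 = m)
    (u : HomCochain K B l) : homD K B n m h' (homD K B l n h u) = 0 := by
  ext ⟨i, hi⟩
  match i with
  | 0 => simp [homD]
  | 1 => simp [homD]
  | i + 2 => simp [homD]

/-- The `n`-cocycles of `Hom(K, B)`. -/
abbrev homCocycles (K : ChainComplex C ℕ) (B : C) (n : ℤ) : AddSubgroup (HomCochain K B n) :=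
  (homD K B n (n + 1) rfl).ker

/-- The `n`-coboundaries of `Hom(K, B)`. -/
abbrev homBoundaries (K : ChainComplex C ℕ) (B : C) (n : ℤ) : AddSubgroup (HomCochain K B n) :=
  (homD K B (n - 1) n (by lia)).range

/-- The group `Hⁿ(Hom(K, B))`. For a projective resolution `K` of `A` this is the unenriched
`Extⁿ(A, B)`, and it vanishes for `n < 0`. -/
abbrev ExtGrp (K : ChainComplex C ℕ) (B : C) (n : ℤ) : Type v :=
  homCocycles K B n ⧸ (homBoundaries K B n).addSubgroupOf (homCocycles K B n)

/-- The class of a cocycle. -/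
def extMk {K : ChainComplex C ℕ} {B : C} {n : ℤ} : homCocycles K B n →+ ExtGrp K B n :=
  QuotientAddGroup.mk' _

lemma extMk_eq_iff {K : ChainComplex C ℕ} {B : C} {n : ℤ} (x y : homCocycles K B n) :
    extMk x = extMk y ↔ ∃ w, homD K B (n - 1) n (by lia) w = x.1 - y.1 := by
  rw [← sub_eq_zero, ← map_sub]
  change ((QuotientAddGroup.mk (x - y) : ExtGrp K B n) = 0) ↔ _
  rw [QuotientAddGroup.eq_zero_iff, AddSubgroup.mem_addSubgroupOf]
  rfl

/-- The map `Extⁿ(A, B) ⟶ Extⁿ(A', B)` induced by a chain map of resolutions. -/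
def extPre {K' K : ChainComplex C ℕ} (f : K' ⟶ K) (B : C) (n : ℤ) :
    ExtGrp K B n →+ ExtGrp K' B n :=
  QuotientAddGroup.lift _
    (extMk.comp (((homPre f B n).comp (homCocycles K B n).subtype).codRestrict
      (homCocycles K' B n) (fun u => by
        have hu := u.2
        rw [AddMonoidHom.mem_ker] at hu ⊢
        simp [homD_pre, hu])))
    (by
      rintro ⟨u, hu⟩ ⟨w, hw⟩
      rw [AddMonoidHom.mem_ker, ← map_zero extMk]
      refine (extMk_eq_iff _ _).2 ⟨homPre f B _ w, ?_⟩
      rw [homD_pre, hw]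
      simp)

variable {A : C} (P : ProjectiveResolution A) {S : ShortComplex C}

/-- A lift of a cochain with values in `S.X₃` to a cochain with values in `S.X₂`. -/
def liftCochain (hS : S.ShortExact) (n : ℤ) (u : HomCochain P.complex S.X₃ n) : HomCochain P.complex S.X₂ n :=
  fun i => haveI := hS.epi_g; Projective.factorThru (u i) S.g

lemma liftCochain_post (hS : S.ShortExact) (n : ℤ) (u : HomCochain P.complex S.X₃ n) :
    homPost _ S.g n (liftCochain P hS n u) = u := by
  ext i
  have := hS.epi_g
  exact Projective.factorThru_comp _ _

lemma exists_desc (hS : S.ShortExact) (n : ℤ) (w : HomCochain P.complex S.X₂ n) (hw : homPost _ S.g n w = 0) :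
    ∃ x : HomCochain P.complex S.X₁ n, homPost _ S.f n x = w := by
  have := hS.mono_f
  refine ⟨fun i => hS.exact.lift (w i) (congrFun hw i), ?_⟩
  ext i
  exact hS.exact.lift_f _ _

lemma homPost_injective (hS : S.ShortExact) (n : ℤ) : Function.Injective (homPost P.complex S.f n) := by
  intro x y h
  have := hS.mono_f
  ext i
  rw [← cancel_mono S.f]
  exact congrFun h i

lemma exists_connecting (hS : S.ShortExact) (n m : ℤ) (h : n + 1 = m) (u : homCocycles P.complex S.X₃ n) :
    ∃ x : homCocycles P.complex S.X₁ m,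
      homPost _ S.f m x.1 = homD _ _ n m h (liftCochain P hS n u.1) := by
  subst h
  obtain ⟨x, hx⟩ := exists_desc P hS (n + 1) (homD _ _ n (n + 1) rfl (liftCochain P hS n u.1)) (by
    rw [← homD_post, liftCochain_post]
    exact u.2)
  refine ⟨⟨x, ?_⟩, hx⟩
  apply homPost_injective P hS
  rw [← homD_post, hx, homD_homD, map_zero]

lemma connecting_unique (hS : S.ShortExact) (n m : ℤ) (h : n + 1 = m) (u : homCocycles P.complex S.X₃ n)
    (w w' : HomCochain P.complex S.X₂ n) (x x' : homCocycles P.complex S.X₁ m)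
    (hw : homPost _ S.g n w = u.1) (hx : homPost _ S.f m x.1 = homD _ _ n m h w)
    (b : HomCochain P.complex S.X₃ (n - 1))
    (hw' : homPost _ S.g n w' = u.1 + homD _ _ (n - 1) n (by lia) b)
    (hx' : homPost _ S.f m x'.1 = homD _ _ n m h w') : extMk x' = extMk x := by
  subst h
  obtain ⟨y, hy⟩ := exists_desc P hS n
    (w' - w - homD _ _ (n - 1) n (by lia) (liftCochain P hS _ b)) (by
      rw [map_sub, map_sub, ← homD_post, liftCochain_post, hw, hw']
      abel)
  rw [extMk_eq_iff]
  have key : homD P.complex S.X₁ n (n + 1) rfl y = x'.1 - x.1 := by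
    apply homPost_injective P hS
    rw [← homD_post, hy, map_sub, map_sub, homD_homD, map_sub, hx, hx', sub_zero]
  have aux : ∀ (l : ℤ) (hl : l + 1 = n + 1),
      ∃ y, homD P.complex S.X₁ l (n + 1) hl y = x'.1 - x.1 := by
    intro l hl
    obtain rfl : l = n := by lia
    exact ⟨y, key⟩
  exact aux _ _

/-- The connecting homomorphism `Extⁿ(A, S₃) ⟶ Extⁿ⁺¹(A, S₁)` of a short exact sequence `S`, for
the differential `u ↦ -(-1)ⁿ u ∘ d` that `Hom(A_•, -)` carries as a hypercohomology complex: a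
cocycle `u : Aₙ ⟶ S₃` is lifted to `Aₙ ⟶ S₂`, and the differential of the lift takes
values in `S₁`. -/
def connecting (hS : S.ShortExact) (n m : ℤ) (h : n + 1 = m) :
    ExtGrp P.complex S.X₃ n →+ ExtGrp P.complex S.X₁ m :=
  QuotientAddGroup.lift _
    (m.negOnePow •
      (AddMonoidHom.mk' (fun u => extMk (exists_connecting P hS n m h u).choose) (by
        intro u u'
        rw [← map_add]
        refine connecting_unique P hS n m h (u + u')
          (liftCochain P hS n u.1 + liftCochain P hS n u'.1) _ _ _ ?_ ?_ 0 ?_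
          (exists_connecting P hS n m h (u + u')).choose_spec
        · rw [map_add, liftCochain_post, liftCochain_post]
          rfl
        · rw [map_add]
          exact (map_add (homPost P.complex S.f m) _ _).trans (congrArg₂ (· + ·)
            (exists_connecting P hS n m h u).choose_spec
            (exists_connecting P hS n m h u').choose_spec)
        · rw [liftCochain_post, map_zero, add_zero])))
    (by
      rintro ⟨u, hu⟩ ⟨b, hb⟩
      rw [AddMonoidHom.mem_ker]
      change m.negOnePow • extMk (exists_connecting P hS n m h ⟨u, hu⟩).choose = 0
      have : extMk (exists_connecting P hS n m h ⟨u, hu⟩).choose = extMk 0 := by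
        refine connecting_unique P hS n m h 0 0 _ _ _ (map_zero _) (by simp) b ?_
          (exists_connecting P hS n m h ⟨u, hu⟩).choose_spec
        rw [liftCochain_post]
        simpa using hb.symm
      rw [this, map_zero, smul_zero])

lemma connecting_mk (hS : S.ShortExact) (n m : ℤ) (h : n + 1 = m) (u : homCocycles P.complex S.X₃ n)
    (w : HomCochain P.complex S.X₂ n) (x : homCocycles P.complex S.X₁ m)
    (hw : homPost _ S.g n w = u.1) (hx : homPost _ S.f m x.1 = homD _ _ n m h w) :
    connecting P hS n m h (extMk u) = m.negOnePow • extMk x := by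
  change m.negOnePow • extMk (exists_connecting P hS n m h u).choose = _
  rw [connecting_unique P hS n m h u w _ x _ hw hx 0 _
    (exists_connecting P hS n m h u).choose_spec]
  rw [liftCochain_post, map_zero, add_zero]

lemma extPre_mk {K' K : ChainComplex C ℕ} (f : K' ⟶ K) (B : C) (n : ℤ)
    (u : homCocycles K B n) (u' : homCocycles K' B n) (h : u'.1 = homPre f B n u.1) :
    extPre f B n (extMk u) = extMk u' :=
  congrArg extMk (Subtype.ext h.symm)

lemma connecting_pre (hS : S.ShortExact) {A' : C} (P' : ProjectiveResolution A') (f : P'.complex ⟶ P.complex)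
    (n m : ℤ) (h : n + 1 = m) (x : ExtGrp P.complex S.X₃ n) :
    extPre f _ m (connecting P hS n m h x) = connecting P' hS n m h (extPre f _ n x) := by
  obtain ⟨u, rfl⟩ := QuotientAddGroup.mk_surjective x
  have hx := (exists_connecting P hS n m h u).choose_spec
  generalize (exists_connecting P hS n m h u).choose = y at hx
  let u' : homCocycles P'.complex S.X₃ n := ⟨homPre f _ n u.1, by
    rw [AddMonoidHom.mem_ker, homD_pre, u.2, map_zero]⟩
  let y' : homCocycles P'.complex S.X₁ m := ⟨homPre f _ m y.1, by
    rw [AddMonoidHom.mem_ker, homD_pre, y.2, map_zero]⟩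
  have hcomm : ∀ {B B' : C} (g : B ⟶ B') (k : ℤ) (z : HomCochain P.complex B k),
      homPost _ g k (homPre f B k z) = homPre f B' k (homPost _ g k z) := by
    intro B B' g k z
    ext i
    exact Category.assoc _ _ _
  refine Eq.trans (congrArg _ (connecting_mk P hS n m h u _ y (liftCochain_post _ _ _ _) hx)) ?_
  refine Eq.trans ?_ (congrArg _ (extPre_mk f _ n u u' rfl)).symm
  rw [connecting_mk P' hS n m h u' (homPre f _ n (liftCochain P hS n u.1)) y'
    (by rw [hcomm, liftCochain_post]) (by rw [homD_pre, ← hx, hcomm]), ← extPre_mk f _ m y y' rfl]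
  exact map_zsmul_unit _ _ _

end Ext

/-! ### Completed unenriched `Ext`: the resolution construction -/

section Resolution

variable {A A' B : C} (P : ProjectiveResolution A) (P' : ProjectiveResolution A')
  (Q : ProjectiveResolution B)

/-- The direct system `Extⁿ⁺ᵏ(A, B̃ₖ)`, `k ∈ ℕ₀`, along the connecting homomorphisms of
`0 ⟶ B̃ₖ₊₁ ⟶ Bₖ ⟶ B̃ₖ ⟶ 0`. -/
def resSystem (n : ℤ) : ℕ ⥤ AddCommGrpCat.{v} :=
  Functor.ofSequence (X := fun k : ℕ => AddCommGrpCat.of (ExtGrp P.complex (syz Q k) (n + k)))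
    (fun k => AddCommGrpCat.ofHom (connecting P (syzSeq_shortExact Q k) (n + k)
      (n + (k + 1 : ℕ)) (by push_cast; lia)))

/-- The completed unenriched `Ext` group `Êxtⁿ(A, B)` in the resolution construction: the direct
limit of `Extⁿ⁺ᵏ(A, B̃ₖ)`. -/
abbrev ResExt (n : ℤ) : Type v := (colimit (resSystem P Q n) : AddCommGrpCat.{v})

/-- The canonical homomorphism `Extⁿ⁺ᵏ(A, B̃ₖ) ⟶ Êxtⁿ(A, B)`. -/
def resIota (n : ℤ) (k : ℕ) : ExtGrp P.complex (syz Q k) (n + k) →+ ResExt P Q n :=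
  (colimit.ι (resSystem P Q n) k).hom

variable {P P'}

/-- The homomorphism `Êxtⁿ(A, B) ⟶ Êxtⁿ(A', B)` induced by a chain map of resolutions. -/
def resPre (f : P'.complex ⟶ P.complex) (n : ℤ) : ResExt P Q n →+ ResExt P' Q n :=
  (colimMap (NatTrans.ofSequence (F := resSystem P Q n) (G := resSystem P' Q n)
    (fun k => AddCommGrpCat.ofHom (extPre f (syz Q k) (n + k))) (by
      intro k
      simp only [resSystem, Functor.ofSequence_map_homOfLE_succ]
      ext x
      exact connecting_pre P (syzSeq_shortExact Q k) P' f _ _ _ x))).hom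

end Resolution

/-! ### Completed unenriched `Ext`: the hypercohomology construction -/

section Hypercohomology

variable (K L : ChainComplex C ℕ)

/-- The `n`-cochains of the hypercohomology complex, `∏ₖ Hom(Kₖ₊ₙ, Lₖ)`, where the complexes are
zero in negative degrees, so that only the pairs of natural numbers `(k + n, k)` contribute. -/
abbrev Hyp (n : ℤ) : Type v := ∀ p : {p : ℕ × ℕ // (p.1 : ℤ) = p.2 + n}, K.X p.1.1 ⟶ L.X p.1.2

/-- The differential `φ ↦ d ∘ φ - (-1)ⁿ φ ∘ d` of the hypercohomology complex. -/
def hypD (n m : ℤ) (h : n + 1 = m) : Hyp K L n →+ Hyp K L m where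
  toFun φ p := match p with
    | ⟨(0, j), hp⟩ => φ ⟨(0, j + 1), by push_cast at hp ⊢; lia⟩ ≫ L.d (j + 1) j
    | ⟨(i + 1, j), hp⟩ => φ ⟨(i + 1, j + 1), by push_cast at hp ⊢; lia⟩ ≫ L.d (j + 1) j -
        n.negOnePow • (K.d (i + 1) i ≫ φ ⟨(i, j), by push_cast at hp ⊢; lia⟩)
  map_zero' := by
    ext ⟨⟨i, j⟩, hp⟩
    cases i <;> simp
  map_add' φ ψ := by
    ext ⟨⟨i, j⟩, hp⟩
    cases i
    · simp
    · simp only [Pi.add_apply, Preadditive.add_comp, Preadditive.comp_add, smul_add]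
      abel

/-- The bounded cochains `⨁ₖ Hom(Kₖ₊ₙ, Lₖ)`: those with finitely many nonzero components. -/
def bdd (n : ℤ) : AddSubgroup (Hyp K L n) where
  carrier := {φ | ∃ N : ℕ, ∀ p, N ≤ p.1.2 → φ p = 0}
  zero_mem' := ⟨0, fun _ _ => rfl⟩
  add_mem' := by
    rintro φ ψ ⟨N, hN⟩ ⟨M, hM⟩
    refine ⟨max N M, fun p hp => ?_⟩
    rw [Pi.add_apply, hN p (le_trans (le_max_left _ _) hp), hM p (le_trans (le_max_right _ _) hp),
      add_zero]
  neg_mem' := by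
    rintro φ ⟨N, hN⟩
    exact ⟨N, fun p hp => by rw [Pi.neg_apply, hN p hp, neg_zero]⟩

variable {K L} in
lemma hypD_mem_bdd (n m : ℤ) (h : n + 1 = m) {φ : Hyp K L n} (hφ : φ ∈ bdd K L n) :
    hypD K L n m h φ ∈ bdd K L m := by
  obtain ⟨N, hN⟩ := hφ
  refine ⟨N, ?_⟩
  rintro ⟨⟨i, j⟩, hp⟩ hj
  have hj : N ≤ j := hj
  cases i with
  | zero => simp [hypD, hN ⟨(0, j + 1), _⟩ (Nat.le_succ_of_le hj)]
  | succ i =>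
    simp [hypD, hN ⟨(i + 1, j + 1), _⟩ (Nat.le_succ_of_le hj), hN ⟨(i, j), _⟩ hj]

/-- The `n`-cochains of the Vogel complex: the quotient of the hypercohomology complex by the
bounded complex. -/
abbrev Vog (n : ℤ) : Type v := Hyp K L n ⧸ bdd K L n

/-- The differential of the Vogel complex. -/
def vogD (n m : ℤ) (h : n + 1 = m) : Vog K L n →+ Vog K L m :=
  QuotientAddGroup.map _ _ (hypD K L n m h) (fun _ hφ => hypD_mem_bdd n m h hφ)

/-- The cohomology group `Hⁿ` of the Vogel complex. For projective resolutions `K` of `A` and `L`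
of `B` this is the completed unenriched `Ext` group `Êxtⁿ(A, B)` in the hypercohomology
construction. -/
def HypExt (n : ℤ) : Type v :=
  (vogD K L n (n + 1) rfl).ker ⧸
    ((vogD K L (n - 1) n (by lia)).range.addSubgroupOf (vogD K L n (n + 1) rfl).ker)

instance (n : ℤ) : AddCommGroup (HypExt K L n) :=
  QuotientAddGroup.Quotient.addCommGroup _

variable {K L}

/-- A cochain whose differential is bounded: up to signs, an almost chain map `K[n] ⟶ L`. -/
def IsAlmostCocycle {n : ℤ} (φ : Hyp K L n) : Prop :=
  hypD K L n (n + 1) rfl φ ∈ bdd K L (n + 1)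

/-- The cohomology class of an almost cocycle. -/
def hypMk {n : ℤ} (φ : Hyp K L n) (hφ : IsAlmostCocycle φ) : HypExt K L n :=
  QuotientAddGroup.mk' _ ⟨QuotientAddGroup.mk φ, (QuotientAddGroup.eq_zero_iff _).2 hφ⟩

/-- Postcomposition with a chain map. -/
def hypPost {L' : ChainComplex C ℕ} (f : L ⟶ L') {n : ℤ} (φ : Hyp K L n) : Hyp K L' n :=
  fun p => φ p ≫ f.f p.1.2

/-- Precomposition with a chain map. -/
def hypPre {K' : ChainComplex C ℕ} (f : K' ⟶ K) (L : ChainComplex C ℕ) (n : ℤ) :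
    Hyp K L n →+ Hyp K' L n where
  toFun φ p := f.f p.1.1 ≫ φ p
  map_zero' := by ext; simp
  map_add' φ ψ := by ext; simp

lemma hypD_pre {K' : ChainComplex C ℕ} (f : K' ⟶ K) (n m : ℤ) (h : n + 1 = m) (φ : Hyp K L n) :
    hypD K' L n m h (hypPre f L n φ) = hypPre f L m (hypD K L n m h φ) := by
  ext ⟨⟨i, j⟩, hp⟩
  cases i <;> simp [hypD, hypPre]

/-- The homomorphism of Vogel cochains induced by a chain map. -/
def vogPre {K' : ChainComplex C ℕ} (f : K' ⟶ K) (L : ChainComplex C ℕ) (n : ℤ) :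
    Vog K L n →+ Vog K' L n :=
  QuotientAddGroup.map _ _ (hypPre f L n) (by
    rintro φ ⟨N, hN⟩
    exact ⟨N, fun p hp => by simp [hypPre, hN p hp]⟩)

lemma vogD_pre {K' : ChainComplex C ℕ} (f : K' ⟶ K) (n m : ℤ) (h : n + 1 = m) (x : Vog K L n) :
    vogD K' L n m h (vogPre f L n x) = vogPre f L m (vogD K L n m h x) := by
  obtain ⟨φ, rfl⟩ := QuotientAddGroup.mk_surjective x
  exact congrArg QuotientAddGroup.mk (hypD_pre f n m h φ)

/-- The homomorphism `Êxtⁿ(A, B) ⟶ Êxtⁿ(A', B)` induced by a chain map of resolutions. -/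
def hypExtPre {K' : ChainComplex C ℕ} (f : K' ⟶ K) (L : ChainComplex C ℕ) (n : ℤ) :
    HypExt K L n →+ HypExt K' L n :=
  QuotientAddGroup.map _ _
    (((vogPre f L n).comp (vogD K L n (n + 1) rfl).ker.subtype).codRestrict
      (vogD K' L n (n + 1) rfl).ker (fun x => by
        have hx := x.2
        rw [AddMonoidHom.mem_ker] at hx ⊢
        simp [vogD_pre, hx]))
    (by
      rintro ⟨x, hx⟩ ⟨w, hw⟩
      refine ⟨vogPre f L _ w, ?_⟩
      rw [vogD_pre, hw]
      rfl)

end Hypercohomology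

section Comparison

variable {A B : C} (P : ProjectiveResolution A) (Q : ProjectiveResolution B)

/-- The composites `Pₙ₊ₖ ⟶ Qₖ ⟶ Q̃ₖ` of the components of a hypercohomology cochain. -/
def syzComp {n : ℤ} (φ : Hyp P.complex Q.complex n) (k : ℕ) :
    HomCochain P.complex (syz Q k) (n + k) :=
  fun i => φ ⟨(i.1, k), i.2.trans (add_comm _ _)⟩ ≫ syzPi Q k

/-- The canonical isomorphism between the hypercohomology and the resolution construction: the
class of an almost cocycle `φ` that satisfies the cocycle condition in all degrees `≥ k` goes to
`(-1)^(k(k+1)/2)` times the class of `Pₙ₊ₖ ⟶ Qₖ ⟶ Q̃ₖ` in `Extⁿ⁺ᵏ(A, Q̃ₖ)`. (The sign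
accounts for the signs in the differentials and makes the value independent of `k`.) -/
def IsComparison {n : ℤ} (Φ : HypExt P.complex Q.complex n ≃+ ResExt P Q n) : Prop :=
  ∀ (φ : Hyp P.complex Q.complex n) (hφ : IsAlmostCocycle φ) (k : ℕ),
    (∀ p, k ≤ p.1.2 → hypD _ _ n (n + 1) rfl φ p = 0) →
    ∃ h : syzComp P Q φ k ∈ homCocycles P.complex (syz Q k) (n + k),
      Φ (hypMk φ hφ) = (-1 : ℤˣ) ^ (k * (k + 1) / 2) • resIota P Q n k (extMk ⟨_, h⟩)

end Comparison

/-! ### Tensor products -/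

/-- A tensor product on an abelian category `C` of module objects, with `R` the ground ring
regarded as an object of `C`: a bi-additive associative bifunctor with natural isomorphisms
`R ⊗ M ≅ M ≅ M ⊗ R` for which the tensor product of two projectives is projective. -/
structure TensorProd (R : C) where
  /-- The bifunctor `⊗`. -/
  F : C ⥤ C ⥤ C
  additive_left : F.Additive
  additive_right : ∀ X, (F.obj X).Additive
  /-- Associativity. -/
  assoc : bifunctorComp₁₂ F F ≅ bifunctorComp₂₃ F F
  /-- `R ⊗ M ≅ M`. -/
  leftUnit : F.obj R ≅ 𝟭 C
  /-- `M ⊗ R ≅ M`. -/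
  rightUnit : F.flip.obj R ≅ 𝟭 C
  projective : ∀ X Y, Projective X → Projective Y → Projective ((F.obj X).obj Y)

attribute [instance] TensorProd.additive_left TensorProd.additive_right

namespace TensorProd

variable {R : C} (T : TensorProd R)

instance (X : C) : (T.F.flip.obj X).Additive where
  map_add {Y Z f g} := by simp [Functor.map_add]

/-- `X ⊗ Y`. -/
abbrev ob (X Y : C) : C := (T.F.obj X).obj Y

/-- `f ⊗ g`. -/
def mor {X X' Y Y' : C} (f : X ⟶ X') (g : Y ⟶ Y') : T.ob X Y ⟶ T.ob X' Y' :=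
  (T.F.map f).app Y ≫ (T.F.obj X').map g

lemma map_app_mor {X X' X'' Y Y' : C} (f : X ⟶ X') (f' : X' ⟶ X'') (g : Y ⟶ Y') :
    (T.F.map f).app Y ≫ T.mor f' g = T.mor (f ≫ f') g := by
  simp [mor]

lemma map_mor {X X' Y Y' Y'' : C} (f : X ⟶ X') (g : Y ⟶ Y') (g' : Y' ⟶ Y'') :
    (T.F.obj X).map g ≫ T.mor f g' = T.mor f (g ≫ g') := by
  simp [mor]

lemma mor_comp {X X' X'' Y Y' Y'' : C} (f : X ⟶ X') (f' : X' ⟶ X'') (g : Y ⟶ Y')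
    (g' : Y' ⟶ Y'') : T.mor f g ≫ T.mor f' g' = T.mor (f ≫ f') (g ≫ g') := by
  simp [mor]

@[simp]
lemma zero_mor {X X' Y Y' : C} (g : Y ⟶ Y') : T.mor (0 : X ⟶ X') g = 0 := by
  simp [mor]

@[simp]
lemma mor_zero {X X' Y Y' : C} (f : X ⟶ X') : T.mor f (0 : Y ⟶ Y') = 0 := by
  simp [mor]

lemma mor_id_comp (X : C) {Y Y' Y'' : C} (g : Y ⟶ Y') (g' : Y' ⟶ Y'') (h : g ≫ g' = 0) :
    T.mor (𝟙 X) g ≫ T.mor (𝟙 X) g' = 0 := by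
  rw [mor_comp, h, mor_zero]

lemma mor_comp_id (Y : C) {X X' X'' : C} (f : X ⟶ X') (f' : X' ⟶ X'') (h : f ≫ f' = 0) :
    T.mor f (𝟙 Y) ≫ T.mor f' (𝟙 Y) = 0 := by
  rw [mor_comp, h, zero_mor]

instance hasTensor (K L : ChainComplex C ℕ) :
    HomologicalComplex.HasMapBifunctor K L T.F (ComplexShape.down ℕ) := fun n => by
  have : Finite ((fun p : ℕ × ℕ => p.1 + p.2) ⁻¹' {n}) :=
    Set.Finite.subset (Set.finite_Iic (n, n)) (by
      rintro ⟨i, j⟩ h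
      simp only [Set.mem_preimage, Set.mem_singleton_iff] at h
      simp only [Set.mem_Iic, Prod.mk_le_mk]
      lia)
  have : HasColimitsOfShape (Discrete ((fun p : ℕ × ℕ => p.1 + p.2) ⁻¹' {n})) C := inferInstance
  exact HasColimitsOfShape.has_colimit _

/-- The tensor product of chain complexes, with differential `d ⊗ 1 + (-1)ⁱ (1 ⊗ d)` on the
summand `Kᵢ ⊗ Lⱼ`. -/
abbrev tensorComplex (K L : ChainComplex C ℕ) : ChainComplex C ℕ :=
  HomologicalComplex.mapBifunctor K L T.F (ComplexShape.down ℕ)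

/-- The morphism `(K ⊗ L)ₙ ⟶ X` that is given by `f i j` on the summand `Kᵢ ⊗ Lⱼ`. -/
def desc {K L : ChainComplex C ℕ} {X : C} (n : ℕ)
    (f : ∀ i j : ℕ, T.ob (K.X i) (L.X j) ⟶ X) : (T.tensorComplex K L).X n ⟶ X :=
  HomologicalComplex.mapBifunctorDesc (fun i j _ => f i j)

section Resolutions

variable {A A' : C} (P : ProjectiveResolution A) (P' : ProjectiveResolution A')

lemma d_tensorAug : (T.tensorComplex P.complex P'.complex).d 1 0 ≫
    T.desc 0 (fun i j => T.mor (aug P i) (aug P' j)) = 0 := by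
  apply HomologicalComplex.mapBifunctor.hom_ext
  intro i j hij
  replace hij : i + j = 1 := hij
  rw [comp_zero, HomologicalComplex.mapBifunctor.d_eq, Preadditive.add_comp,
    Preadditive.comp_add, HomologicalComplex.mapBifunctor.ι_D₁_assoc,
    HomologicalComplex.mapBifunctor.ι_D₂_assoc]
  have h₁ : HomologicalComplex.mapBifunctor.d₁ P.complex P'.complex T.F
      (ComplexShape.down ℕ) i j 0 ≫ T.desc 0 (fun i j => T.mor (aug P i) (aug P' j)) = 0 := by
    cases i with
    | zero =>
      rw [HomologicalComplex.mapBifunctor.d₁_eq_zero _ _ _ _ _ _ _ (by simp), zero_comp]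
    | succ i =>
      rw [HomologicalComplex.mapBifunctor.d₁_eq _ _ _ _
        (show (ComplexShape.down ℕ).Rel (i + 1) i by simp) _ _ (show i + j = 0 by lia),
        Linear.units_smul_comp, Category.assoc, desc, HomologicalComplex.ι_mapBifunctorDesc,
        map_app_mor, d_aug, zero_mor, smul_zero]
  have h₂ : HomologicalComplex.mapBifunctor.d₂ P.complex P'.complex T.F
      (ComplexShape.down ℕ) i j 0 ≫ T.desc 0 (fun i j => T.mor (aug P i) (aug P' j)) = 0 := by
    cases j with
    | zero =>
      rw [HomologicalComplex.mapBifunctor.d₂_eq_zero _ _ _ _ _ _ _ (by simp), zero_comp]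
    | succ j =>
      rw [HomologicalComplex.mapBifunctor.d₂_eq _ _ _ _ _
        (show (ComplexShape.down ℕ).Rel (j + 1) j by simp) _ (show i + j = 0 by lia),
        Linear.units_smul_comp, Category.assoc, desc, HomologicalComplex.ι_mapBifunctorDesc,
        map_mor, d_aug, mor_zero, smul_zero]
  rw [h₁, h₂, add_zero]

/-- The augmentation `P ⊗ P' ⟶ A ⊗ A'`. -/
def tensorAug : T.tensorComplex P.complex P'.complex ⟶
    (ChainComplex.single₀ C).obj (T.ob A A') :=
  (ChainComplex.toSingle₀Equiv _ _).symm ⟨_, T.d_tensorAug P P'⟩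

lemma projective_tensorComplex (n : ℕ) :
    Projective ((T.tensorComplex P.complex P'.complex).X n) where
  factors f e _ := by
    have hp : ∀ i j, Projective (T.ob (P.complex.X i) (P'.complex.X j)) := fun i j =>
      T.projective _ _ (P.projective i) (P'.projective j)
    refine ⟨HomologicalComplex.mapBifunctorDesc (fun i j h => Projective.factorThru
      (HomologicalComplex.ιMapBifunctor P.complex P'.complex T.F _ i j n h ≫ f) e), ?_⟩
    apply HomologicalComplex.mapBifunctor.hom_ext
    intro i j h
    simp

/-- If the augmentation `P ⊗ P' ⟶ A ⊗ A'` is a quasi-isomorphism, then `P ⊗ P'` is a projective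
resolution of `A ⊗ A'`. -/
def tensorRes (h : QuasiIso (T.tensorAug P P')) : ProjectiveResolution (T.ob A A') where
  complex := T.tensorComplex P.complex P'.complex
  projective := T.projective_tensorComplex P P'
  π := T.tensorAug P P'
  quasiIso := h

end Resolutions

/-- The functors `X ⊗ -` and `- ⊗ X` are exact and preserve projectives. -/
structure ExactProjective (X : C) : Prop where
  exact_left : ∀ S : ShortComplex C, S.ShortExact → (S.map (T.F.obj X)).ShortExact
  exact_right : ∀ S : ShortComplex C, S.ShortExact → (S.map (T.F.flip.obj X)).ShortExact
  projective_left : (T.F.obj X).PreservesProjectiveObjects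
  projective_right : (T.F.flip.obj X).PreservesProjectiveObjects

/-- The cochain-level external product `Hom(Kₘ, B) × Hom(Lₙ, E) ⟶ Hom((K ⊗ L)ₘ₊ₙ, B ⊗ E)`,
`(u, w) ↦ (-1)ᵐⁿ (u ⊗ w) ∘ p`, with `p` the projection of `(K ⊗ L)ₘ₊ₙ` to `Kₘ ⊗ Lₙ`. -/
def extProd {K L : ChainComplex C ℕ} {B E : C} {m n : ℤ} (u : HomCochain K B m)
    (w : HomCochain L E n) (l : ℤ) (_ : m + n = l) :
    HomCochain (T.tensorComplex K L) (T.ob B E) l :=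
  fun i => T.desc i.1 fun a b =>
    if h : (a : ℤ) = m ∧ (b : ℤ) = n then
      (m * n).negOnePow • T.mor (u ⟨a, h.1⟩) (w ⟨b, h.2⟩)
    else 0

end TensorProd

/-! ### The resolutions `B_• ⊗ᵒ E_•` of `B ⊗ E` -/

/-- The sequences `o` in which both values occur infinitely often. The value `true` at `k` means
that the `k`-th step is made in the resolution of `B`, the value `false` that it is made in the
resolution of `E`. -/
def Admissible (o : ℕ → Bool) : Prop :=
  ∀ N, (∃ k, N ≤ k ∧ o k = true) ∧ ∃ k, N ≤ k ∧ o k = false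

/-- One step from the pair of indices `s`. -/
def step (b : Bool) (s : ℕ × ℕ) : ℕ × ℕ :=
  match b with
  | true => (s.1 + 1, s.2)
  | false => (s.1, s.2 + 1)

/-- The pair `(P(o)ₖ, D(o)ₖ)` that counts the occurrences of the two values among the first `k`
terms of `o`. -/
def counts (o : ℕ → Bool) : ℕ → ℕ × ℕ
  | 0 => (0, 0)
  | k + 1 => step (o k) (counts o k)

lemma counts_sum (o : ℕ → Bool) (k : ℕ) : (counts o k).1 + (counts o k).2 = k := by
  induction k with
  | zero => rfl
  | succ k ih =>
    simp only [counts, step]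
    split <;> simp only <;> lia

lemma counts_degree (o : ℕ → Bool) (k : ℕ) (m n : ℤ) :
    m + ((counts o k).1 : ℤ) + (n + ((counts o k).2 : ℤ)) = m + n + k := by
  have := counts_sum o k
  lia

/-- The sign of the identification of the direct limit of the groups
`Extᵐ⁺ⁿ⁺ᵏ(A ⊗ C, B̃_{P(o)ₖ} ⊗ Ẽ_{D(o)ₖ})`, whose transition maps are the connecting homomorphisms
`δ` for steps in the resolution of `B` and `(-1)^(m + P(o)ₖ) δ` for steps in the resolution of `E`,
with the limit along the unsigned connecting homomorphisms. -/
def resSign (m : ℤ) (o : ℕ → Bool) : ℕ → ℤˣ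
  | 0 => 1
  | k + 1 => resSign m o k *
      match o k with
      | true => 1
      | false => (m + (counts o k).1).negOnePow

/-- The signs that make `φ ⊗ᵒ ψ` satisfy the cocycle condition. -/
def hypSign (m n : ℤ) (o : ℕ → Bool) : ℕ → ℤˣ
  | 0 => (m * n).negOnePow
  | k + 1 => hypSign m n o k *
      match o k with
      | true => n.negOnePow
      | false => (-1) ^ (counts o k).1

namespace TensorProd

variable {R : C} (T : TensorProd R)

section OTensor

variable {B E : C} (PB : ProjectiveResolution B) (PE : ProjectiveResolution E)

/-- `B̃ₚ ⊗ Ẽ_q` for `s = (p, q)`. -/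
abbrev syzOb (s : ℕ × ℕ) : C := T.ob (syz PB s.1) (syz PE s.2)

/-- `Bₚ ⊗ Ẽ_q` if the next step is made in the resolution of `B`, otherwise `B̃ₚ ⊗ E_q`. -/
def stepOb (b : Bool) (s : ℕ × ℕ) : C :=
  match b with
  | true => T.ob (PB.complex.X s.1) (syz PE s.2)
  | false => T.ob (syz PB s.1) (PE.complex.X s.2)

/-- The projection to `B̃ₚ ⊗ Ẽ_q`. -/
def stepPi (b : Bool) (s : ℕ × ℕ) : T.stepOb PB PE b s ⟶ T.syzOb PB PE s :=
  match b with
  | true => T.mor (syzPi PB s.1) (𝟙 (syz PE s.2))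
  | false => T.mor (𝟙 (syz PB s.1)) (syzPi PE s.2)

/-- The inclusion of `B̃ₚ₊₁ ⊗ Ẽ_q` or `B̃ₚ ⊗ Ẽ_{q+1}`. -/
def stepIota (b : Bool) (s : ℕ × ℕ) : T.syzOb PB PE (step b s) ⟶ T.stepOb PB PE b s :=
  match b with
  | true => T.mor (syzIota PB s.1) (𝟙 (syz PE s.2))
  | false => T.mor (𝟙 (syz PB s.1)) (syzIota PE s.2)

lemma stepIota_stepPi (b : Bool) (s : ℕ × ℕ) :
    T.stepIota PB PE b s ≫ T.stepPi PB PE b s = 0 := by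
  cases b
  · exact T.mor_id_comp _ _ _ (syzIota_syzPi PE s.2)
  · exact T.mor_comp_id _ _ _ (syzIota_syzPi PB s.1)

variable (o : ℕ → Bool)

/-- The projection from the `k`-th term of `B_• ⊗ᵒ E_•` to its `k`-th syzygy. -/
abbrev oPi (k : ℕ) : T.stepOb PB PE (o k) (counts o k) ⟶ T.syzOb PB PE (counts o k) :=
  T.stepPi PB PE (o k) (counts o k)

/-- The inclusion of the `(k+1)`-st syzygy of `B_• ⊗ᵒ E_•` in the `k`-th term. -/
abbrev oIota (k : ℕ) :
    T.syzOb PB PE (counts o (k + 1)) ⟶ T.stepOb PB PE (o k) (counts o k) :=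
  T.stepIota PB PE (o k) (counts o k)

lemma oIota_oPi (k : ℕ) : T.oIota PB PE o k ≫ T.oPi PB PE o k = 0 :=
  T.stepIota_stepPi PB PE (o k) (counts o k)

/-- The complex `B_• ⊗ᵒ E_•`, with `k`-th term `B_{P(o)ₖ} ⊗ Ẽ_{D(o)ₖ}` or
`B̃_{P(o)ₖ} ⊗ E_{D(o)ₖ}`. -/
def oComplex : ChainComplex C ℕ :=
  ChainComplex.of (fun k => T.stepOb PB PE (o k) (counts o k))
    (fun k => T.oPi PB PE o (k + 1) ≫ T.oIota PB PE o k) (fun k => by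
      rw [Category.assoc, ← Category.assoc (T.oIota PB PE o (k + 1)), oIota_oPi, zero_comp,
        comp_zero])

lemma oComplex_d (k : ℕ) :
    (T.oComplex PB PE o).d (k + 1) k = T.oPi PB PE o (k + 1) ≫ T.oIota PB PE o k :=
  ChainComplex.of_d (fun k => T.stepOb PB PE (o k) (counts o k))
    (fun k => T.oPi PB PE o (k + 1) ≫ T.oIota PB PE o k) k

/-- The augmentation `B_• ⊗ᵒ E_• ⟶ B ⊗ E`. -/
def oAug : T.oComplex PB PE o ⟶ (ChainComplex.single₀ C).obj (T.ob B E) :=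
  (ChainComplex.toSingle₀Equiv _ _).symm ⟨T.oPi PB PE o 0, by
    refine Eq.trans (congrArg (fun t => t ≫ T.oPi PB PE o 0) (T.oComplex_d PB PE o 0)) ?_
    exact (Category.assoc _ _ _).trans
      ((congrArg (fun t => T.oPi PB PE o 1 ≫ t) (T.oIota_oPi PB PE o 0)).trans comp_zero)⟩

/-- A chain map from `B_• ⊗ᵒ E_•` to a projective resolution `Q` of `B ⊗ E` that lifts the identity
of `B ⊗ E`, together with the induced morphisms of the syzygies. -/
structure OLift (Q : ProjectiveResolution (T.ob B E)) where
  /-- The chain map. -/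
  f : T.oComplex PB PE o ⟶ Q.complex
  /-- The induced morphisms of the syzygies. -/
  g : ∀ k, T.syzOb PB PE (counts o k) ⟶ syz Q k
  g_zero : g 0 = 𝟙 (T.ob B E)
  pi_comm : ∀ k, T.oPi PB PE o k ≫ g k = f.f k ≫ syzPi Q k
  iota_comm : ∀ k, T.oIota PB PE o k ≫ f.f k = g (k + 1) ≫ syzIota Q k

end OTensor

/-! ### External products -/

section Products

variable {A B A' B' : C} (PA : ProjectiveResolution A) (PA' : ProjectiveResolution A')
  (PB : ProjectiveResolution B) (PB' : ProjectiveResolution B')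

/-- The morphism `Aᵢ ⊗ A'ⱼ ⟶ Bₚ ⊗ B̃'_q` or `Aᵢ ⊗ A'ⱼ ⟶ B̃ₚ ⊗ B'_q` that is
`φₘ₊ₚ ⊗ (π ∘ ψₙ₊_q)` or `(π ∘ φₘ₊ₚ) ⊗ ψₙ₊_q` for `i = m + p` and `j = n + q`, and zero
otherwise. -/
def stepProd {m n : ℤ} (φ : Hyp PA.complex PB.complex m) (ψ : Hyp PA'.complex PB'.complex n)
    (b : Bool) (s : ℕ × ℕ) (i j : ℕ) :
    T.ob (PA.complex.X i) (PA'.complex.X j) ⟶ T.stepOb PB PB' b s :=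
  if h : (i : ℤ) = s.1 + m ∧ (j : ℤ) = s.2 + n then
    match b with
    | true => T.mor (φ ⟨(i, s.1), h.1⟩) (ψ ⟨(j, s.2), h.2⟩ ≫ syzPi PB' s.2)
    | false => T.mor (φ ⟨(i, s.1), h.1⟩ ≫ syzPi PB s.1) (ψ ⟨(j, s.2), h.2⟩)
  else 0

/-- The cochain `φ ⊗ᵒ ψ`. -/
def oProd (o : ℕ → Bool) {m n : ℤ} (φ : Hyp PA.complex PB.complex m)
    (ψ : Hyp PA'.complex PB'.complex n) :
    Hyp (T.tensorComplex PA.complex PA'.complex) (T.oComplex PB PB' o) (m + n) :=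
  fun p => hypSign m n o p.1.2 • T.desc p.1.1
    (fun i j => T.stepProd PA PA' PB PB' φ ψ (o p.1.2) (counts o p.1.2) i j)

variable {PA PA' PB PB'}
  {hA : QuasiIso (T.tensorAug PA PA')} {Q : ProjectiveResolution (T.ob B B')} {m n : ℤ}

/-- `v` is the external product of completed `Ext` groups in the resolution construction: for every
admissible `o` it is the direct limit over `k` of the external products
`Ext^{m+P(o)ₖ}(A, B̃_{P(o)ₖ}) × Ext^{n+D(o)ₖ}(A', B̃'_{D(o)ₖ}) ⟶
  Ext^{m+n+k}(A ⊗ A', B̃_{P(o)ₖ} ⊗ B̃'_{D(o)ₖ})`,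
where the groups on the right are compared with those of the resolution `Q` of `B ⊗ B'` by lifts of
the identity. -/
def IsResProduct
    (v : ResExt PA PB m →+ ResExt PA' PB' n →+ ResExt (T.tensorRes PA PA' hA) Q (m + n)) : Prop :=
  ∀ (o : ℕ → Bool), Admissible o → ∀ (ℓ : T.OLift PB PB' o Q) (k : ℕ)
    (x : homCocycles PA.complex (syz PB (counts o k).1) (m + (counts o k).1))
    (y : homCocycles PA'.complex (syz PB' (counts o k).2) (n + (counts o k).2)),
    ∃ h : homPost _ (ℓ.g k) _ (T.extProd x.1 y.1 (m + n + k) (counts_degree o k m n)) ∈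
        homCocycles (T.tensorRes PA PA' hA).complex (syz Q k) (m + n + k),
      v (resIota PA PB m _ (extMk x)) (resIota PA' PB' n _ (extMk y)) =
        resSign m o k • resIota (T.tensorRes PA PA' hA) Q (m + n) k (extMk ⟨_, h⟩)

/-- `v` is the external product of completed `Ext` groups in the hypercohomology construction: for
every admissible `o` it sends the classes of almost cocycles `φ` and `ψ` to the class of
the almost cocycle `φ ⊗ᵒ ψ`, where the resolution `B_• ⊗ᵒ B'_•` of `B ⊗ B'` is compared
with `Q` by lifts of the identity. -/
def IsHypProduct
    (v : HypExt PA.complex PB.complex m →+ HypExt PA'.complex PB'.complex n →+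
      HypExt (T.tensorRes PA PA' hA).complex Q.complex (m + n)) : Prop :=
  ∀ (o : ℕ → Bool), Admissible o →
    ∀ (φ : Hyp PA.complex PB.complex m) (hφ : IsAlmostCocycle φ)
      (ψ : Hyp PA'.complex PB'.complex n) (hψ : IsAlmostCocycle ψ),
      IsAlmostCocycle (T.oProd PA PA' PB PB' o φ ψ) ∧
      ∀ ℓ : T.OLift PB PB' o Q,
        ∃ h : IsAlmostCocycle (hypPost ℓ.f (T.oProd PA PA' PB PB' o φ ψ)),
          v (hypMk φ hφ) (hypMk ψ hψ) =
            hypMk (K := (T.tensorRes PA PA' hA).complex) _ h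

end Products

/-- External products of completed unenriched `Ext` groups exist for the tensor product `T`, and
the resolution and the hypercohomology construction of them agree: whenever `A_• ⊗ A'_•`
is a resolution of `A ⊗ A'` and tensoring with the syzygies of `B_•` and `B'_•` is exact and
preserves projectives,
* every `B_• ⊗ᵒ B'_•` is a projective resolution of `B ⊗ B'` (so that the identity of `B ⊗ B'` lifts
  to any other resolution `Q`);
* in all degrees `m, n ∈ ℤ` there is exactly one biadditive map `vRes` that is given by the
  resolution construction, and exactly one biadditive map `vHyp` that is given by the
  hypercohomology construction;
* the canonical isomorphisms between the two constructions of `Êxt` carry `vHyp` to `vRes`. -/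
def HasExternalProducts : Prop :=
  ∀ {A A' B B' : C} (PA : ProjectiveResolution A) (PA' : ProjectiveResolution A')
    (hA : QuasiIso (T.tensorAug PA PA'))
    (PB : ProjectiveResolution B) (PB' : ProjectiveResolution B'),
    (∀ k, T.ExactProjective (syz PB k)) → (∀ k, T.ExactProjective (syz PB' k)) →
    (∀ o, Admissible o →
      (∀ k, Projective ((T.oComplex PB PB' o).X k)) ∧ QuasiIso (T.oAug PB PB' o)) ∧
    ∀ Q : ProjectiveResolution (T.ob B B'),
      (∀ o, Admissible o → Nonempty (T.OLift PB PB' o Q)) ∧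
      ∀ m n : ℤ,
        ∃ (vRes : ResExt PA PB m →+ ResExt PA' PB' n →+
            ResExt (T.tensorRes PA PA' hA) Q (m + n))
          (vHyp : HypExt PA.complex PB.complex m →+ HypExt PA'.complex PB'.complex n →+
            HypExt (T.tensorRes PA PA' hA).complex Q.complex (m + n)),
          T.IsResProduct vRes ∧ (∀ v, T.IsResProduct (hA := hA) (Q := Q) v → v = vRes) ∧
          T.IsHypProduct vHyp ∧ (∀ v, T.IsHypProduct (hA := hA) (Q := Q) v → v = vHyp) ∧
          ∃ (Φ : HypExt PA.complex PB.complex m ≃+ ResExt PA PB m)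
            (Ψ : HypExt PA'.complex PB'.complex n ≃+ ResExt PA' PB' n)
            (Θ : HypExt (T.tensorRes PA PA' hA).complex Q.complex (m + n) ≃+
              ResExt (T.tensorRes PA PA' hA) Q (m + n)),
            IsComparison PA PB Φ ∧ IsComparison PA' PB' Ψ ∧
            IsComparison (T.tensorRes PA PA' hA) Q Θ ∧
            ∀ x y, Θ (vHyp x y) = vRes (Φ x) (Ψ y)

/-- A chain map `S₃ ⟶ S₁ ⊗ S₂` of resolutions of `R` that lifts the isomorphism `R ≅ R ⊗ R`. -/
def IsDiagonal (S₁ S₂ S₃ : ProjectiveResolution R)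
    (Δ : S₃.complex ⟶ T.tensorComplex S₁.complex S₂.complex) : Prop :=
  Δ ≫ T.tensorAug S₁ S₂ ≫ (ChainComplex.single₀ C).map (T.leftUnit.hom.app R) = S₃.π

end TensorProd

/-! ### Complete group cohomology -/

section GroupCohomology

variable {S : Type u} [Category.{v} S] [CartesianMonoidalCategory S] [BraidedCategory S]
  {R G : S} [RingObj R] [GrpObj G] [Abelian (RGMod R G)] {M : RGMod R G}

/-- Complete unenriched group cohomology `Ĥⁿ_R(G, M) = Êxtⁿ(R, M)` in the resolution construction,
for a projective resolution `P` of the trivial module `R` in `Mod_R(G)`. -/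
abbrev ResCoh (P : ProjectiveResolution (RGMod.trivial R G)) (PM : ProjectiveResolution M)
    (n : ℤ) : Type v :=
  ResExt P PM n

/-- Complete unenriched group cohomology `Ĥⁿ_R(G, M) = Êxtⁿ(R, M)` in the hypercohomology
construction. -/
abbrev HypCoh (P : ProjectiveResolution (RGMod.trivial R G)) (PM : ProjectiveResolution M)
    (n : ℤ) : Type v :=
  HypExt P.complex PM.complex n

end GroupCohomology

end
end CompletedExt

/-!
# External products and cup products of completed `Ext` groups

Everything except the last step takes place in an arbitrary abelian category with a tensor product.

*The two constructions agree.* An almost cocycle `φ` of the hypercohomology complex satisfies the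
cocycle condition from some degree `k` on, and its `k`-th component, projected to the syzygy `B̃ₖ`,
is then a cocycle. The connecting homomorphism sends its class to `(-1)ᵏ⁺¹` times that of the next
component (`delta_syzClass`), so the class with the sign `(-1)^{k(k+1)/2}` is a well-defined element
of the direct limit. Conversely, a cocycle with values in `B̃ₖ`, as well as a primitive of one, is
extended to higher degrees step by step, because the terms of the resolution of `A` are projective
(`exists_hypD_eq`). Hence the map to the direct limit is surjective and its kernel consists of the
coboundaries (`exists_isComparison`).

*The product in the resolution construction.* A lift of the identity of `B ⊗ E` along a sequence of
steps is a repeated dimension shift, and yields morphisms `B̃ₚ ⊗ Ẽ_q ⟶ Q̃ₖ` with `k = p + q`. The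
two orders of a `B`-step and an `E`-step lead to opposite morphisms, up to a morphism that factors
through `Qₖ` (`stablyEq_neg_of_isShift`). If `E`-steps are given the sign `(-1)ᵖ`, all orders thus
yield the same stable class (`Reach.stablyEq`), and since the connecting homomorphism vanishes on
classes that lift to `Qₖ`, the same map to the direct limit (`resIota_extPost_congr`). By the
Leibniz rule `homD_extProd` the external products of ordinary `Ext` groups, followed by these maps,
commute with the connecting homomorphisms in each variable up to signs, which `resTerm` corrects. So
they descend to the direct limits (`exists_isResProduct`). Uniqueness holds because every pair
`(p, q)` is reached by some admissible sequence of steps.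

*The product in the hypercohomology construction.* The same Leibniz rule shows that `φ ⊗ᵒ ψ`
satisfies the cocycle condition as soon as enough steps have been made (`cocycleFrom_oProd`). Its
projection to a syzygy is the external product of the projections of `φ` and `ψ`, with a sign that
agrees with those of the canonical isomorphisms (`hypSign_eq`). Therefore the product of the
resolution construction, transported through the canonical isomorphisms, has the property that
characterizes the product of the hypercohomology construction (`IsResProduct.isHypProduct`).

*Cup products.* A projective resolution of a projective object is homotopy equivalent to that
object, so the tensor product of two such resolutions is again a resolution
(`quasiIso_tensorAug_of_projective`). The restriction functor is faithful and exact, hence reflects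
quasi-isomorphisms, and it is compatible with tensor products of complexes; so the tensor product of
resolutions of `R` is a resolution already with the action of `G` (`quasiIso_tensorAug_of_functor`).
Diagonal approximations then exist and are unique up to homotopy, and external products are pulled
back along them (`exists_cup`).
-/


namespace CompletedExt

noncomputable section

variable {C : Type u} [Category.{v} C] [Abelian C]

/-! ### Functoriality of `Ext` in the second variable -/

lemma extMk_surjective {K : ChainComplex C ℕ} {B : C} {n : ℤ} (x : ExtGrp K B n) :
    ∃ u : homCocycles K B n, extMk u = x :=
  QuotientAddGroup.mk_surjective x

lemma homPost_mem_cocycles {K : ChainComplex C ℕ} {B B' : C} (g : B ⟶ B') {n : ℤ}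
    {u : HomCochain K B n} (hu : u ∈ homCocycles K B n) :
    homPost K g n u ∈ homCocycles K B' n := by
  rw [AddMonoidHom.mem_ker] at hu ⊢
  rw [homD_post, hu, map_zero]

/-- The homomorphism `Extⁿ(A, B) ⟶ Extⁿ(A, B')` induced by a morphism `g : B ⟶ B'`. -/
def extPost (K : ChainComplex C ℕ) {B B' : C} (g : B ⟶ B') (n : ℤ) :
    ExtGrp K B n →+ ExtGrp K B' n :=
  QuotientAddGroup.lift _
    (extMk.comp (((homPost K g n).comp (homCocycles K B n).subtype).codRestrict
      (homCocycles K B' n) (fun u => homPost_mem_cocycles g u.2)))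
    (by
      rintro ⟨u, hu⟩ ⟨w, hw⟩
      rw [AddMonoidHom.mem_ker, ← map_zero extMk]
      refine (extMk_eq_iff _ _).2 ⟨homPost K g _ w, ?_⟩
      rw [homD_post, hw]
      simp)

lemma extPost_mk {K : ChainComplex C ℕ} {B B' : C} (g : B ⟶ B') {n : ℤ} (u : homCocycles K B n) :
    extPost K g n (extMk u) = extMk ⟨homPost K g n u.1, homPost_mem_cocycles g u.2⟩ :=
  rfl

lemma homPost_comp (K : ChainComplex C ℕ) {B B' B'' : C} (g : B ⟶ B') (g' : B' ⟶ B'') (n : ℤ)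
    (u : HomCochain K B n) :
    homPost K g' n (homPost K g n u) = homPost K (g ≫ g') n u := by
  ext i
  exact Category.assoc _ _ _

lemma homPost_sub (K : ChainComplex C ℕ) {B B' : C} (g g' : B ⟶ B') (n : ℤ)
    (u : HomCochain K B n) :
    homPost K (g - g') n u = homPost K g n u - homPost K g' n u := by
  ext i
  exact Preadditive.comp_sub _ _ _

lemma homPost_units_smul (K : ChainComplex C ℕ) {B B' : C} (ε : ℤˣ) (g : B ⟶ B') (n : ℤ)
    (u : HomCochain K B n) :
    homPost K (ε • g) n u = ε • homPost K g n u := by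
  ext i
  exact Linear.comp_units_smul _ _ _

@[simp]
lemma homPost_id (K : ChainComplex C ℕ) (B : C) (n : ℤ) (u : HomCochain K B n) :
    homPost K (𝟙 B) n u = u := by
  ext i
  exact Category.comp_id _

@[simp]
lemma homPost_zero (K : ChainComplex C ℕ) (B B' : C) (n : ℤ) (u : HomCochain K B n) :
    homPost K (0 : B ⟶ B') n u = 0 := by
  ext i
  exact comp_zero

lemma extPost_sub (K : ChainComplex C ℕ) {B B' : C} (g g' : B ⟶ B') (n : ℤ)
    (x : ExtGrp K B n) :
    extPost K (g - g') n x = extPost K g n x - extPost K g' n x := by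
  obtain ⟨u, rfl⟩ := extMk_surjective x
  simp only [extPost_mk, ← map_sub]
  exact congrArg extMk (Subtype.ext (homPost_sub K g g' n u.1))

lemma extPost_units_smul (K : ChainComplex C ℕ) {B B' : C} (ε : ℤˣ) (g : B ⟶ B') (n : ℤ)
    (x : ExtGrp K B n) :
    extPost K (ε • g) n x = ε • extPost K g n x := by
  obtain ⟨u, rfl⟩ := extMk_surjective x
  simp only [extPost_mk]
  rw [← map_zsmul_unit]
  exact congrArg extMk (Subtype.ext (homPost_units_smul K ε g n u.1))

/-! ### The direct limit of the resolution construction -/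

section Limit

variable {A B : C} (P : ProjectiveResolution A) (Q : ProjectiveResolution B) (n : ℤ)

/-- The transition homomorphism of the direct system that defines `ResExt P Q n`. -/
def delta (k : ℕ) : ExtGrp P.complex (syz Q k) (n + k) →+
    ExtGrp P.complex (syz Q (k + 1)) (n + (k + 1 : ℕ)) :=
  connecting P (syzSeq_shortExact Q k) (n + k) (n + (k + 1 : ℕ)) (by push_cast; lia)

lemma resSystem_map_succ (k : ℕ) (x : ExtGrp P.complex (syz Q k) (n + k)) :
    ((resSystem P Q n).map (homOfLE (Nat.le_succ k))).hom x = delta P Q n k x := by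
  simp only [resSystem, Functor.ofSequence_map_homOfLE_succ]
  rfl

lemma resIota_delta (k : ℕ) (x : ExtGrp P.complex (syz Q k) (n + k)) :
    resIota P Q n (k + 1) (delta P Q n k x) = resIota P Q n k x := by
  rw [← resSystem_map_succ]
  exact ConcreteCategory.congr_hom (colimit.w (resSystem P Q n) (homOfLE (Nat.le_succ k))) x

instance preservesColimit_resSystem : PreservesColimit (resSystem P Q n) (forget AddCommGrpCat) :=
  have : PreservesFilteredColimitsOfSize.{0, 0} (forget AddCommGrpCat.{v}) :=
    preservesFilteredColimitsOfSize_shrink.{0, v, 0, v} _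
  inferInstance

lemma resIota_surjective (x : ResExt P Q n) : ∃ k a, resIota P Q n k a = x :=
  Concrete.colimit_exists_rep (resSystem P Q n) x

/-- An induction principle for the elements that vanish in the direct limit: it suffices that a
property holds for `0` and descends from `δ a` to `a`. -/
lemma resIota_eq_zero_induction {M : ∀ k : ℕ, ExtGrp P.complex (syz Q k) (n + k) → Prop}
    (zero : ∀ k, M k 0) (succ : ∀ k a, M (k + 1) (delta P Q n k a) → M k a)
    {k : ℕ} {a : ExtGrp P.complex (syz Q k) (n + k)} (h : resIota P Q n k a = 0) : M k a := by
  have h' : (colimit.ι (resSystem P Q n) k).hom a = (colimit.ι (resSystem P Q n) k).hom 0 := by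
    rw [map_zero]
    exact h
  obtain ⟨j, f, g, hfg⟩ := Concrete.colimit_exists_of_rep_eq (resSystem P Q n) a 0 h'
  have hj : k ≤ j := leOfHom f
  obtain rfl : f = homOfLE hj := Subsingleton.elim _ _
  replace hfg : ((resSystem P Q n).map (homOfLE hj)).hom a = 0 :=
    hfg.trans (map_zero ((resSystem P Q n).map g).hom)
  clear h h' g
  obtain ⟨d, rfl⟩ := Nat.exists_eq_add_of_le hj
  induction d generalizing k with
  | zero =>
    have : homOfLE hj = 𝟙 k := Subsingleton.elim _ _
    rw [this, CategoryTheory.Functor.map_id] at hfg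
    replace hfg : a = 0 := hfg
    rw [hfg]
    exact zero k
  | succ d ih =>
    apply succ
    have e : k + (d + 1) = k + 1 + d := by lia
    have aux : ∀ (j : ℕ) (hj : k ≤ j) (_ : j = k + 1 + d),
        ((resSystem P Q n).map (homOfLE hj)).hom a = 0 →
        ∃ hj' : k + 1 ≤ k + 1 + d,
          ((resSystem P Q n).map (homOfLE hj')).hom (delta P Q n k a) = 0 := by
      rintro j hj rfl h0
      refine ⟨by lia, ?_⟩
      have e' : homOfLE hj = homOfLE (Nat.le_succ k) ≫ homOfLE (by lia : k + 1 ≤ k + 1 + d) :=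
        Subsingleton.elim _ _
      rw [e', Functor.map_comp] at h0
      rw [← resSystem_map_succ]
      exact h0
    obtain ⟨hj', h1⟩ := aux _ hj e hfg
    exact ih hj' h1

variable {P Q n}

/-- The homomorphism out of the direct limit that is given by a compatible family. -/
def resDesc {Z : Type v} [AddCommGroup Z]
    (f : ∀ k : ℕ, ExtGrp P.complex (syz Q k) (n + k) →+ Z)
    (hf : ∀ k a, f (k + 1) (delta P Q n k a) = f k a) : ResExt P Q n →+ Z :=
  (colimit.desc (resSystem P Q n)
    { pt := AddCommGrpCat.of Z
      ι := NatTrans.ofSequence (F := resSystem P Q n)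
        (G := (Functor.const ℕ).obj (AddCommGrpCat.of Z)) (fun k => AddCommGrpCat.ofHom (f k))
        (by
          intro k
          ext x
          exact (congrArg (f (k + 1)) (resSystem_map_succ P Q n k x)).trans (hf k x)) }).hom

lemma resDesc_iota {Z : Type v} [AddCommGroup Z]
    (f : ∀ k : ℕ, ExtGrp P.complex (syz Q k) (n + k) →+ Z)
    (hf : ∀ k a, f (k + 1) (delta P Q n k a) = f k a) (k : ℕ)
    (a : ExtGrp P.complex (syz Q k) (n + k)) :
    resDesc f hf (resIota P Q n k a) = f k a :=
  ConcreteCategory.congr_hom (colimit.ι_desc (F := resSystem P Q n) _ k) a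

/-- Homomorphisms that are compatible with the transition maps in both variables descend to a
biadditive map on the direct limits. -/
lemma exists_resDesc₂ {A' B' : C} {P' : ProjectiveResolution A'} {Q' : ProjectiveResolution B'}
    {n' : ℤ} {Z : Type v} [AddCommGroup Z]
    (W : ∀ p q : ℕ, ExtGrp P.complex (syz Q p) (n + p) →+
      ExtGrp P'.complex (syz Q' q) (n' + q) →+ Z)
    (h₁ : ∀ p q x y, W (p + 1) q (delta P Q n p x) y = W p q x y)
    (h₂ : ∀ p q x y, W p (q + 1) x (delta P' Q' n' q y) = W p q x y) :
    ∃ w : ResExt P Q n →+ ResExt P' Q' n' →+ Z, ∀ p q x y,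
      w (resIota P Q n p x) (resIota P' Q' n' q y) = W p q x y := by
  let V : ∀ q, ResExt P Q n →+ ExtGrp P'.complex (syz Q' q) (n' + q) →+ Z := fun q =>
    resDesc (fun p => W p q) (fun p x => AddMonoidHom.ext fun y => h₁ p q x y)
  have hV : ∀ q p x, V q (resIota P Q n p x) = W p q x := fun q p x => resDesc_iota _ _ _ _
  refine ⟨AddMonoidHom.flip (resDesc (fun q => (V q).flip) (fun q y => ?_)), ?_⟩
  · ext x
    obtain ⟨p, x, rfl⟩ := resIota_surjective P Q n x
    simp only [AddMonoidHom.flip_apply, hV, h₂]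
  · intro p q x y
    rw [AddMonoidHom.flip_apply, resDesc_iota, AddMonoidHom.flip_apply, hV]

end Limit

/-! ### The canonical isomorphism between the two constructions -/

/-- Dependent choice from index `k` on, with an invariant `I` and a relation `r` between
consecutive terms. The terms below `k` are irrelevant and taken from `z`. -/
lemma exists_seq {X : ℕ → Type*} (z : ∀ j, X j) (I : ∀ j, X j → Prop)
    (r : ∀ j, X j → X (j + 1) → Prop) (k : ℕ) (x₀ : X k) (h₀ : I k x₀)
    (hs : ∀ j, k ≤ j → ∀ x, I j x → ∃ x', I (j + 1) x' ∧ r j x x') :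
    ∃ s : ∀ j, X j, s k = x₀ ∧ ∀ j, k ≤ j → r j (s j) (s (j + 1)) := by
  have : ∀ j, Nonempty (X j) := fun j => ⟨z j⟩
  choose! f hf hr using hs
  let t : ∀ j, k ≤ j → {x : X j // k ≤ j ∧ I j x} := fun j hj =>
    Nat.leRec (motive := fun j _ => {x : X j // k ≤ j ∧ I j x}) ⟨x₀, le_rfl, h₀⟩
      (fun j _ x => ⟨f j x.1, hf j x.2.1 x.1 x.2.2 |> fun h => ⟨Nat.le_succ_of_le x.2.1, h⟩⟩) hj
  have t₀ : t k le_rfl = ⟨x₀, le_rfl, h₀⟩ := Nat.leRec_self _ _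
  have t₁ : ∀ j hj, (t (j + 1) (Nat.le_succ_of_le hj)).1 = f j (t j hj).1 := fun j hj =>
    congrArg Subtype.val (Nat.leRec_succ (motive := fun j _ => {x : X j // k ≤ j ∧ I j x}) _ _ hj)
  refine ⟨fun j => if h : k ≤ j then (t j h).1 else z j, ?_, fun j hj => ?_⟩
  · beta_reduce
    rw [dif_pos le_rfl, t₀]
  · beta_reduce
    rw [dif_pos hj, dif_pos (Nat.le_succ_of_le hj), t₁]
    exact hr j hj _ (t j hj).2.2

lemma units_smul_eq_zero_iff {X : Type*} [AddCommGroup X] (ε : ℤˣ) (x : X) :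
    ε • x = 0 ↔ x = 0 := by
  refine ⟨fun h => ?_, fun h => by rw [h, smul_zero]⟩
  rw [← one_smul ℤˣ x, ← Int.units_mul_self ε, mul_smul, h, smul_zero]

/-- Transport of a cochain along an equality of degrees. -/
def recast {K : ChainComplex C ℕ} {B : C} {n m : ℤ} (h : n = m) (u : HomCochain K B n) :
    HomCochain K B m :=
  fun i => u ⟨i.1, i.2.trans h.symm⟩

lemma recast_rfl {K : ChainComplex C ℕ} {B : C} {n : ℤ} (u : HomCochain K B n) :
    recast rfl u = u :=
  rfl

lemma recast_recast {K : ChainComplex C ℕ} {B : C} {n m l : ℤ} (h : n = m) (h' : m = l)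
    (u : HomCochain K B n) : recast h' (recast h u) = recast (h.trans h') u :=
  rfl

section Components

variable {K L : ChainComplex C ℕ}

/-- The components `Kₙ₊ₖ ⟶ Lₖ` of a hypercohomology cochain for a fixed `k`. The degree is a
separate variable `l`, so that different forms of `n + k` need not be identified. -/
def hypComp {n : ℤ} (φ : Hyp K L n) (k : ℕ) (l : ℤ) (hl : l = n + k) : HomCochain K (L.X k) l :=
  fun i => φ ⟨(i.1, k), i.2.trans (hl.trans (add_comm _ _))⟩

/-- The hypercohomology cochain with given components. -/
def hypOfComp {n : ℤ} (s : ∀ k : ℕ, HomCochain K (L.X k) (n + k)) : Hyp K L n :=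
  fun p => s p.1.2 ⟨p.1.1, p.2.trans (add_comm _ _)⟩

/-- The differential of the hypercohomology complex in terms of the differentials of the
complexes `Hom(K, Lₖ)`. -/
lemma hypComp_hypD {n m : ℤ} (h : n + 1 = m) (φ : Hyp K L n) (k : ℕ) (l l' : ℤ) (hl : l = n + k)
    (hl' : l + 1 = l') :
    hypComp (hypD K L n m h φ) k l' (by lia) =
      homPost K (L.d (k + 1) k) l' (hypComp φ (k + 1) l' (by push_cast; lia)) -
        n.negOnePow • homD K (L.X k) l l' hl' (hypComp φ k l hl) := by
  ext ⟨i, hi⟩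
  cases i with
  | zero =>
    refine (sub_zero _).symm.trans (congrArg₂ _ rfl ?_)
    exact (smul_zero n.negOnePow).symm
  | succ i => rfl

/-- The cochain `φ` satisfies the cocycle condition in all degrees `≥ k`. -/
def CocycleFrom {n : ℤ} (φ : Hyp K L n) (k : ℕ) : Prop :=
  ∀ p, k ≤ p.1.2 → hypD K L n (n + 1) rfl φ p = 0

lemma CocycleFrom.mono {n : ℤ} {φ : Hyp K L n} {k k' : ℕ} (h : CocycleFrom φ k) (hk : k ≤ k') :
    CocycleFrom φ k' :=
  fun p hp => h p (hk.trans hp)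

lemma CocycleFrom.add {n : ℤ} {φ ψ : Hyp K L n} {k : ℕ} (h : CocycleFrom φ k)
    (h' : CocycleFrom ψ k) : CocycleFrom (φ + ψ) k := by
  intro p hp
  rw [map_add, Pi.add_apply, h p hp, h' p hp, add_zero]

lemma CocycleFrom.eq {n : ℤ} {φ : Hyp K L n} {k : ℕ} (h : CocycleFrom φ k) {j : ℕ} (hj : k ≤ j)
    (l l' : ℤ) (hl : l = n + j) (hl' : l + 1 = l') :
    homPost K (L.d (j + 1) j) l' (hypComp φ (j + 1) l' (by push_cast; lia)) =
      n.negOnePow • homD K (L.X j) l l' hl' (hypComp φ j l hl) := by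
  rw [← sub_eq_zero, ← hypComp_hypD rfl φ j l l' hl hl']
  ext i
  exact h _ hj

lemma cocycleFrom_of_eq {n : ℤ} {φ : Hyp K L n} {k : ℕ}
    (h : ∀ j, k ≤ j → ∀ (l l' : ℤ) (hl : l = n + j) (hl' : l + 1 = l'),
      homPost K (L.d (j + 1) j) l' (hypComp φ (j + 1) l' (by push_cast; lia)) =
        n.negOnePow • homD K (L.X j) l l' hl' (hypComp φ j l hl)) : CocycleFrom φ k := by
  rintro ⟨⟨i, j⟩, hp⟩ hj
  have := hypComp_hypD rfl φ j (n + j) (n + 1 + j) rfl (by lia)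
  rw [h j hj (n + j) (n + 1 + j) rfl (by lia), sub_self] at this
  exact congrFun this ⟨i, by simpa [add_comm] using hp⟩

variable (K L) in
/-- The group of almost cocycles. -/
def almostCocycles (n : ℤ) : AddSubgroup (Hyp K L n) :=
  (bdd K L (n + 1)).comap (hypD K L n (n + 1) rfl)

variable (K L) in
/-- The class of an almost cocycle as a homomorphism. -/
def hypMkHom (n : ℤ) : almostCocycles K L n →+ HypExt K L n where
  toFun φ := hypMk φ.1 φ.2
  map_zero' := rfl
  map_add' _ _ := rfl

lemma hypMk_surjective {n : ℤ} (x : HypExt K L n) :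
    ∃ (φ : Hyp K L n) (hφ : IsAlmostCocycle φ), hypMk φ hφ = x := by
  obtain ⟨⟨y, hy⟩, rfl⟩ := QuotientAddGroup.mk_surjective x
  obtain ⟨φ, rfl⟩ := QuotientAddGroup.mk_surjective y
  exact ⟨φ, (QuotientAddGroup.eq_zero_iff _).1 hy, rfl⟩

lemma hypMk_eq_zero_iff {n : ℤ} (φ : Hyp K L n) (hφ : IsAlmostCocycle φ) :
    hypMk φ hφ = 0 ↔ ∃ χ : Hyp K L (n - 1), ∃ N : ℕ, ∀ p, N ≤ p.1.2 →
      hypD K L (n - 1) n (by lia) χ p = φ p := by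
  refine (QuotientAddGroup.eq_zero_iff _).trans ?_
  rw [AddSubgroup.mem_addSubgroupOf]
  have key : ∀ χ : Hyp K L (n - 1),
      vogD K L (n - 1) n (by lia) (QuotientAddGroup.mk χ) = QuotientAddGroup.mk φ ↔
      ∃ N : ℕ, ∀ p, N ≤ p.1.2 → hypD K L (n - 1) n (by lia) χ p = φ p := by
    intro χ
    refine (QuotientAddGroup.eq (s := bdd K L n)).trans ⟨?_, ?_⟩
    · rintro ⟨N, hN⟩
      refine ⟨N, fun p hp => ?_⟩
      have := hN p hp
      rwa [Pi.add_apply, Pi.neg_apply, neg_add_eq_zero] at this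
    · rintro ⟨N, hN⟩
      refine ⟨N, fun p hp => ?_⟩
      rw [Pi.add_apply, Pi.neg_apply, neg_add_eq_zero]
      exact hN p hp
  constructor
  · rintro ⟨w, hw⟩
    obtain ⟨χ, rfl⟩ := QuotientAddGroup.mk_surjective w
    exact ⟨χ, (key χ).1 hw⟩
  · rintro ⟨χ, hχ⟩
    exact ⟨QuotientAddGroup.mk χ, (key χ).2 hχ⟩

end Components

section Comparison

variable {A B : C} (P : ProjectiveResolution A) (Q : ProjectiveResolution B)

lemma exists_lift_syz {k : ℕ} {l : ℤ} (u : HomCochain P.complex (syz Q k) l) :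
    ∃ w : HomCochain P.complex (Q.complex.X k) l, homPost _ (syzPi Q k) l w = u :=
  ⟨_, liftCochain_post P (syzSeq_shortExact Q k) l u⟩

lemma homPost_syzIota_injective (k : ℕ) (l : ℤ) :
    Function.Injective (homPost P.complex (syzIota Q k) l) :=
  homPost_injective P (syzSeq_shortExact Q k) l

/-- A cochain with values in `Qₖ` that vanishes in the syzygy `Q̃ₖ` lifts along `d : Qₖ₊₁ ⟶ Qₖ`. -/
lemma exists_lift_d {k : ℕ} {l : ℤ} (y : HomCochain P.complex (Q.complex.X k) l)
    (hy : homPost _ (syzPi Q k) l y = 0) :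
    ∃ z : HomCochain P.complex (Q.complex.X (k + 1)) l,
      homPost _ (Q.complex.d (k + 1) k) l z = y := by
  obtain ⟨x, hx⟩ := exists_desc P (syzSeq_shortExact Q k) l y hy
  obtain ⟨z, rfl⟩ := exists_lift_syz P Q (k := k + 1) x
  refine ⟨z, ?_⟩
  rw [← syzPi_syzIota, ← hx]
  exact (homPost_comp _ (syzPi Q (k + 1)) (syzIota Q k) l _).symm

variable {P Q}

/-- A cocycle `θ` is extended to a coboundary step by step: if `χₖ` solves the equation
`d χ = θ` in degree `k` after projection to the syzygy, then `χₖ` is the component of a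
cochain `χ` with `d χ = θ` in all degrees `≥ k`. -/
lemma exists_hypD_eq {n m : ℤ} (h : n + 1 = m) {k : ℕ} (θ : Hyp P.complex Q.complex m)
    (hθ : CocycleFrom θ k) (x : HomCochain P.complex (Q.complex.X k) (n + k))
    (hx : homPost _ (syzPi Q k) (m + k) (hypComp θ k (m + k) rfl +
      n.negOnePow • homD _ _ (n + k) (m + k) (by lia) x) = 0) :
    ∃ χ : Hyp P.complex Q.complex n, hypComp χ k (n + k) rfl = x ∧
      ∀ p, k ≤ p.1.2 → hypD P.complex Q.complex n m h χ p = θ p := by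
  subst h
  obtain ⟨s, hs, hr⟩ := exists_seq (X := fun j => HomCochain P.complex (Q.complex.X j) (n + j))
    (fun j => 0)
    (fun j x => ∀ (l l' : ℤ) (hl : l = n + j) (hl' : l + 1 = l'), homPost _ (syzPi Q j) l'
      (hypComp θ j l' (by lia) + n.negOnePow • homD _ _ l l' hl' (recast hl.symm x)) = 0)
    (fun j x x' => ∀ (l l' : ℤ) (hl : l = n + j) (hl' : l + 1 = l'),
      homPost P.complex (Q.complex.d (j + 1) j) l' (recast (by push_cast; lia) x') =
        hypComp θ j l' (by lia) + n.negOnePow • homD _ _ l l' hl' (recast hl.symm x))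
    k x (by
      rintro l l' rfl hl'
      obtain rfl : l' = n + 1 + k := by lia
      exact hx) (by
      intro j hj y hy
      obtain ⟨z, hz⟩ := exists_lift_d P Q _ (hy (n + j) (n + j + 1) rfl rfl)
      refine ⟨recast (by push_cast; lia) z, ?_, ?_⟩
      · -- the obstruction in degree `j + 1` vanishes because `θ` is a cocycle and `d ∘ d = 0`
        intro l l' hl hl'
        obtain rfl : l = n + j + 1 := by rw [hl]; push_cast; lia
        subst hl'
        apply homPost_syzIota_injective P Q j
        refine Eq.trans (homPost_comp _ (syzPi Q (j + 1)) (syzIota Q j) _ _) ?_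
        rw [syzPi_syzIota, map_zero, map_add, map_zsmul_unit, ← homD_post, recast_recast,
          recast_rfl, hz, map_add, map_zsmul_unit, homD_homD, smul_zero, add_zero,
          hθ.eq hj (n + j + 1) (n + j + 1 + 1) (by lia) rfl, Int.negOnePow_succ, Units.neg_smul,
          neg_add_cancel]
      · rintro l l' rfl rfl
        rw [recast_recast, recast_rfl, hz])
  refine ⟨hypOfComp s, hs, ?_⟩
  rintro ⟨⟨i, j⟩, hp⟩ hj
  have h1 := hypComp_hypD rfl (hypOfComp s) j (n + j) (n + 1 + j) rfl (by lia)
  have h2 := hr j hj (n + j) (n + 1 + j) rfl (by lia)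
  have h3 : hypComp (hypD P.complex Q.complex n (n + 1) rfl (hypOfComp s)) j (n + 1 + j) (by lia) =
      hypComp θ j (n + 1 + j) rfl := by
    refine h1.trans (sub_eq_of_eq_add ?_)
    exact h2
  exact congrFun h3 ⟨i, by simpa [add_comm] using hp⟩

variable (P Q) in
lemma syzComp_eq {n : ℤ} (φ : Hyp P.complex Q.complex n) (k : ℕ) :
    syzComp P Q φ k = homPost _ (syzPi Q k) _ (hypComp φ k (n + k) rfl) :=
  rfl

lemma homPost_d_syzPi (k : ℕ) {l : ℤ} (u : HomCochain P.complex (Q.complex.X (k + 1)) l) :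
    homPost _ (syzPi Q k) l (homPost _ (Q.complex.d (k + 1) k) l u) = 0 := by
  rw [homPost_comp, d_syzPi, homPost_zero]

lemma CocycleFrom.syzComp_mem {n : ℤ} {φ : Hyp P.complex Q.complex n} {k : ℕ}
    (h : CocycleFrom φ k) : syzComp P Q φ k ∈ homCocycles P.complex (syz Q k) (n + k) := by
  rw [AddMonoidHom.mem_ker, syzComp_eq, homD_post]
  have := congrArg (homPost _ (syzPi Q k) _) (h.eq le_rfl (n + k) (n + k + 1) rfl rfl)
  rw [homPost_d_syzPi, map_zsmul_unit, eq_comm, units_smul_eq_zero_iff] at this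
  exact this

/-- The class of the `k`-th component of a cochain that satisfies the cocycle condition from
degree `k` on. -/
def syzClass {n : ℤ} (φ : Hyp P.complex Q.complex n) (k : ℕ) (h : CocycleFrom φ k) :
    ExtGrp P.complex (syz Q k) (n + k) :=
  extMk ⟨syzComp P Q φ k, h.syzComp_mem⟩

lemma syzClass_add {n : ℤ} {φ ψ : Hyp P.complex Q.complex n} {k : ℕ} (h : CocycleFrom φ k)
    (h' : CocycleFrom ψ k) :
    syzClass (φ + ψ) k (h.add h') = syzClass φ k h + syzClass ψ k h' := by
  simp only [syzClass, ← map_add]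
  exact congrArg extMk (Subtype.ext (map_add (homPost _ (syzPi Q k) _) (hypComp φ k (n + k) rfl)
    (hypComp ψ k (n + k) rfl)))

/-- The connecting homomorphism sends the class of the `k`-th component of an almost cocycle to
`(-1)ᵏ⁺¹` times that of the next one. -/
lemma delta_syzClass {n : ℤ} {φ : Hyp P.complex Q.complex n} {k : ℕ} (h : CocycleFrom φ k) :
    delta P Q n k (syzClass φ k h) =
      (-1 : ℤˣ) ^ (k + 1) • syzClass φ (k + 1) (h.mono (Nat.le_succ k)) := by
  have h' := h.mono (Nat.le_succ k)
  refine (connecting_mk P (syzSeq_shortExact Q k) (n + k) (n + (k + 1 : ℕ)) _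
    ⟨syzComp P Q φ k, h.syzComp_mem⟩ (hypComp φ k (n + k) rfl)
    (n.negOnePow • ⟨syzComp P Q φ (k + 1), h'.syzComp_mem⟩) rfl ?_).trans ?_
  · have := h.eq le_rfl (n + k) (n + (k + 1 : ℕ)) rfl (by push_cast; lia)
    refine Eq.trans (map_zsmul_unit (homPost P.complex (syzIota Q k) (n + (k + 1 : ℕ))) _
      (syzComp P Q φ (k + 1))) ?_
    rw [syzComp_eq, homPost_comp, syzPi_syzIota, this, smul_smul, Int.units_mul_self, one_smul]
    rfl
  · rw [map_zsmul_unit, smul_smul, ← Int.negOnePow_add, add_right_comm, Int.negOnePow_add,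
      Int.negOnePow_even _ (by simp), one_mul]
    rfl

/-- The value at an almost cocycle of the canonical isomorphism. -/
def compVal {n : ℤ} (φ : Hyp P.complex Q.complex n) (k : ℕ) (h : CocycleFrom φ k) :
    ResExt P Q n :=
  (-1 : ℤˣ) ^ (k * (k + 1) / 2) • resIota P Q n k (syzClass φ k h)

lemma negOnePow_triangle_succ (k : ℕ) :
    (-1 : ℤˣ) ^ ((k + 1) * (k + 1 + 1) / 2) = (-1) ^ (k * (k + 1) / 2) * (-1) ^ (k + 1) := by
  rw [← pow_add]
  congr 1
  have : (k + 1) * (k + 1 + 1) = k * (k + 1) + (k + 1) * 2 := by ring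
  rw [this, Nat.add_mul_div_right _ _ (by norm_num)]

/-- The signs `(-1)^{k(k+1)/2}` compensate those in `delta_syzClass`, so that the value does not
depend on `k`. -/
lemma compVal_eq_of_le {n : ℤ} {φ : Hyp P.complex Q.complex n} {k k' : ℕ} (h : CocycleFrom φ k)
    (hk : k ≤ k') : compVal φ k' (h.mono hk) = compVal φ k h := by
  induction k', hk using Nat.le_induction with
  | base => rfl
  | succ j hj ih =>
    rw [← ih, compVal, compVal, ← resIota_delta P Q n j, delta_syzClass (h.mono hj), map_zsmul_unit,
      smul_smul, negOnePow_triangle_succ]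

lemma compVal_eq {n : ℤ} {φ : Hyp P.complex Q.complex n} {k k' : ℕ} (h : CocycleFrom φ k)
    (h' : CocycleFrom φ k') : compVal φ k h = compVal φ k' h' :=
  (compVal_eq_of_le h (le_max_left k k')).symm.trans (compVal_eq_of_le h' (le_max_right k k'))

lemma IsAlmostCocycle.exists_cocycleFrom {K L : ChainComplex C ℕ} {n : ℤ} {φ : Hyp K L n}
    (h : IsAlmostCocycle φ) : ∃ k, CocycleFrom φ k :=
  h

variable (P Q) in
/-- The homomorphism from almost cocycles to the resolution construction that induces the canonical
isomorphism. -/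
def compHom (n : ℤ) : almostCocycles P.complex Q.complex n →+ ResExt P Q n :=
  AddMonoidHom.mk' (fun φ => compVal φ.1 _ (IsAlmostCocycle.exists_cocycleFrom φ.2).choose_spec) (by
    intro φ ψ
    obtain ⟨a, ha⟩ := IsAlmostCocycle.exists_cocycleFrom φ.2
    obtain ⟨b, hb⟩ := IsAlmostCocycle.exists_cocycleFrom ψ.2
    have ha' := ha.mono (le_max_left a b)
    have hb' := hb.mono (le_max_right a b)
    rw [compVal_eq _ ha', compVal_eq _ hb', compVal_eq (φ := (φ + ψ).1) _ (ha'.add hb'), compVal,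
      compVal, compVal, ← smul_add, ← map_add, ← syzClass_add]
    rfl)

lemma compHom_apply {n : ℤ} (φ : Hyp P.complex Q.complex n) (hφ : IsAlmostCocycle φ) (k : ℕ)
    (h : CocycleFrom φ k) : compHom P Q n ⟨φ, hφ⟩ = compVal φ k h :=
  compVal_eq _ _

lemma compHom_surjective (n : ℤ) : Function.Surjective (compHom P Q n) := by
  intro y
  obtain ⟨k, a, rfl⟩ := resIota_surjective P Q n y
  obtain ⟨u, rfl⟩ := extMk_surjective a
  -- the sign `ε` cancels the one in `compVal`
  let ε := (-1 : ℤˣ) ^ (k * (k + 1) / 2)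
  let v := ε • u
  have hv : homD _ _ (n + k) (n + 1 + k) (by lia) v.1 = 0 := by
    have : ∀ t (ht : n + k + 1 = t), homD _ _ (n + k) t ht v.1 = 0 := by
      rintro _ rfl
      exact v.2
    exact this _ _
  obtain ⟨w, hw⟩ := exists_lift_syz P Q v.1
  obtain ⟨φ, h1, h2⟩ := exists_hypD_eq rfl (k := k) (0 : Hyp P.complex Q.complex (n + 1))
    (fun p _ => by rw [map_zero]; rfl) w (by
      change homPost P.complex (syzPi Q k) _ (0 + _) = 0
      rw [zero_add, map_zsmul_unit, ← homD_post, hw, hv, smul_zero])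
  have hφ : CocycleFrom φ k := h2
  refine ⟨⟨φ, ⟨k, hφ⟩⟩, ?_⟩
  have hc : syzClass φ k hφ = extMk v := by
    refine congrArg extMk (Subtype.ext ?_)
    change syzComp P Q φ k = v.1
    rw [syzComp_eq, h1, hw]
  refine (compHom_apply φ _ k hφ).trans ?_
  rw [compVal, hc, map_zsmul_unit, map_zsmul_unit, smul_smul,
    Int.units_mul_self, one_smul]

lemma compHom_eq_zero_of_coboundary {n : ℤ} (φ : Hyp P.complex Q.complex n)
    (hφ : IsAlmostCocycle φ) (χ : Hyp P.complex Q.complex (n - 1)) (N : ℕ)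
    (h : ∀ p, N ≤ p.1.2 → hypD _ _ (n - 1) n (by lia) χ p = φ p) :
    compHom P Q n ⟨φ, hφ⟩ = 0 := by
  obtain ⟨k, hk⟩ := hφ.exists_cocycleFrom
  have hk' := hk.mono (le_max_left k N)
  generalize hK : max k N = K at hk'
  have hN : N ≤ K := hK ▸ le_max_right k N
  have : syzClass φ K hk' = 0 := by
    rw [← map_zero extMk]
    refine (extMk_eq_iff _ _).2 ⟨-(n - 1).negOnePow • homPost _ (syzPi Q K) _
      (hypComp χ K (n + K - 1) (by lia)), ?_⟩
    have e := hypComp_hypD (by lia : n - 1 + 1 = n) χ K (n + K - 1) (n + K) (by lia) (by lia)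
    have e' : hypComp φ K (n + K) rfl =
        hypComp (hypD _ _ (n - 1) n (by lia) χ) K (n + K) (by lia) := by
      ext i
      exact (h _ hN).symm
    change _ = syzComp P Q φ K - 0
    rw [syzComp_eq, e', e, map_sub, homPost_d_syzPi, map_zsmul_unit, map_zsmul_unit, ← homD_post,
      Units.neg_smul, zero_sub, sub_zero]
  rw [compHom_apply φ hφ K hk', compVal, this, map_zero, smul_zero]

/-- If the value of an almost cocycle vanishes, then the class of its `k`-th component vanishes in
`Ext` itself for some `k`, and a primitive of that component extends to all degrees `≥ k`. -/
lemma exists_coboundary_of_compHom_eq_zero {n : ℤ} (φ : Hyp P.complex Q.complex n)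
    (hφ : IsAlmostCocycle φ) (h : compHom P Q n ⟨φ, hφ⟩ = 0) :
    ∃ χ : Hyp P.complex Q.complex (n - 1), ∃ N : ℕ, ∀ p, N ≤ p.1.2 →
      hypD _ _ (n - 1) n (by lia) χ p = φ p := by
  obtain ⟨k, hk⟩ := hφ.exists_cocycleFrom
  rw [compHom_apply φ hφ k hk, compVal, units_smul_eq_zero_iff] at h
  refine resIota_eq_zero_induction P Q n
    (M := fun k a => ∀ (ε : ℤˣ) (hk : CocycleFrom φ k), a = ε • syzClass φ k hk →
      ∃ χ : Hyp P.complex Q.complex (n - 1), ∃ N : ℕ, ∀ p, N ≤ p.1.2 →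
        hypD _ _ (n - 1) n (by lia) χ p = φ p) ?_ ?_ h 1 hk (one_smul _ _).symm
  · intro k ε hk h0
    rw [eq_comm, units_smul_eq_zero_iff, syzClass, ← map_zero extMk, extMk_eq_iff] at h0
    obtain ⟨w, hw⟩ := h0
    replace hw : homD _ _ (n + k - 1) (n + k) (by lia) w = syzComp P Q φ k := hw.trans (sub_zero _)
    let w' : HomCochain P.complex (syz Q k) (n - 1 + k) :=
      recast (by lia) (-(n - 1).negOnePow • w)
    obtain ⟨x, hx⟩ := exists_lift_syz P Q w'
    obtain ⟨χ, -, hχ⟩ := exists_hypD_eq (by lia : n - 1 + 1 = n) φ hk x (by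
        rw [map_add, map_zsmul_unit, ← homD_post, hx]
        have : ∀ (t : ℤ) (ht : n + k - 1 = t) (ht' : t + 1 = n + k),
            homD _ _ t (n + k) ht' (recast ht (-(n - 1).negOnePow • w)) =
              -(n - 1).negOnePow • syzComp P Q φ k := by
          rintro _ rfl _
          rw [recast_rfl, map_zsmul_unit, hw]
        rw [this, smul_smul, mul_neg, Int.units_mul_self, Units.neg_smul, one_smul]
        exact add_neg_cancel _)
    exact ⟨χ, k, hχ⟩
  · intro k a ih ε hk ha
    exact ih (ε * (-1) ^ (k + 1)) (hk.mono (Nat.le_succ k)) (by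
      rw [ha, map_zsmul_unit, delta_syzClass, smul_smul])

/-- Two surjections with the same kernel have isomorphic targets. Comparing kernels, rather than
constructing maps out of the quotient, avoids unfolding the definition of `HypExt`. -/
lemma exists_addEquiv_of_ker_eq {X Y Z : Type*} [AddCommGroup X] [AddCommGroup Y]
    [AddCommGroup Z] (f : X →+ Y) (g : X →+ Z) (hf : Function.Surjective f)
    (hg : Function.Surjective g) (h : ∀ x, f x = 0 ↔ g x = 0) :
    ∃ e : Y ≃+ Z, ∀ x, e (f x) = g x := by
  have hker : f.ker = g.ker := by
    ext x
    exact h x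
  refine ⟨(QuotientAddGroup.quotientKerEquivOfSurjective f hf).symm.trans
    ((QuotientAddGroup.quotientAddEquivOfEq hker).trans
      (QuotientAddGroup.quotientKerEquivOfSurjective g hg)), fun x => ?_⟩
  have : (QuotientAddGroup.quotientKerEquivOfSurjective f hf).symm (f x) =
      (x : X ⧸ f.ker) := by
    rw [AddEquiv.symm_apply_eq]
    rfl
  rw [AddEquiv.trans_apply, this]
  rfl

/-- The canonical isomorphism between the hypercohomology and the resolution construction. -/
theorem exists_isComparison (P : ProjectiveResolution A) (Q : ProjectiveResolution B) (n : ℤ) :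
    ∃ Φ : HypExt P.complex Q.complex n ≃+ ResExt P Q n, IsComparison P Q Φ := by
  obtain ⟨Φ, hΦ⟩ := exists_addEquiv_of_ker_eq (hypMkHom P.complex Q.complex n) (compHom P Q n)
    (fun x => by
      obtain ⟨φ, hφ, rfl⟩ := hypMk_surjective x
      exact ⟨⟨φ, hφ⟩, rfl⟩) (compHom_surjective n) (fun x =>
      (hypMk_eq_zero_iff x.1 x.2).trans
        ⟨fun ⟨χ, N, h⟩ => compHom_eq_zero_of_coboundary x.1 x.2 χ N h,
          exists_coboundary_of_compHom_eq_zero x.1 x.2⟩)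
  exact ⟨Φ, fun φ hφ k hk => ⟨CocycleFrom.syzComp_mem hk,
    (hΦ ⟨φ, hφ⟩).trans (compHom_apply φ hφ k hk)⟩⟩

end Comparison

/-! ### Resolutions that are spliced from short exact sequences -/

/-- A complex that is spliced from short exact sequences `0 ⟶ Zₖ₊₁ ⟶ Kₖ ⟶ Zₖ ⟶ 0` is a
resolution of `Z₀`. -/
lemma quasiIso_of_splice (K : ChainComplex C ℕ) (Z : ℕ → C) (π : ∀ k, K.X k ⟶ Z k)
    (ι : ∀ k, Z (k + 1) ⟶ K.X k) (w : ∀ k, ι k ≫ π k = 0)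
    (hS : ∀ k, (ShortComplex.mk (ι k) (π k) (w k)).ShortExact)
    (hd : ∀ k, K.d (k + 1) k = π (k + 1) ≫ ι k)
    (α : K ⟶ (ChainComplex.single₀ C).obj (Z 0)) (hα : α.f 0 = π 0) : QuasiIso α := by
  have hepi : ∀ k, Epi (π k) := fun k => (hS k).epi_g
  have hmono : ∀ k, Mono (ι k) := fun k => (hS k).mono_f
  have hdπ : ∀ k, K.d (k + 1) k ≫ π k = 0 := fun k => by rw [hd, Category.assoc, w, comp_zero]
  have ex : ∀ k, (ShortComplex.mk (K.d (k + 1) k) (π k) (hdπ k)).Exact := fun k => by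
    let f : ShortComplex.mk (K.d (k + 1) k) (π k) (hdπ k) ⟶ ShortComplex.mk (ι k) (π k) (w k) :=
      { τ₁ := π (k + 1), τ₂ := 𝟙 _, τ₃ := 𝟙 _, comm₁₂ := by simp [hd] }
    have : Epi f.τ₁ := hepi (k + 1)
    have : IsIso f.τ₂ := inferInstanceAs (IsIso (𝟙 _))
    have : Mono f.τ₃ := inferInstanceAs (Mono (𝟙 _))
    exact (ShortComplex.exact_iff_of_epi_of_isIso_of_mono f).2 (hS k).exact
  refine ⟨fun n => ?_⟩
  cases n with
  | zero =>
    rw [ChainComplex.quasiIsoAt₀_iff, ShortComplex.quasiIso_iff_of_zeros']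
    · refine (ShortComplex.exact_and_epi_g_iff_of_iso ?_).2 ⟨ex 0, hepi 0⟩
      exact ShortComplex.isoMk (Iso.refl _) (Iso.refl _) (Iso.refl _)
        ((Category.id_comp _).trans (Category.comp_id _).symm)
        ((Category.id_comp _).trans (hα.symm.trans (Category.comp_id _).symm))
    · exact K.shape _ _ (by simp)
    all_goals rfl
  | succ n =>
    rw [quasiIsoAt_iff_exactAt']
    · rw [HomologicalComplex.exactAt_iff' _ (n + 1 + 1) (n + 1) n (by simp) (by simp)]
      let f : ShortComplex.mk (K.d (n + 1 + 1) (n + 1)) (π (n + 1)) (hdπ (n + 1)) ⟶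
          K.sc' (n + 1 + 1) (n + 1) n :=
        { τ₁ := 𝟙 _, τ₂ := 𝟙 _, τ₃ := ι n
          comm₁₂ := (Category.id_comp _).trans (Category.comp_id _).symm
          comm₂₃ := (Category.id_comp _).trans (hd n) }
      have : Epi f.τ₁ := inferInstanceAs (Epi (𝟙 _))
      have : IsIso f.τ₂ := inferInstanceAs (IsIso (𝟙 _))
      have : Mono f.τ₃ := hmono n
      exact (ShortComplex.exact_iff_of_epi_of_isIso_of_mono f).1 (ex (n + 1))
    · apply ChainComplex.exactAt_succ_single_obj

namespace TensorProd

variable {R : C} (T : TensorProd R)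

lemma mor_id_right {X X' : C} (f : X ⟶ X') (Y : C) : T.mor f (𝟙 Y) = (T.F.map f).app Y := by
  simp [mor]

lemma mor_id_left (X : C) {Y Y' : C} (g : Y ⟶ Y') : T.mor (𝟙 X) g = (T.F.obj X).map g := by
  simp [mor]

section

variable {B E : C} (PB : ProjectiveResolution B) (PE : ProjectiveResolution E)

/-- The sequence of a `B`-step is `0 ⟶ B̃ₚ₊₁ ⟶ Bₚ ⟶ B̃ₚ ⟶ 0` tensored with a syzygy of `E`, and
symmetrically for an `E`-step. -/
lemma stepSeq_shortExact (hB : ∀ k, T.ExactProjective (syz PB k))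
    (hE : ∀ k, T.ExactProjective (syz PE k)) (b : Bool) (s : ℕ × ℕ) :
    (ShortComplex.mk (T.stepIota PB PE b s) (T.stepPi PB PE b s)
      (T.stepIota_stepPi PB PE b s)).ShortExact := by
  cases b with
  | true =>
    refine ShortComplex.shortExact_of_iso ?_
      ((hE s.2).exact_right _ (syzSeq_shortExact PB s.1))
    exact ShortComplex.isoMk (Iso.refl _) (Iso.refl _) (Iso.refl _)
      ((Category.id_comp _).trans ((T.mor_id_right _ _).trans (Category.comp_id _).symm))
      ((Category.id_comp _).trans ((T.mor_id_right _ _).trans (Category.comp_id _).symm))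
  | false =>
    refine ShortComplex.shortExact_of_iso ?_
      ((hB s.1).exact_left _ (syzSeq_shortExact PE s.2))
    exact ShortComplex.isoMk (Iso.refl _) (Iso.refl _) (Iso.refl _)
      ((Category.id_comp _).trans ((T.mor_id_left _ _).trans (Category.comp_id _).symm))
      ((Category.id_comp _).trans ((T.mor_id_left _ _).trans (Category.comp_id _).symm))

lemma projective_stepOb (hB : ∀ k, T.ExactProjective (syz PB k))
    (hE : ∀ k, T.ExactProjective (syz PE k)) (b : Bool) (s : ℕ × ℕ) :
    Projective (T.stepOb PB PE b s) := by
  cases b with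
  | true =>
    have := (hE s.2).projective_right
    exact (T.F.flip.obj (syz PE s.2)).projective_obj (PB.complex.X s.1)
  | false =>
    have := (hB s.1).projective_left
    exact (T.F.obj (syz PB s.1)).projective_obj (PE.complex.X s.2)

lemma oComplex_projective (hB : ∀ k, T.ExactProjective (syz PB k))
    (hE : ∀ k, T.ExactProjective (syz PE k)) (o : ℕ → Bool) (k : ℕ) :
    Projective ((T.oComplex PB PE o).X k) :=
  T.projective_stepOb PB PE hB hE (o k) (counts o k)

lemma oAug_f_zero (o : ℕ → Bool) : (T.oAug PB PE o).f 0 = T.oPi PB PE o 0 :=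
  ChainComplex.toSingle₀Equiv_symm_apply_f_zero _ _

lemma quasiIso_oAug (hB : ∀ k, T.ExactProjective (syz PB k))
    (hE : ∀ k, T.ExactProjective (syz PE k)) (o : ℕ → Bool) : QuasiIso (T.oAug PB PE o) :=
  quasiIso_of_splice (T.oComplex PB PE o) (fun k => T.syzOb PB PE (counts o k))
    (T.oPi PB PE o) (T.oIota PB PE o) (T.oIota_oPi PB PE o)
    (fun k => T.stepSeq_shortExact PB PE hB hE (o k) (counts o k)) (T.oComplex_d PB PE o) _
    (T.oAug_f_zero PB PE o)

end

end TensorProd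

/-! ### Dimension shifting of morphisms to a syzygy -/

section Steps

variable {D : C} (Q : ProjectiveResolution D)

/-- Two morphisms to a syzygy are stably equal if their difference factors through the projection
from the projective object that covers it. -/
def StablyEq {k : ℕ} {X : C} (g g' : X ⟶ syz Q k) : Prop :=
  ∃ h : X ⟶ Q.complex.X k, g - g' = h ≫ syzPi Q k

/-- The morphism `g'` arises from `g` by dimension shifting along a sequence
`X' ⟶ M ⟶ X`: together they are part of a morphism to `0 ⟶ Q̃ₖ₊₁ ⟶ Qₖ ⟶ Q̃ₖ ⟶ 0`. -/
def IsShift {k : ℕ} {X X' M : C} (ι : X' ⟶ M) (π : M ⟶ X) (g : X ⟶ syz Q k)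
    (g' : X' ⟶ syz Q (k + 1)) : Prop :=
  ∃ f : M ⟶ Q.complex.X k, π ≫ g = f ≫ syzPi Q k ∧ ι ≫ f = g' ≫ syzIota Q k

variable {Q}

lemma StablyEq.refl {k : ℕ} {X : C} (g : X ⟶ syz Q k) : StablyEq Q g g :=
  ⟨0, by simp⟩

lemma StablyEq.symm {k : ℕ} {X : C} {g g' : X ⟶ syz Q k} (h : StablyEq Q g g') :
    StablyEq Q g' g := by
  obtain ⟨h, hh⟩ := h
  exact ⟨-h, by rw [Preadditive.neg_comp, ← hh, neg_sub]⟩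

lemma StablyEq.trans {k : ℕ} {X : C} {g g' g'' : X ⟶ syz Q k} (h : StablyEq Q g g')
    (h' : StablyEq Q g' g'') : StablyEq Q g g'' := by
  obtain ⟨h, hh⟩ := h
  obtain ⟨h', hh'⟩ := h'
  exact ⟨h + h', by rw [Preadditive.add_comp, ← hh, ← hh', sub_add_sub_cancel]⟩

lemma StablyEq.units_smul {k : ℕ} {X : C} {g g' : X ⟶ syz Q k} (ε : ℤˣ)
    (h : StablyEq Q g g') : StablyEq Q (ε • g) (ε • g') := by
  obtain ⟨h, hh⟩ := h
  exact ⟨ε • h, by rw [Linear.units_smul_comp, ← hh, smul_sub]⟩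

lemma StablyEq.of_units_smul {k : ℕ} {X : C} {g g' : X ⟶ syz Q k} {ε : ℤˣ}
    (h : StablyEq Q (ε • g) (ε • g')) : StablyEq Q g g' := by
  simpa [smul_smul] using h.units_smul ε

lemma exists_syzIota_lift {k : ℕ} {X : C} (f : X ⟶ Q.complex.X k) (hf : f ≫ syzPi Q k = 0) :
    ∃ t : X ⟶ syz Q (k + 1), t ≫ syzIota Q k = f :=
  ⟨kernel.lift _ f hf, kernel.lift_ι _ _ _⟩

lemma exists_syzPi_lift {k : ℕ} {M : C} [Projective M] (g : M ⟶ syz Q k) :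
    ∃ f : M ⟶ Q.complex.X k, f ≫ syzPi Q k = g :=
  ⟨Projective.factorThru g (syzPi Q k), Projective.factorThru_comp _ _⟩

/-- Dimension shifting along a projective object is always possible. -/
lemma exists_isShift {k : ℕ} {X X' M : C} [Projective M] {ι : X' ⟶ M} {π : M ⟶ X}
    (w : ι ≫ π = 0) (g : X ⟶ syz Q k) : ∃ g', IsShift Q ι π g g' := by
  obtain ⟨f, hf⟩ := exists_syzPi_lift (Q := Q) (π ≫ g)
  obtain ⟨g', hg'⟩ := exists_syzIota_lift (Q := Q) (ι ≫ f) (by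
    rw [Category.assoc, hf, ← Category.assoc, w, zero_comp])
  exact ⟨g', f, hf.symm, hg'.symm⟩

lemma IsShift.units_smul {k : ℕ} {X X' M : C} {ι : X' ⟶ M} {π : M ⟶ X} {g : X ⟶ syz Q k}
    {g' : X' ⟶ syz Q (k + 1)} (h : IsShift Q ι π g g') (ε : ℤˣ) :
    IsShift Q ι π (ε • g) (ε • g') := by
  obtain ⟨f, h1, h2⟩ := h
  exact ⟨ε • f, by rw [Linear.comp_units_smul, h1, Linear.units_smul_comp],
    by rw [Linear.comp_units_smul, h2, Linear.units_smul_comp]⟩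

/-- Dimension shifting along a projective object preserves stable equality. -/
lemma IsShift.stablyEq {k : ℕ} {X X' M : C} [Projective M] {ι : X' ⟶ M} {π : M ⟶ X}
    (w : ι ≫ π = 0) {g₁ g₂ : X ⟶ syz Q k} {g₁' g₂' : X' ⟶ syz Q (k + 1)}
    (h₁ : IsShift Q ι π g₁ g₁') (h₂ : IsShift Q ι π g₂ g₂') (h : StablyEq Q g₁ g₂) :
    StablyEq Q g₁' g₂' := by
  obtain ⟨f₁, a₁, b₁⟩ := h₁
  obtain ⟨f₂, a₂, b₂⟩ := h₂
  obtain ⟨h, hh⟩ := h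
  obtain ⟨t, ht⟩ := exists_syzIota_lift (Q := Q) (f₁ - f₂ - π ≫ h) (by
    rw [Preadditive.sub_comp, Preadditive.sub_comp, ← a₁, ← a₂, Category.assoc, ← hh,
      Preadditive.comp_sub, sub_self])
  obtain ⟨s, rfl⟩ := exists_syzPi_lift (Q := Q) t
  refine ⟨ι ≫ s, ?_⟩
  rw [← cancel_mono (syzIota Q k), Preadditive.sub_comp, ← b₁, ← b₂]
  simp only [Category.assoc] at ht ⊢
  rw [ht, Preadditive.comp_sub, Preadditive.comp_sub, ← Category.assoc ι π, w, zero_comp, sub_zero]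

end Steps

namespace TensorProd

variable {R : C} (T : TensorProd R)

variable {B E : C} (PB : ProjectiveResolution B) (PE : ProjectiveResolution E)

/-- A lift of the identity exists along every sequence of steps: it is built by dimension
shifting. -/
lemma exists_oLift (hB : ∀ k, T.ExactProjective (syz PB k))
    (hE : ∀ k, T.ExactProjective (syz PE k)) (o : ℕ → Bool)
    (Q : ProjectiveResolution (T.ob B E)) : Nonempty (T.OLift PB PE o Q) := by
  obtain ⟨g, h0, hg⟩ := exists_seq (X := fun k => T.syzOb PB PE (counts o k) ⟶ syz Q k)
    (fun _ => 0) (fun _ _ => True)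
    (fun k g g' => IsShift Q (T.oIota PB PE o k) (T.oPi PB PE o k) g g') 0 (𝟙 (T.ob B E)) trivial
    (fun k _ g _ => by
      have := T.projective_stepOb PB PE hB hE (o k) (counts o k)
      obtain ⟨g', hg'⟩ := exists_isShift (T.oIota_oPi PB PE o k) g
      exact ⟨g', trivial, hg'⟩)
  choose f hf hf' using fun k => hg k (Nat.zero_le k)
  refine ⟨{ f := { f := f, comm' := ?_ }, g := g, g_zero := h0, pi_comm := hf, iota_comm := hf' }⟩
  rintro i j (rfl : j + 1 = i)
  rw [oComplex_d, ← syzPi_syzIota]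
  have e : f (j + 1) ≫ syzPi Q (j + 1) ≫ syzIota Q j =
      (T.oPi PB PE o (j + 1) ≫ T.oIota PB PE o j) ≫ f j := by
    rw [Category.assoc, hf', ← Category.assoc, ← hf (j + 1), Category.assoc]
  exact e

variable {PB PE}

/-- The two orders in which a step in the resolution of `B` and a step in the resolution of `E` can
be made lead to opposite morphisms: a lift on `Bₚ ⊗ E_q` of the difference of the first
steps restricts to the second steps, with opposite signs. -/
lemma stablyEq_neg_of_isShift {Q : ProjectiveResolution (T.ob B E)} {p q k : ℕ}
    [Projective (T.ob (syz PB (p + 1)) (PE.complex.X q))]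
    [Projective (T.ob (PB.complex.X p) (syz PE (q + 1)))]
    {g : T.ob (syz PB p) (syz PE q) ⟶ syz Q k}
    {g₁ : T.ob (syz PB (p + 1)) (syz PE q) ⟶ syz Q (k + 1)}
    {g₁' : T.ob (syz PB p) (syz PE (q + 1)) ⟶ syz Q (k + 1)}
    {g₂ g₂' : T.ob (syz PB (p + 1)) (syz PE (q + 1)) ⟶ syz Q (k + 1 + 1)}
    (h₁ : IsShift Q (T.mor (syzIota PB p) (𝟙 (syz PE q))) (T.mor (syzPi PB p) (𝟙 (syz PE q))) g g₁)
    (h₂ : IsShift Q (T.mor (𝟙 (syz PB (p + 1))) (syzIota PE q))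
      (T.mor (𝟙 (syz PB (p + 1))) (syzPi PE q)) g₁ g₂)
    (h₁' : IsShift Q (T.mor (𝟙 (syz PB p)) (syzIota PE q)) (T.mor (𝟙 (syz PB p)) (syzPi PE q))
      g g₁')
    (h₂' : IsShift Q (T.mor (syzIota PB p) (𝟙 (syz PE (q + 1))))
      (T.mor (syzPi PB p) (𝟙 (syz PE (q + 1)))) g₁' g₂') :
    StablyEq Q g₂ (-g₂') := by
  obtain ⟨f₁, a₁, b₁⟩ := h₁
  obtain ⟨f₁', a₁', b₁'⟩ := h₁'
  have : Projective (T.ob (PB.complex.X p) (PE.complex.X q)) :=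
    T.projective _ _ (PB.projective p) (PE.projective q)
  -- the difference of the two lifts of `g` to `Bₚ ⊗ E_q` takes values in the next syzygy
  obtain ⟨t, ht⟩ := exists_syzIota_lift (Q := Q)
    (T.mor (𝟙 (PB.complex.X p)) (syzPi PE q) ≫ f₁ -
      T.mor (syzPi PB p) (𝟙 (PE.complex.X q)) ≫ f₁') (by
    rw [Preadditive.sub_comp, Category.assoc, Category.assoc, ← a₁, ← a₁', ← Category.assoc,
      ← Category.assoc, mor_comp, mor_comp]
    simp)
  obtain ⟨s, rfl⟩ := exists_syzPi_lift (Q := Q) t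
  rw [Category.assoc] at ht
  have c₁ : T.mor (𝟙 (syz PB (p + 1))) (syzPi PE q) ≫ g₁ =
      (T.mor (syzIota PB p) (𝟙 (PE.complex.X q)) ≫ s) ≫ syzPi Q (k + 1) := by
    rw [← cancel_mono (syzIota Q k), Category.assoc, Category.assoc, Category.assoc, ht, ← b₁,
      Preadditive.comp_sub]
    simp only [← Category.assoc, mor_comp]
    simp
  have c₁' : T.mor (syzPi PB p) (𝟙 (syz PE (q + 1))) ≫ g₁' =
      (-(T.mor (𝟙 (PB.complex.X p)) (syzIota PE q) ≫ s)) ≫ syzPi Q (k + 1) := by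
    rw [← cancel_mono (syzIota Q k), Preadditive.neg_comp, Preadditive.neg_comp, Category.assoc,
      Category.assoc, Category.assoc, ht, ← b₁', Preadditive.comp_sub]
    simp only [← Category.assoc, mor_comp]
    simp
  -- the restriction of its lift `s` to `B̃ₚ₊₁ ⊗ Ẽ_q₊₁` represents both second steps, up to sign
  obtain ⟨h, hh⟩ := exists_syzIota_lift (Q := Q)
    (T.mor (𝟙 (syz PB (p + 1))) (syzIota PE q) ≫
      T.mor (syzIota PB p) (𝟙 (PE.complex.X q)) ≫ s) (by
    rw [Category.assoc, ← c₁, ← Category.assoc, mor_comp]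
    simp)
  have e := h₂.stablyEq (T.mor_id_comp _ _ _ (syzIota_syzPi PE q)) ⟨_, c₁, hh.symm⟩
    (StablyEq.refl g₁)
  have e' := h₂'.stablyEq (g₂' := -h) (T.mor_comp_id _ _ _ (syzIota_syzPi PB p)) ⟨_, c₁', by
    rw [Preadditive.neg_comp, hh, Preadditive.comp_neg, ← Category.assoc, ← Category.assoc,
      mor_comp, mor_comp]
    simp⟩ (StablyEq.refl g₁')
  refine e.trans ?_
  simpa using (e'.units_smul (-1)).symm

variable (PB PE) in
/-- The morphisms `B̃ₚ ⊗ Ẽ_q ⟶ Q̃ₖ`, `k = p + q`, that are obtained from the identity of `B ⊗ E` by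
`p` steps in the resolution of `B` and `q` steps in the resolution of `E`, in any order. The
sign `(-1)ᵖ` of the latter steps makes the result independent of the order, up to stable
equality. -/
inductive Reach (Q : ProjectiveResolution (T.ob B E)) :
    ∀ p q k : ℕ, (T.ob (syz PB p) (syz PE q) ⟶ syz Q k) → Prop
  | zero : Reach Q 0 0 0 (𝟙 (T.ob B E))
  | left {p q k : ℕ} {g : T.ob (syz PB p) (syz PE q) ⟶ syz Q k}
      {g' : T.ob (syz PB (p + 1)) (syz PE q) ⟶ syz Q (k + 1)} (h : Reach Q p q k g)
      (hg : IsShift Q (T.mor (syzIota PB p) (𝟙 (syz PE q))) (T.mor (syzPi PB p) (𝟙 (syz PE q)))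
        g g') : Reach Q (p + 1) q (k + 1) g'
  | right {p q k : ℕ} {g : T.ob (syz PB p) (syz PE q) ⟶ syz Q k}
      {g' : T.ob (syz PB p) (syz PE (q + 1)) ⟶ syz Q (k + 1)} (h : Reach Q p q k g)
      (hg : IsShift Q (T.mor (𝟙 (syz PB p)) (syzIota PE q)) (T.mor (𝟙 (syz PB p)) (syzPi PE q))
        g ((-1 : ℤˣ) ^ p • g')) : Reach Q p (q + 1) (k + 1) g'

lemma Reach.eq_add {Q : ProjectiveResolution (T.ob B E)} {p q k : ℕ}
    {g : T.ob (syz PB p) (syz PE q) ⟶ syz Q k} (h : T.Reach PB PE Q p q k g) : k = p + q := by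
  induction h with
  | zero => rfl
  | left _ _ ih => lia
  | right _ _ ih => lia

variable (hB : ∀ k, T.ExactProjective (syz PB k)) (hE : ∀ k, T.ExactProjective (syz PE k))
include hB hE

lemma Reach.exists_left {Q : ProjectiveResolution (T.ob B E)} {p q k : ℕ}
    {g : T.ob (syz PB p) (syz PE q) ⟶ syz Q k} (h : T.Reach PB PE Q p q k g) :
    ∃ g', IsShift Q (T.mor (syzIota PB p) (𝟙 (syz PE q))) (T.mor (syzPi PB p) (𝟙 (syz PE q)))
      g g' ∧ T.Reach PB PE Q (p + 1) q (k + 1) g' := by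
  have : Projective (T.ob (PB.complex.X p) (syz PE q)) :=
    T.projective_stepOb PB PE hB hE true (p, q)
  obtain ⟨g', hg'⟩ := exists_isShift (T.mor_comp_id _ _ _ (syzIota_syzPi PB p)) g
  exact ⟨g', hg', h.left hg'⟩

lemma Reach.exists_right {Q : ProjectiveResolution (T.ob B E)} {p q k : ℕ}
    {g : T.ob (syz PB p) (syz PE q) ⟶ syz Q k} (h : T.Reach PB PE Q p q k g) :
    ∃ g', IsShift Q (T.mor (𝟙 (syz PB p)) (syzIota PE q)) (T.mor (𝟙 (syz PB p)) (syzPi PE q))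
      g ((-1 : ℤˣ) ^ p • g') ∧ T.Reach PB PE Q p (q + 1) (k + 1) g' := by
  have : Projective (T.ob (syz PB p) (PE.complex.X q)) :=
    T.projective_stepOb PB PE hB hE false (p, q)
  obtain ⟨g', hg'⟩ := exists_isShift (T.mor_id_comp _ _ _ (syzIota_syzPi PE q)) g
  have e : g' = (-1 : ℤˣ) ^ p • (-1 : ℤˣ) ^ p • g' := by
    rw [smul_smul, Int.units_mul_self, one_smul]
  rw [e] at hg'
  exact ⟨_, hg', h.right hg'⟩

lemma exists_reach (Q : ProjectiveResolution (T.ob B E)) (p q : ℕ) :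
    ∃ k g, T.Reach PB PE Q p q k g := by
  induction p with
  | zero =>
    induction q with
    | zero => exact ⟨_, _, Reach.zero⟩
    | succ q ih =>
      obtain ⟨k, g, h⟩ := ih
      obtain ⟨g', -, h'⟩ := h.exists_right T hB hE
      exact ⟨_, _, h'⟩
  | succ p ih =>
    obtain ⟨k, g, h⟩ := ih
    obtain ⟨g', -, h'⟩ := h.exists_left T hB hE
    exact ⟨_, _, h'⟩

/-- The morphisms that are reached by different orders of the steps are stably equal. -/
theorem Reach.stablyEq {Q : ProjectiveResolution (T.ob B E)} {p q k : ℕ}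
    {g g' : T.ob (syz PB p) (syz PE q) ⟶ syz Q k} (h : T.Reach PB PE Q p q k g)
    (h' : T.Reach PB PE Q p q k g') : StablyEq Q g g' := by
  have hP : ∀ p q, Projective (T.ob (PB.complex.X p) (syz PE q)) := fun p q =>
    T.projective_stepOb PB PE hB hE true (p, q)
  have hP' : ∀ p q, Projective (T.ob (syz PB p) (PE.complex.X q)) := fun p q =>
    T.projective_stepOb PB PE hB hE false (p, q)
  -- the last steps of two orders differ: compare both with orders that part at `(p, q)`
  have swap : ∀ {p q k : ℕ} {g g' : T.ob (syz PB (p + 1)) (syz PE (q + 1)) ⟶ syz Q (k + 1)}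
      {g₀ : T.ob (syz PB p) (syz PE (q + 1)) ⟶ syz Q k}
      {g₀' : T.ob (syz PB (p + 1)) (syz PE q) ⟶ syz Q k},
      (∀ {p q : ℕ} {g g' : T.ob (syz PB p) (syz PE q) ⟶ syz Q k},
        T.Reach PB PE Q p q k g → T.Reach PB PE Q p q k g' → StablyEq Q g g') →
      T.Reach PB PE Q p (q + 1) k g₀ → T.Reach PB PE Q (p + 1) q k g₀' →
      IsShift Q (T.mor (syzIota PB p) (𝟙 (syz PE (q + 1))))
        (T.mor (syzPi PB p) (𝟙 (syz PE (q + 1)))) g₀ g →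
      IsShift Q (T.mor (𝟙 (syz PB (p + 1))) (syzIota PE q))
        (T.mor (𝟙 (syz PB (p + 1))) (syzPi PE q)) g₀' ((-1 : ℤˣ) ^ (p + 1) • g') →
      StablyEq Q g g' := by
    intro p q k g g' g₀ g₀' ih r r' s s'
    obtain ⟨l, c, rc⟩ := T.exists_reach hB hE Q p q
    obtain rfl : k = l + 1 := by
      have := rc.eq_add
      have := r.eq_add
      lia
    obtain ⟨c₁, sc₁, rc₁⟩ := rc.exists_left T hB hE
    obtain ⟨c₂, sc₂, -⟩ := rc₁.exists_right T hB hE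
    obtain ⟨c₁', sc₁', rc₁'⟩ := rc.exists_right T hB hE
    obtain ⟨c₂', sc₂', -⟩ := rc₁'.exists_left T hB hE
    have e := s.stablyEq (T.mor_comp_id _ _ _ (syzIota_syzPi PB p)) sc₂' (ih r rc₁')
    have e' := (s'.stablyEq (T.mor_id_comp _ _ _ (syzIota_syzPi PE q)) sc₂
      (ih r' rc₁)).of_units_smul
    have e'' := T.stablyEq_neg_of_isShift sc₁ sc₂ sc₁' (sc₂'.units_smul _)
    have e₀ : -((-1 : ℤˣ) ^ p • c₂') = (-1 : ℤˣ) ^ (p + 1) • c₂' := by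
      rw [pow_succ', neg_one_mul, Units.neg_smul]
    rw [e₀] at e''
    exact e.trans (e''.of_units_smul.symm.trans e'.symm)
  induction k generalizing p q with
  | zero =>
    cases h
    cases h'
    exact StablyEq.refl _
  | succ k ih =>
    cases h with
    | left r s =>
      cases h' with
      | left r' s' => exact s.stablyEq (T.mor_comp_id _ _ _ (syzIota_syzPi PB _)) s' (ih r r')
      | right r' s' => exact swap ih r r' s s'
    | right r s =>
      cases h' with
      | left r' s' => exact (swap ih r' r s' s).symm
      | right r' s' =>
        exact (s.stablyEq (T.mor_id_comp _ _ _ (syzIota_syzPi PE _)) s' (ih r r')).of_units_smul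

omit hB hE

/-- The sign of a step from the pair of indices `s` in the definition of `Reach`. -/
def stepSign (b : Bool) (s : ℕ × ℕ) : ℤˣ :=
  match b with
  | true => 1
  | false => (-1) ^ s.1

/-- The sign by which a lift along the steps `o` differs from the morphisms of `Reach`. -/
def pathSign (o : ℕ → Bool) : ℕ → ℤˣ
  | 0 => 1
  | k + 1 => pathSign o k * stepSign (o k) (counts o k)

lemma reach_step {Q : ProjectiveResolution (T.ob B E)} {k : ℕ} (b : Bool) (s : ℕ × ℕ) (σ : ℤˣ)
    {g : T.syzOb PB PE s ⟶ syz Q k} {g' : T.syzOb PB PE (step b s) ⟶ syz Q (k + 1)}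
    (h : T.Reach PB PE Q s.1 s.2 k (σ • g))
    (hg : IsShift Q (T.stepIota PB PE b s) (T.stepPi PB PE b s) g g') :
    T.Reach PB PE Q (step b s).1 (step b s).2 (k + 1)
      ((σ * stepSign b s) • g') := by
  cases b with
  | true =>
    rw [stepSign, mul_one]
    exact h.left (hg.units_smul σ)
  | false =>
    have e : (-1 : ℤˣ) ^ s.1 • (σ * stepSign false s) • g' = σ • g' := by
      rw [smul_smul, stepSign, mul_left_comm, Int.units_mul_self, mul_one]
    exact h.right (e.symm ▸ hg.units_smul σ)

/-- Every lift of the identity along a sequence of steps is of the kind considered in `Reach`, up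
to sign. -/
lemma OLift.reach {Q : ProjectiveResolution (T.ob B E)} {o : ℕ → Bool} (ℓ : T.OLift PB PE o Q)
    (k : ℕ) :
    T.Reach PB PE Q (counts o k).1 (counts o k).2 k (pathSign o k • ℓ.g k) := by
  induction k with
  | zero =>
    have e : pathSign o 0 • ℓ.g 0 = 𝟙 (T.ob B E) := (one_smul _ _).trans ℓ.g_zero
    exact e.symm ▸ Reach.zero
  | succ k ih => exact T.reach_step (o k) (counts o k) _ ih ⟨ℓ.f.f k, ℓ.pi_comm k, ℓ.iota_comm k⟩

end TensorProd

/-! ### The tensor product of complexes and external products of cochains -/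

/-- The component of a cochain at an index `a`, which is zero unless `a` is its degree. -/
def cochainAt {K : ChainComplex C ℕ} {B : C} {n : ℤ} (u : HomCochain K B n) (a : ℕ) : K.X a ⟶ B :=
  if h : (a : ℤ) = n then u ⟨a, h⟩ else 0

lemma cochainAt_of_eq {K : ChainComplex C ℕ} {B : C} {n : ℤ} (u : HomCochain K B n) {a : ℕ}
    (h : (a : ℤ) = n) : cochainAt u a = u ⟨a, h⟩ :=
  dif_pos h

lemma cochainAt_of_ne {K : ChainComplex C ℕ} {B : C} {n : ℤ} (u : HomCochain K B n) {a : ℕ}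
    (h : (a : ℤ) ≠ n) : cochainAt u a = 0 :=
  dif_neg h

@[simp]
lemma cochainAt_zero {K : ChainComplex C ℕ} {B : C} {n : ℤ} (a : ℕ) :
    cochainAt (0 : HomCochain K B n) a = 0 := by
  rw [cochainAt]
  split <;> rfl

lemma cochainAt_add {K : ChainComplex C ℕ} {B : C} {n : ℤ} (u u' : HomCochain K B n) (a : ℕ) :
    cochainAt (u + u') a = cochainAt u a + cochainAt u' a := by
  by_cases h : (a : ℤ) = n
  · simp only [cochainAt_of_eq _ h, Pi.add_apply]
  · simp only [cochainAt_of_ne _ h, add_zero]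

lemma cochainAt_post {K : ChainComplex C ℕ} {B B' : C} (g : B ⟶ B') {n : ℤ}
    (u : HomCochain K B n) (a : ℕ) : cochainAt (homPost K g n u) a = cochainAt u a ≫ g := by
  by_cases h : (a : ℤ) = n
  · simp only [cochainAt_of_eq _ h]
    rfl
  · simp only [cochainAt_of_ne _ h, zero_comp]

lemma cochainAt_homD_zero {K : ChainComplex C ℕ} {B : C} {n m : ℤ} (h : n + 1 = m)
    (u : HomCochain K B n) : cochainAt (homD K B n m h u) 0 = 0 := by
  by_cases hm : ((0 : ℕ) : ℤ) = m
  · rw [cochainAt_of_eq _ hm]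
    rfl
  · exact cochainAt_of_ne _ hm

lemma cochainAt_homD_succ {K : ChainComplex C ℕ} {B : C} {n m : ℤ} (h : n + 1 = m)
    (u : HomCochain K B n) (a : ℕ) :
    cochainAt (homD K B n m h u) (a + 1) = K.d (a + 1) a ≫ cochainAt u a := by
  by_cases hm : ((a + 1 : ℕ) : ℤ) = m
  · rw [cochainAt_of_eq _ hm, cochainAt_of_eq _ (by push_cast at hm; lia)]
    rfl
  · rw [cochainAt_of_ne _ hm, cochainAt_of_ne _ (by push_cast at hm; lia), comp_zero]

namespace TensorProd

variable {R : C} (T : TensorProd R)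

section Mor

variable {X X' Y Y' : C}

lemma mor_add_left (f f' : X ⟶ X') (g : Y ⟶ Y') : T.mor (f + f') g = T.mor f g + T.mor f' g := by
  simp [mor, Functor.map_add]

lemma mor_add_right (f : X ⟶ X') (g g' : Y ⟶ Y') :
    T.mor f (g + g') = T.mor f g + T.mor f g' := by
  simp [mor, Functor.map_add]

end Mor

section Desc

variable {K L : ChainComplex C ℕ} {X Y : C}

/-- The inclusion of the summand `Kᵢ ⊗ Lⱼ`. -/
abbrev incl (K L : ChainComplex C ℕ) (i j n : ℕ) (h : i + j = n) :
    T.ob (K.X i) (L.X j) ⟶ (T.tensorComplex K L).X n :=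
  HomologicalComplex.ιMapBifunctor K L T.F (ComplexShape.down ℕ) i j n h

lemma incl_desc (n : ℕ) (f : ∀ i j : ℕ, T.ob (K.X i) (L.X j) ⟶ X) (i j : ℕ) (h : i + j = n) :
    T.incl K L i j n h ≫ T.desc n f = f i j :=
  HomologicalComplex.ι_mapBifunctorDesc _ _ _ _

lemma tensor_hom_ext {n : ℕ} {f g : (T.tensorComplex K L).X n ⟶ X}
    (h : ∀ i j h, T.incl K L i j n h ≫ f = T.incl K L i j n h ≫ g) : f = g :=
  HomologicalComplex.mapBifunctor.hom_ext h

lemma desc_congr {n : ℕ} {f f' : ∀ i j : ℕ, T.ob (K.X i) (L.X j) ⟶ X}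
    (h : ∀ i j, i + j = n → f i j = f' i j) : T.desc n f = T.desc n f' :=
  T.tensor_hom_ext fun i j hij => by rw [incl_desc, incl_desc, h i j hij]

lemma desc_add (n : ℕ) (f f' : ∀ i j : ℕ, T.ob (K.X i) (L.X j) ⟶ X) :
    T.desc n (fun i j => f i j + f' i j) = T.desc n f + T.desc n f' :=
  T.tensor_hom_ext fun i j hij => by
    rw [incl_desc, Preadditive.comp_add, incl_desc, incl_desc]

lemma desc_units_smul (n : ℕ) (ε : ℤˣ) (f : ∀ i j : ℕ, T.ob (K.X i) (L.X j) ⟶ X) :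
    T.desc n (fun i j => ε • f i j) = ε • T.desc n f :=
  T.tensor_hom_ext fun i j hij => by
    rw [incl_desc, Linear.comp_units_smul, incl_desc]

lemma desc_comp (n : ℕ) (f : ∀ i j : ℕ, T.ob (K.X i) (L.X j) ⟶ X) (g : X ⟶ Y) :
    T.desc n f ≫ g = T.desc n (fun i j => f i j ≫ g) :=
  T.tensor_hom_ext fun i j hij => by rw [incl_desc, ← Category.assoc, incl_desc]

lemma desc_zero (n : ℕ) : T.desc n (fun i j => (0 : T.ob (K.X i) (L.X j) ⟶ X)) = 0 :=
  T.tensor_hom_ext fun i j hij => by rw [incl_desc, comp_zero]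

/-- The composite of `d ⊗ 1` with a family of morphisms. -/
def dLeft (f : ∀ i j : ℕ, T.ob (K.X i) (L.X j) ⟶ X) : ∀ i j : ℕ, T.ob (K.X i) (L.X j) ⟶ X
  | 0, _ => 0
  | i + 1, j => (T.F.map (K.d (i + 1) i)).app (L.X j) ≫ f i j

/-- The composite of `1 ⊗ d` with a family of morphisms. -/
def dRight (f : ∀ i j : ℕ, T.ob (K.X i) (L.X j) ⟶ X) : ∀ i j : ℕ, T.ob (K.X i) (L.X j) ⟶ X
  | _, 0 => 0
  | i, j + 1 => (T.F.obj (K.X i)).map (L.d (j + 1) j) ≫ f i j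

/-- The differential of the tensor product of complexes, tested on a morphism that is given by its
restrictions to the summands. -/
lemma d_desc (n : ℕ) (f : ∀ i j : ℕ, T.ob (K.X i) (L.X j) ⟶ X) :
    (T.tensorComplex K L).d (n + 1) n ≫ T.desc n f =
      T.desc (n + 1) (fun i j => T.dLeft f i j + (-1 : ℤˣ) ^ i • T.dRight f i j) := by
  refine T.tensor_hom_ext fun i j hij => ?_
  rw [incl_desc, HomologicalComplex.mapBifunctor.d_eq, Preadditive.add_comp,
    Preadditive.comp_add, HomologicalComplex.mapBifunctor.ι_D₁_assoc,
    HomologicalComplex.mapBifunctor.ι_D₂_assoc]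
  congr 1
  · cases i with
    | zero =>
      rw [HomologicalComplex.mapBifunctor.d₁_eq_zero _ _ _ _ _ _ _ (by simp), zero_comp]
      rfl
    | succ i =>
      rw [HomologicalComplex.mapBifunctor.d₁_eq _ _ _ _
        (show (ComplexShape.down ℕ).Rel (i + 1) i by simp) _ _ (show i + j = n by lia),
        Linear.units_smul_comp, Category.assoc]
      exact (one_smul _ _).trans (congrArg _ (T.incl_desc n f i j (by lia)))
  · cases j with
    | zero =>
      rw [HomologicalComplex.mapBifunctor.d₂_eq_zero _ _ _ _ _ _ _ (by simp), zero_comp]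
      exact (smul_zero _).symm
    | succ j =>
      rw [HomologicalComplex.mapBifunctor.d₂_eq _ _ _ _ _
        (show (ComplexShape.down ℕ).Rel (j + 1) j by simp) _ (show i + j = n by lia),
        Linear.units_smul_comp, Category.assoc]
      exact congrArg (fun t => _ • (_ ≫ t)) (T.incl_desc n f i j (by lia))

end Desc

section ExtProd

variable {K L : ChainComplex C ℕ} {B E : C} {m n : ℤ}

/-- The condition on the degrees in the definition of `extProd` is absorbed in `cochainAt`. -/
lemma extProd_eq (u : HomCochain K B m) (w : HomCochain L E n) (l : ℤ) (h : m + n = l) :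
    T.extProd u w l h = fun i : {i : ℕ // (i : ℤ) = l} => T.desc i.1 fun a b =>
      (m * n).negOnePow • T.mor (cochainAt u a) (cochainAt w b) := by
  funext i
  refine T.desc_congr fun a b _ => ?_
  split_ifs with hab
  · rw [cochainAt_of_eq _ hab.1, cochainAt_of_eq _ hab.2]
  · rw [not_and_or] at hab
    rcases hab with ha | hb
    · rw [cochainAt_of_ne _ ha, zero_mor, smul_zero]
    · rw [cochainAt_of_ne _ hb, mor_zero, smul_zero]

lemma extProd_add_left (u u' : HomCochain K B m) (w : HomCochain L E n) (l : ℤ) (h : m + n = l) :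
    T.extProd (u + u') w l h = T.extProd u w l h + T.extProd u' w l h := by
  simp only [extProd_eq, cochainAt_add, mor_add_left, smul_add]
  exact funext fun i => T.desc_add _ _ _

lemma extProd_add_right (u : HomCochain K B m) (w w' : HomCochain L E n) (l : ℤ) (h : m + n = l) :
    T.extProd u (w + w') l h = T.extProd u w l h + T.extProd u w' l h := by
  simp only [extProd_eq, cochainAt_add, mor_add_right, smul_add]
  exact funext fun i => T.desc_add _ _ _

@[simp]
lemma extProd_zero_left (w : HomCochain L E n) (l : ℤ) (h : m + n = l) :
    T.extProd (0 : HomCochain K B m) w l h = 0 := by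
  simp only [extProd_eq, cochainAt_zero, zero_mor, smul_zero]
  exact funext fun i => T.desc_zero _

@[simp]
lemma extProd_zero_right (u : HomCochain K B m) (l : ℤ) (h : m + n = l) :
    T.extProd u (0 : HomCochain L E n) l h = 0 := by
  simp only [extProd_eq, cochainAt_zero, mor_zero, smul_zero]
  exact funext fun i => T.desc_zero _

lemma homPost_extProd {B' E' : C} (f : B ⟶ B') (g : E ⟶ E') (u : HomCochain K B m)
    (w : HomCochain L E n) (l : ℤ) (h : m + n = l) :
    homPost _ (T.mor f g) l (T.extProd u w l h) =
      T.extProd (homPost _ f m u) (homPost _ g n w) l h := by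
  simp only [extProd_eq, cochainAt_post, ← mor_comp]
  funext i
  refine (T.desc_comp _ _ _).trans (T.desc_congr fun a b _ => ?_)
  rw [Linear.units_smul_comp]

/-- The sign `(-1)ᵃ` in the differential of `K ⊗ L` is constant on the support of a cochain of
degree `m`. -/
lemma negOnePow_smul_mor_cochainAt {Y Z : C} (u : HomCochain K B m) (a : ℕ) (g : Y ⟶ Z) :
    (-1 : ℤˣ) ^ a • T.mor (cochainAt u a) g = m.negOnePow • T.mor (cochainAt u a) g := by
  by_cases h : (a : ℤ) = m
  · subst h
    rfl
  · rw [cochainAt_of_ne _ h, zero_mor, smul_zero, smul_zero]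

/-- The Leibniz rule for external products of cochains. -/
lemma homD_extProd (u : HomCochain K B m) (w : HomCochain L E n) {l l' m' n' : ℤ}
    (h : m + n = l) (hl : l + 1 = l') (hm : m + 1 = m') (hn : n + 1 = n') :
    homD (T.tensorComplex K L) _ l l' hl (T.extProd u w l h) =
      n.negOnePow • T.extProd (homD K B m m' hm u) w l' (by lia) +
        T.extProd u (homD L E n n' hn w) l' (by lia) := by
  have e₁ : (m' * n).negOnePow = n.negOnePow * (m * n).negOnePow := by
    rw [← hm, ← Int.negOnePow_add, add_mul, one_mul, add_comm]
  have e₂ : (m * n').negOnePow = (m * n).negOnePow * m.negOnePow := by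
    rw [← hn, ← Int.negOnePow_add, mul_add, mul_one]
  simp only [extProd_eq]
  funext ⟨i, hi⟩
  have key : ∀ f f' : ∀ a b : ℕ, T.ob (K.X a) (L.X b) ⟶ T.ob B E,
      n.negOnePow • T.desc i f + T.desc i f' =
        T.desc i fun a b => n.negOnePow • f a b + f' a b := fun f f' => by
    rw [desc_add, desc_units_smul]
  refine Eq.trans ?_ (key _ _).symm
  cases i with
  | zero =>
    change 0 = _
    rw [← T.desc_zero 0]
    refine T.desc_congr fun a b hab => ?_
    obtain rfl : a = 0 := by lia
    obtain rfl : b = 0 := by lia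
    rw [cochainAt_homD_zero, cochainAt_homD_zero, zero_mor, mor_zero, smul_zero, smul_zero,
      smul_zero, add_zero]
  | succ i =>
    refine (T.d_desc i _).trans (T.desc_congr fun a b _ => ?_)
    congr 1
    · rw [e₁, mul_smul, smul_smul n.negOnePow, Int.units_mul_self, one_smul]
      cases a with
      | zero =>
        rw [cochainAt_homD_zero, zero_mor, smul_zero]
        rfl
      | succ a =>
        rw [cochainAt_homD_succ, ← map_app_mor, dLeft, Linear.comp_units_smul]
    · rw [e₂, mul_smul, ← negOnePow_smul_mor_cochainAt]
      cases b with
      | zero =>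
        rw [cochainAt_homD_zero, mor_zero, smul_zero, smul_zero]
        exact smul_zero _
      | succ b =>
        rw [cochainAt_homD_succ, ← map_mor, dRight, Linear.comp_units_smul, smul_comm]

/-- The external product of cocycles. -/
def extProdCocycle (u : homCocycles K B m) (w : homCocycles L E n) (l : ℤ) (h : m + n = l) :
    homCocycles (T.tensorComplex K L) (T.ob B E) l :=
  ⟨T.extProd u.1 w.1 l h, by
    rw [AddMonoidHom.mem_ker, T.homD_extProd u.1 w.1 h rfl rfl rfl, u.2, w.2, extProd_zero_left,
      extProd_zero_right, smul_zero, add_zero]⟩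

lemma extProdCocycle_add_right (u : homCocycles K B m) (w w' : homCocycles L E n) (l : ℤ)
    (h : m + n = l) :
    T.extProdCocycle u (w + w') l h = T.extProdCocycle u w l h + T.extProdCocycle u w' l h :=
  Subtype.ext (T.extProd_add_right u.1 w.1 w'.1 l h)

lemma extProdCocycle_add_left (u u' : homCocycles K B m) (w : homCocycles L E n) (l : ℤ)
    (h : m + n = l) :
    T.extProdCocycle (u + u') w l h = T.extProdCocycle u w l h + T.extProdCocycle u' w l h :=
  Subtype.ext (T.extProd_add_left u.1 u'.1 w.1 l h)

/-- The external product with the class of a fixed cocycle. -/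
def extProdRight (u : homCocycles K B m) (L : ChainComplex C ℕ) (E : C) (n l : ℤ) (h : m + n = l) :
    ExtGrp L E n →+ ExtGrp (T.tensorComplex K L) (T.ob B E) l :=
  QuotientAddGroup.lift _
    (AddMonoidHom.mk' (fun w => extMk (T.extProdCocycle u w l h)) (fun w w' => by
      rw [extProdCocycle_add_right, map_add]))
    (by
      rintro ⟨w, hw⟩ ⟨b, hb⟩
      rw [AddMonoidHom.mem_ker]
      change extMk _ = 0
      rw [← map_zero extMk]
      refine (extMk_eq_iff _ _).2 ⟨T.extProd u.1 b (l - 1) (by lia), ?_⟩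
      rw [T.homD_extProd u.1 b _ _ (rfl : m + 1 = m + 1) (by lia : n - 1 + 1 = n), u.2, hb,
        extProd_zero_left, smul_zero, zero_add]
      exact (sub_zero _).symm)

lemma extProdRight_mk (u : homCocycles K B m) (w : homCocycles L E n) (l : ℤ) (h : m + n = l) :
    T.extProdRight u L E n l h (extMk w) = extMk (T.extProdCocycle u w l h) :=
  rfl

/-- The external product `Extᵐ(A, B) × Extⁿ(A', E) ⟶ Extᵐ⁺ⁿ(A ⊗ A', B ⊗ E)`. -/
def extProdHom (K L : ChainComplex C ℕ) (B E : C) (m n l : ℤ) (h : m + n = l) :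
    ExtGrp K B m →+ ExtGrp L E n →+ ExtGrp (T.tensorComplex K L) (T.ob B E) l :=
  QuotientAddGroup.lift _
    (AddMonoidHom.mk' (fun u => T.extProdRight u L E n l h) (fun u u' => by
      refine AddMonoidHom.ext fun y => ?_
      obtain ⟨w, rfl⟩ := extMk_surjective y
      rw [AddMonoidHom.add_apply, extProdRight_mk, extProdRight_mk, extProdRight_mk,
        extProdCocycle_add_left, map_add]))
    (by
      rintro ⟨u, hu⟩ ⟨b, hb⟩
      rw [AddMonoidHom.mem_ker]
      refine AddMonoidHom.ext fun y => ?_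
      obtain ⟨w, rfl⟩ := extMk_surjective y
      change extMk _ = 0
      rw [← map_zero extMk]
      refine (extMk_eq_iff _ _).2 ⟨n.negOnePow • T.extProd b w.1 (l - 1) (by lia), ?_⟩
      rw [map_zsmul_unit, T.homD_extProd b w.1 _ _ (by lia : m - 1 + 1 = m) (rfl : n + 1 = n + 1),
        w.2, hb, extProd_zero_right, add_zero, smul_smul, Int.units_mul_self, one_smul]
      exact (sub_zero _).symm)

end ExtProd

end TensorProd

/-! ### The external product in the resolution construction -/

section Delta

variable {A B : C} (P : ProjectiveResolution A) (Q : ProjectiveResolution B) (n : ℤ)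

lemma delta_mk {k : ℕ} (u : homCocycles P.complex (syz Q k) (n + k))
    (w : HomCochain P.complex (Q.complex.X k) (n + k))
    (x : homCocycles P.complex (syz Q (k + 1)) (n + (k + 1 : ℕ)))
    (hw : homPost _ (syzPi Q k) _ w = u.1)
    (hx : homPost _ (syzIota Q k) _ x.1 = homD _ _ _ _ (by push_cast; lia) w) :
    delta P Q n k (extMk u) = (n + (k + 1 : ℕ)).negOnePow • extMk x :=
  connecting_mk P (syzSeq_shortExact Q k) (n + k) (n + (k + 1 : ℕ)) _ u w x hw hx

lemma exists_delta_mk {k : ℕ} (u : homCocycles P.complex (syz Q k) (n + k)) :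
    ∃ (w : HomCochain P.complex (Q.complex.X k) (n + k))
      (x : homCocycles P.complex (syz Q (k + 1)) (n + (k + 1 : ℕ))),
      homPost _ (syzPi Q k) _ w = u.1 ∧
      homPost _ (syzIota Q k) _ x.1 = homD _ _ _ _ (by push_cast; lia) w := by
  obtain ⟨x, hx⟩ := exists_connecting P (syzSeq_shortExact Q k) (n + k) (n + (k + 1 : ℕ))
    (by push_cast; lia) u
  exact ⟨_, x, liftCochain_post P (syzSeq_shortExact Q k) (n + k) u.1, hx⟩

variable {P Q n}

/-- Stably equal morphisms to a syzygy induce the same map to the direct limit, since the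
connecting homomorphism vanishes on classes that lift to the projective cover. -/
lemma resIota_extPost_congr {k : ℕ} {X : C} {g g' : X ⟶ syz Q k} (h : StablyEq Q g g')
    (z : ExtGrp P.complex X (n + k)) :
    resIota P Q n k (extPost _ g _ z) = resIota P Q n k (extPost _ g' _ z) := by
  obtain ⟨h, hh⟩ := h
  rw [← sub_eq_zero, ← map_sub, ← extPost_sub, hh, ← resIota_delta]
  obtain ⟨u, rfl⟩ := extMk_surjective z
  have := delta_mk P Q n ⟨homPost _ (h ≫ syzPi Q k) _ u.1, homPost_mem_cocycles _ u.2⟩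
    (homPost _ h _ u.1) 0 (homPost_comp _ _ _ _ _) (by
      have e : ∀ t (ht : n + k + 1 = t), homD P.complex X (n + k) t ht u.1 = 0 := by
        rintro _ rfl
        exact u.2
      rw [homD_post, e, map_zero]
      exact map_zero _)
  rw [extPost_mk, this, map_zero, smul_zero, map_zero]

end Delta

namespace TensorProd

variable {R : C} (T : TensorProd R)

variable {A B A' B' : C} {PA : ProjectiveResolution A} {PA' : ProjectiveResolution A'}
  {PB : ProjectiveResolution B} {PB' : ProjectiveResolution B'}
  (hA : QuasiIso (T.tensorAug PA PA')) (Q : ProjectiveResolution (T.ob B B'))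

/-- The external product of representatives in `Extᵐ⁺ᵖ(A, B̃ₚ)` and `Extⁿ⁺ᵠ(A', B̃'_q)`, sent to the
direct limit for `B ⊗ B'` by a morphism `B̃ₚ ⊗ B̃'_q ⟶ Q̃ₖ`, with the sign that makes it compatible
with the connecting homomorphisms in both variables. -/
def resTerm (m n : ℤ) (p q k : ℕ) (hk : k = p + q) (g : T.ob (syz PB p) (syz PB' q) ⟶ syz Q k) :
    ExtGrp PA.complex (syz PB p) (m + p) →+ ExtGrp PA'.complex (syz PB' q) (n + q) →+
      ResExt (T.tensorRes PA PA' hA) Q (m + n) :=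
  (AddMonoidHom.compHom ((m * q).negOnePow •
    (resIota (T.tensorRes PA PA' hA) Q (m + n) k).comp (extPost _ g (m + n + k)))).comp
    (T.extProdHom PA.complex PA'.complex (syz PB p) (syz PB' q) (m + p) (n + q) (m + n + k)
      (by rw [hk]; push_cast; ring))

lemma resTerm_apply {m n : ℤ} {p q k : ℕ} (hk : k = p + q)
    (g : T.ob (syz PB p) (syz PB' q) ⟶ syz Q k) (x : ExtGrp PA.complex (syz PB p) (m + p))
    (y : ExtGrp PA'.complex (syz PB' q) (n + q)) :
    T.resTerm hA Q m n p q k hk g x y = (m * q).negOnePow •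
      resIota (T.tensorRes PA PA' hA) Q (m + n) k (extPost _ g (m + n + k)
        (T.extProdHom PA.complex PA'.complex (syz PB p) (syz PB' q) (m + p) (n + q) (m + n + k)
          (by rw [hk]; push_cast; ring) x y)) :=
  rfl

lemma resTerm_mk {m n : ℤ} {p q k : ℕ} (hk : k = p + q)
    (g : T.ob (syz PB p) (syz PB' q) ⟶ syz Q k) (u : homCocycles PA.complex (syz PB p) (m + p))
    (w : homCocycles PA'.complex (syz PB' q) (n + q)) (h : m + p + (n + q) = m + n + k) :
    T.resTerm hA Q m n p q k hk g (extMk u) (extMk w) = (m * q).negOnePow •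
      resIota (T.tensorRes PA PA' hA) Q (m + n) k (extMk ⟨homPost _ g _ (T.extProd u.1 w.1 _ h),
        homPost_mem_cocycles g (T.extProdCocycle u w _ h).2⟩) :=
  rfl

variable {hA Q}

/-- By `Reach.stablyEq` and `resIota_extPost_congr` the order of the steps is irrelevant. -/
lemma resTerm_congr (hB : ∀ k, T.ExactProjective (syz PB k))
    (hB' : ∀ k, T.ExactProjective (syz PB' k)) {m n : ℤ} {p q k k' : ℕ} (hk : k = p + q)
    (hk' : k' = p + q) {g : T.ob (syz PB p) (syz PB' q) ⟶ syz Q k}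
    {g' : T.ob (syz PB p) (syz PB' q) ⟶ syz Q k'} (h : T.Reach PB PB' Q p q k g)
    (h' : T.Reach PB PB' Q p q k' g') :
    T.resTerm (PA := PA) (PA' := PA') hA Q m n p q k hk g = T.resTerm hA Q m n p q k' hk' g' := by
  subst hk
  subst hk'
  refine AddMonoidHom.ext fun x => AddMonoidHom.ext fun y => ?_
  rw [resTerm_apply, resTerm_apply]
  exact congrArg _ (resIota_extPost_congr (P := T.tensorRes PA PA' hA) (h.stablyEq T hB hB' h') _)

/-- Compatibility with the connecting homomorphism in the first variable: the sign `(-1)ⁿ⁺ᵠ` of the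
Leibniz rule is the product of the signs of the two connecting homomorphisms. -/
lemma resTerm_delta_left {m n : ℤ} {p q k : ℕ} (hk : k = p + q)
    {g : T.ob (syz PB p) (syz PB' q) ⟶ syz Q k}
    {g' : T.ob (syz PB (p + 1)) (syz PB' q) ⟶ syz Q (k + 1)}
    (h : IsShift Q (T.mor (syzIota PB p) (𝟙 (syz PB' q))) (T.mor (syzPi PB p) (𝟙 (syz PB' q))) g g')
    (x : ExtGrp PA.complex (syz PB p) (m + p)) (y : ExtGrp PA'.complex (syz PB' q) (n + q)) :
    T.resTerm hA Q m n (p + 1) q (k + 1) (by lia) g' (delta PA PB m p x) y =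
      T.resTerm hA Q m n p q k hk g x y := by
  obtain ⟨f, hf, hf'⟩ := h
  obtain ⟨u, rfl⟩ := extMk_surjective x
  obtain ⟨v, rfl⟩ := extMk_surjective y
  obtain ⟨w, u', hw, hu'⟩ := exists_delta_mk PA PB m u
  have hv : ∀ t (ht : n + q + 1 = t), homD PA'.complex _ (n + q) t ht v.1 = 0 := by
    rintro _ rfl
    exact v.2
  have e : m + p + (n + q) = m + n + k := by rw [hk]; push_cast; ring
  have e' : m + (p + 1 : ℕ) + (n + q) = m + n + (k + 1 : ℕ) := by rw [hk]; push_cast; ring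
  have c₁ : homPost (T.tensorComplex PA.complex PA'.complex) (syzPi Q k) _
      (homPost _ f _ (T.extProd w v.1 (m + n + k) e)) =
      homPost _ g _ (T.extProd u.1 v.1 (m + n + k) e) := by
    rw [homPost_comp, ← hf, ← homPost_comp, homPost_extProd, hw, homPost_id]
  have c₂ : homPost (T.tensorComplex PA.complex PA'.complex) (syzIota Q k) _
      ((n + q).negOnePow • homPost _ g' _ (T.extProd u'.1 v.1 (m + n + (k + 1 : ℕ)) e')) =
      homD _ _ (m + n + k) _ (by push_cast; lia)
        (homPost _ f _ (T.extProd w v.1 (m + n + k) e)) := by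
    rw [homD_post, T.homD_extProd w v.1 e _ (by push_cast; lia : m + p + 1 = m + (p + 1 : ℕ))
      (rfl : n + q + 1 = n + q + 1), hv, extProd_zero_right, add_zero, ← hu', map_zsmul_unit,
      map_zsmul_unit, homPost_comp, ← hf', ← homPost_comp, homPost_extProd, homPost_id]
  let z : homCocycles (T.tensorRes PA PA' hA).complex (syz Q (k + 1)) (m + n + (k + 1 : ℕ)) :=
    ⟨homPost _ g' _ (T.extProd u'.1 v.1 (m + n + (k + 1 : ℕ)) e'),
      homPost_mem_cocycles _ (T.extProdCocycle u' v _ e').2⟩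
  have key := delta_mk (T.tensorRes PA PA' hA) Q (m + n)
    ⟨homPost _ g _ (T.extProd u.1 v.1 (m + n + k) e),
      homPost_mem_cocycles _ (T.extProdCocycle u v _ e).2⟩
    (homPost _ f _ (T.extProd w v.1 (m + n + k) e))
    ((n + q).negOnePow • z) c₁ c₂
  rw [delta_mk PA PB m u w u' hw hu', map_zsmul_unit, AddMonoidHom.smul_apply,
    T.resTerm_mk hA Q _ _ _ _ e, T.resTerm_mk hA Q _ _ _ _ e', smul_smul]
  refine Eq.trans ?_ (congrArg _ (resIota_delta (T.tensorRes PA PA' hA) Q (m + n) k _))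
  refine Eq.trans ?_ (congrArg (fun t => _ • resIota _ _ _ _ t) key.symm)
  rw [map_zsmul_unit, map_zsmul_unit, map_zsmul_unit, smul_smul, smul_smul]
  refine congrArg₂ _ ?_ rfl
  rw [← Int.negOnePow_add, ← Int.negOnePow_add, ← Int.negOnePow_add, Int.negOnePow_eq_iff]
  exact ⟨-(n + q), by rw [hk]; push_cast; ring⟩

/-- Compatibility with the connecting homomorphism in the second variable: the sign `(-1)ᵖ` in
`Reach` and the change of `(-1)ᵐᵠ` by `(-1)ᵐ` together match the product `(-1)ᵐ⁺ᵖ` of the signs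
of the two connecting homomorphisms. -/
lemma resTerm_delta_right {m n : ℤ} {p q k : ℕ} (hk : k = p + q)
    {g : T.ob (syz PB p) (syz PB' q) ⟶ syz Q k}
    {g' : T.ob (syz PB p) (syz PB' (q + 1)) ⟶ syz Q (k + 1)}
    (h : IsShift Q (T.mor (𝟙 (syz PB p)) (syzIota PB' q)) (T.mor (𝟙 (syz PB p)) (syzPi PB' q)) g
      ((-1 : ℤˣ) ^ p • g'))
    (x : ExtGrp PA.complex (syz PB p) (m + p)) (y : ExtGrp PA'.complex (syz PB' q) (n + q)) :
    T.resTerm hA Q m n p (q + 1) (k + 1) (by lia) g' x (delta PA' PB' n q y) =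
      T.resTerm hA Q m n p q k hk g x y := by
  obtain ⟨f, hf, hf'⟩ := h
  obtain ⟨u, rfl⟩ := extMk_surjective x
  obtain ⟨v, rfl⟩ := extMk_surjective y
  obtain ⟨w, v', hw, hv'⟩ := exists_delta_mk PA' PB' n v
  have hu : ∀ t (ht : m + p + 1 = t), homD PA.complex _ (m + p) t ht u.1 = 0 := by
    rintro _ rfl
    exact u.2
  have e : m + p + (n + q) = m + n + k := by rw [hk]; push_cast; ring
  have e' : m + p + (n + (q + 1 : ℕ)) = m + n + (k + 1 : ℕ) := by rw [hk]; push_cast; ring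
  have c₁ : homPost (T.tensorComplex PA.complex PA'.complex) (syzPi Q k) _
      (homPost _ f _ (T.extProd u.1 w (m + n + k) e)) =
      homPost _ g _ (T.extProd u.1 v.1 (m + n + k) e) := by
    rw [homPost_comp, ← hf, ← homPost_comp, homPost_extProd, hw, homPost_id]
  have c₂ : homPost (T.tensorComplex PA.complex PA'.complex) (syzIota Q k) _
      ((-1 : ℤˣ) ^ p • homPost _ g' _ (T.extProd u.1 v'.1 (m + n + (k + 1 : ℕ)) e')) =
      homD _ _ (m + n + k) _ (by push_cast; lia)
        (homPost _ f _ (T.extProd u.1 w (m + n + k) e)) := by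
    rw [homD_post, T.homD_extProd u.1 w e _ (rfl : m + p + 1 = m + p + 1)
      (by push_cast; lia : n + q + 1 = n + (q + 1 : ℕ)), hu, extProd_zero_left, smul_zero, zero_add,
      ← hv', ← homPost_units_smul, homPost_comp, ← hf', ← homPost_comp, homPost_extProd,
      homPost_id]
  let z : homCocycles (T.tensorRes PA PA' hA).complex (syz Q (k + 1)) (m + n + (k + 1 : ℕ)) :=
    ⟨homPost _ g' _ (T.extProd u.1 v'.1 (m + n + (k + 1 : ℕ)) e'),
      homPost_mem_cocycles _ (T.extProdCocycle u v' _ e').2⟩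
  have key := delta_mk (T.tensorRes PA PA' hA) Q (m + n)
    ⟨homPost _ g _ (T.extProd u.1 v.1 (m + n + k) e),
      homPost_mem_cocycles _ (T.extProdCocycle u v _ e).2⟩
    (homPost _ f _ (T.extProd u.1 w (m + n + k) e))
    ((-1 : ℤˣ) ^ p • z) c₁ c₂
  rw [delta_mk PA' PB' n v w v' hw hv', map_zsmul_unit,
    T.resTerm_mk hA Q _ _ _ _ e, T.resTerm_mk hA Q _ _ _ _ e', smul_smul]
  refine Eq.trans ?_ (congrArg _ (resIota_delta (T.tensorRes PA PA' hA) Q (m + n) k _))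
  refine Eq.trans ?_ (congrArg (fun t => _ • resIota _ _ _ _ t) key.symm)
  rw [map_zsmul_unit, map_zsmul_unit, map_zsmul_unit, smul_smul, smul_smul]
  refine congrArg₂ _ ?_ rfl
  have : (-1 : ℤˣ) ^ p = (p : ℤ).negOnePow := rfl
  rw [this, ← Int.negOnePow_add, ← Int.negOnePow_add, ← Int.negOnePow_add, Int.negOnePow_eq_iff]
  exact ⟨-p, by rw [hk]; push_cast; ring⟩

/-- The biadditive map on the direct limits that is given by the external products of
representatives. -/
lemma exists_resTerm_desc (hB : ∀ k, T.ExactProjective (syz PB k))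
    (hB' : ∀ k, T.ExactProjective (syz PB' k)) (hA : QuasiIso (T.tensorAug PA PA'))
    (Q : ProjectiveResolution (T.ob B B')) (m n : ℤ) :
    ∃ v : ResExt PA PB m →+ ResExt PA' PB' n →+ ResExt (T.tensorRes PA PA' hA) Q (m + n),
      ∀ (p q k : ℕ) (hk : k = p + q) (g : T.ob (syz PB p) (syz PB' q) ⟶ syz Q k),
        T.Reach PB PB' Q p q k g → ∀ x y,
        v (resIota PA PB m p x) (resIota PA' PB' n q y) = T.resTerm hA Q m n p q k hk g x y := by
  choose k g hg using T.exists_reach hB hB' Q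
  obtain ⟨v, hv⟩ := exists_resDesc₂ (P := PA) (Q := PB) (n := m) (P' := PA') (Q' := PB') (n' := n)
    (Z := ResExt (T.tensorRes PA PA' hA) Q (m + n))
    (fun p q => T.resTerm hA Q m n p q (k p q) (hg p q).eq_add (g p q))
    (fun p q x y => by
      obtain ⟨g', hs, hr⟩ := (hg p q).exists_left T hB hB'
      beta_reduce
      rw [T.resTerm_congr hB hB' _ hr.eq_add (hg (p + 1) q) hr]
      exact T.resTerm_delta_left (hg p q).eq_add hs x y)
    (fun p q x y => by
      obtain ⟨g', hs, hr⟩ := (hg p q).exists_right T hB hB'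
      beta_reduce
      rw [T.resTerm_congr hB hB' _ hr.eq_add (hg p (q + 1)) hr]
      exact T.resTerm_delta_right (hg p q).eq_add hs x y)
  refine ⟨v, fun p q k' hk' g' hr x y => ?_⟩
  rw [hv, T.resTerm_congr hB hB' _ hk' (hg p q) hr]

/-- The sign of the external product is the product of the sign in `resTerm` and the sign by which
the lift differs from a morphism of `Reach`. -/
lemma resSign_eq (m : ℤ) (o : ℕ → Bool) (k : ℕ) :
    resSign m o k = (m * (counts o k).2).negOnePow * pathSign o k := by
  induction k with
  | zero => simp [resSign, counts, pathSign]
  | succ k ih =>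
    rw [resSign, pathSign, ih, counts]
    cases o k with
    | true => simp [step, stepSign]
    | false =>
      have : (-1 : ℤˣ) ^ (counts o k).1 = ((counts o k).1 : ℤ).negOnePow := rfl
      simp only [step, stepSign, this]
      push_cast
      rw [mul_add, mul_one, Int.negOnePow_add, Int.negOnePow_add]
      simp only [mul_assoc, mul_comm, mul_left_comm]

/-- Every pair of numbers of steps is attained by a sequence in which both kinds of steps occur
infinitely often. -/
lemma exists_admissible (p q : ℕ) :
    ∃ (o : ℕ → Bool) (k : ℕ), Admissible o ∧ (counts o k).1 = p ∧ (counts o k).2 = q := by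
  let o : ℕ → Bool := fun i =>
    if i < p then true else if i < p + q then false else decide (i % 2 = 0)
  have h1 : ∀ i, i ≤ p → counts o i = (i, 0) := by
    intro i
    induction i with
    | zero => exact fun _ => rfl
    | succ i ih =>
      intro hi
      have : o i = true := if_pos hi
      rw [counts, ih (by lia), this]
      rfl
  have h2 : ∀ j, j ≤ q → counts o (p + j) = (p, j) := by
    intro j
    induction j with
    | zero => exact fun _ => h1 p le_rfl
    | succ j ih =>
      intro hj
      have : o (p + j) = false := by
        change (if _ then _ else _) = _
        rw [if_neg (by lia), if_pos (by lia)]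
      rw [← add_assoc, counts, ih (by lia), this]
      rfl
  refine ⟨o, p + q, fun N => ⟨⟨2 * (N + p + q), by lia, ?_⟩, ⟨2 * (N + p + q) + 1, by lia, ?_⟩⟩,
    by rw [h2 q le_rfl], by rw [h2 q le_rfl]⟩
  · change (if _ then _ else if _ then _ else _) = _
    rw [if_neg (by lia), if_neg (by lia), decide_eq_true_eq]
    lia
  · change (if _ then _ else if _ then _ else _) = _
    rw [if_neg (by lia), if_neg (by lia), decide_eq_false_iff_not]
    lia

/-- The external product in the resolution construction exists. -/
theorem exists_isResProduct (hB : ∀ k, T.ExactProjective (syz PB k))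
    (hB' : ∀ k, T.ExactProjective (syz PB' k)) (hA : QuasiIso (T.tensorAug PA PA'))
    (Q : ProjectiveResolution (T.ob B B')) (m n : ℤ) :
    ∃ v : ResExt PA PB m →+ ResExt PA' PB' n →+ ResExt (T.tensorRes PA PA' hA) Q (m + n),
      T.IsResProduct v := by
  obtain ⟨v, hv⟩ := T.exists_resTerm_desc hB hB' hA Q m n
  refine ⟨v, fun o _ ℓ k x y =>
    ⟨homPost_mem_cocycles _ (T.extProdCocycle x y _ (counts_degree o k m n)).2, ?_⟩⟩
  rw [hv _ _ k (counts_sum o k).symm _ (ℓ.reach T k), resTerm_apply]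
  refine (congrArg (fun t => (m * ((counts o k).2 : ℤ)).negOnePow •
    resIota (T.tensorRes PA PA' hA) Q (m + n) k t)
      (extPost_units_smul (T.tensorComplex PA.complex PA'.complex) (pathSign o k) (ℓ.g k) _
        (T.extProdHom PA.complex PA'.complex _ _ _ _ _ (counts_degree o k m n)
          (extMk x) (extMk y)))).trans ?_
  refine (congrArg (fun t => (m * ((counts o k).2 : ℤ)).negOnePow • t)
    (map_zsmul_unit (resIota (T.tensorRes PA PA' hA) Q (m + n) k) (pathSign o k) _)).trans ?_
  rw [smul_smul, resSign_eq]
  rfl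

/-- The external product in the resolution construction is unique. -/
theorem IsResProduct.unique (hB : ∀ k, T.ExactProjective (syz PB k))
    (hB' : ∀ k, T.ExactProjective (syz PB' k)) {m n : ℤ}
    {v v' : ResExt PA PB m →+ ResExt PA' PB' n →+ ResExt (T.tensorRes PA PA' hA) Q (m + n)}
    (hv : T.IsResProduct v) (hv' : T.IsResProduct v') : v = v' := by
  refine AddMonoidHom.ext fun x => AddMonoidHom.ext fun y => ?_
  obtain ⟨p, x, rfl⟩ := resIota_surjective PA PB m x
  obtain ⟨q, y, rfl⟩ := resIota_surjective PA' PB' n y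
  obtain ⟨o, k, ho, rfl, rfl⟩ := exists_admissible p q
  obtain ⟨x, rfl⟩ := extMk_surjective x
  obtain ⟨y, rfl⟩ := extMk_surjective y
  obtain ⟨ℓ⟩ := T.exists_oLift PB PB' hB hB' o Q
  obtain ⟨_, h⟩ := hv o ho ℓ k x y
  obtain ⟨_, h'⟩ := hv' o ho ℓ k x y
  exact h.trans h'.symm

end TensorProd

/-! ### The external product in the hypercohomology construction -/

lemma hypComp_hypPost {K L L' : ChainComplex C ℕ} (f : L ⟶ L') {n : ℤ} (φ : Hyp K L n) (k : ℕ)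
    (l : ℤ) (hl : l = n + k) :
    hypComp (hypPost f φ) k l hl = homPost K (f.f k) l (hypComp φ k l hl) :=
  rfl

lemma CocycleFrom.hypPost {K L L' : ChainComplex C ℕ} {n : ℤ} {φ : Hyp K L n} {k : ℕ}
    (h : CocycleFrom φ k) (f : L ⟶ L') : CocycleFrom (hypPost f φ) k := by
  refine cocycleFrom_of_eq fun j hj l l' hl hl' => ?_
  have := congrArg (homPost K (f.f j) l') (h.eq hj l l' hl hl')
  rw [hypComp_hypPost, hypComp_hypPost, homPost_comp, f.comm, ← homPost_comp, this,
    map_zsmul_unit, ← homD_post]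

lemma CocycleFrom.isAlmostCocycle {K L : ChainComplex C ℕ} {n : ℤ} {φ : Hyp K L n} {k : ℕ}
    (h : CocycleFrom φ k) : IsAlmostCocycle φ :=
  ⟨k, h⟩

lemma counts_mono (o : ℕ → Bool) {k j : ℕ} (h : k ≤ j) :
    (counts o k).1 ≤ (counts o j).1 ∧ (counts o k).2 ≤ (counts o j).2 := by
  induction j, h using Nat.le_induction with
  | base => exact ⟨le_rfl, le_rfl⟩
  | succ j _ ih =>
    rw [counts]
    cases o j
    · exact ⟨ih.1, Nat.le_succ_of_le ih.2⟩
    · exact ⟨Nat.le_succ_of_le ih.1, ih.2⟩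

/-- Along a sequence in which both kinds of steps occur infinitely often, both numbers of steps
become arbitrarily large. -/
lemma Admissible.exists_le_counts {o : ℕ → Bool} (ho : Admissible o) (a b : ℕ) :
    ∃ k, a ≤ (counts o k).1 ∧ b ≤ (counts o k).2 := by
  have h₁ : ∀ a, ∃ k, a ≤ (counts o k).1 := by
    intro a
    induction a with
    | zero => exact ⟨0, Nat.zero_le _⟩
    | succ a ih =>
      obtain ⟨k, hk⟩ := ih
      obtain ⟨j, hj, e⟩ := (ho k).1
      refine ⟨j + 1, ?_⟩
      rw [counts, e]
      exact Nat.succ_le_succ (hk.trans (counts_mono o hj).1)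
  have h₂ : ∀ b, ∃ k, b ≤ (counts o k).2 := by
    intro b
    induction b with
    | zero => exact ⟨0, Nat.zero_le _⟩
    | succ b ih =>
      obtain ⟨k, hk⟩ := ih
      obtain ⟨j, hj, e⟩ := (ho k).2
      refine ⟨j + 1, ?_⟩
      rw [counts, e]
      exact Nat.succ_le_succ (hk.trans (counts_mono o hj).2)
  obtain ⟨k, hk⟩ := h₁ a
  obtain ⟨j, hj⟩ := h₂ b
  exact ⟨max k j, hk.trans (counts_mono o (le_max_left k j)).1,
    hj.trans (counts_mono o (le_max_right k j)).2⟩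

lemma units_smul_smul_self {X : Type*} [AddCommGroup X] (ε : ℤˣ) (x : X) : ε • ε • x = x := by
  rw [smul_smul, Int.units_mul_self, one_smul]

lemma units_smul_smul_congr {X : Type*} [AddCommGroup X] {ε₁ ε₂ ε₃ ε₄ : ℤˣ}
    (h : ε₁ * ε₂ = ε₃ * ε₄) (x : X) : ε₁ • ε₂ • x = ε₃ • ε₄ • x := by
  rw [smul_smul, h, smul_smul]

/-- The factor by which `hypSign` changes in one step from the pair of indices `s`. -/
def hypStepSign (n : ℤ) (b : Bool) (s : ℕ × ℕ) : ℤˣ :=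
  match b with
  | true => n.negOnePow
  | false => (-1) ^ s.1

lemma hypSign_succ (m n : ℤ) (o : ℕ → Bool) (k : ℕ) :
    hypSign m n o (k + 1) = hypSign m n o k * hypStepSign n (o k) (counts o k) :=
  rfl

/-- The signs of the products and those of the canonical isomorphisms match. -/
lemma hypSign_eq (m n : ℤ) (o : ℕ → Bool) (k : ℕ) :
    (-1 : ℤˣ) ^ (k * (k + 1) / 2) * (hypSign m n o k *
        ((m + (counts o k).1) * (n + (counts o k).2)).negOnePow) =
      (-1) ^ ((counts o k).1 * ((counts o k).1 + 1) / 2) *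
        ((-1) ^ ((counts o k).2 * ((counts o k).2 + 1) / 2) * resSign m o k) := by
  induction k with
  | zero => simp [hypSign, resSign, counts]
  | succ k ih =>
    have hk := counts_sum o k
    rw [hypSign_succ, resSign, counts, negOnePow_triangle_succ]
    generalize hypSign m n o k = x at ih ⊢
    generalize resSign m o k = y at ih ⊢
    generalize counts o k = s at ih hk ⊢
    obtain ⟨p, q⟩ := s
    dsimp only at hk ih
    have hk' : (-1 : ℤˣ) ^ (k + 1) = (-1) ^ p * (-1) ^ (q + 1) := by rw [← pow_add, ← hk, add_assoc]
    have hpow : ∀ i : ℕ, (i : ℤ).negOnePow = (-1 : ℤˣ) ^ i := fun i => rfl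
    cases o k with
    | true =>
      simp only [hypStepSign, step]
      have e : ((m + (p + 1 : ℕ)) * (n + q)).negOnePow =
          ((m + p) * (n + q)).negOnePow * (n.negOnePow * (-1) ^ q) := by
        rw [← hpow, ← Int.negOnePow_add, ← Int.negOnePow_add]
        congr 1
        push_cast
        ring
      rw [e, hk', negOnePow_triangle_succ, mul_one]
      have hn : n.negOnePow * n.negOnePow = 1 := Int.units_mul_self _
      have hq : (-1 : ℤˣ) ^ q * (-1) ^ q = 1 := Int.units_mul_self _
      rw [pow_succ (-1 : ℤˣ) q, pow_succ (-1 : ℤˣ) p]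
      generalize (-1 : ℤˣ) ^ q = b at hq ⊢
      generalize (-1 : ℤˣ) ^ p = a
      generalize (-1 : ℤˣ) ^ (k * (k + 1) / 2) = c at ih ⊢
      calc _ = (c * (x * ((m + p) * (n + q)).negOnePow)) *
            (n.negOnePow * n.negOnePow) * (b * b) * (a * (-1)) := by ac_rfl
        _ = _ := by
          rw [ih, hn, hq, mul_one, mul_one]
          ac_rfl
    | false =>
      simp only [hypStepSign, step]
      have e : ((m + p) * (n + (q + 1 : ℕ))).negOnePow =
          ((m + p) * (n + q)).negOnePow * (m + p).negOnePow := by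
        rw [← Int.negOnePow_add]
        congr 1
        push_cast
        ring
      rw [e, hk', negOnePow_triangle_succ]
      have hp : (-1 : ℤˣ) ^ p * (-1) ^ p = 1 := Int.units_mul_self _
      generalize (-1 : ℤˣ) ^ p = a at hp ⊢
      generalize (-1 : ℤˣ) ^ (q + 1) = b
      generalize (-1 : ℤˣ) ^ (k * (k + 1) / 2) = c at ih ⊢
      calc _ = (c * (x * ((m + p) * (n + q)).negOnePow)) * (a * a) * (m + p).negOnePow * b := by
            ac_rfl
        _ = _ := by
          rw [ih, hp, mul_one]
          ac_rfl

namespace TensorProd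

variable {R : C} (T : TensorProd R)

section ExtProdSmul

variable {K L : ChainComplex C ℕ} {B E : C} {m n : ℤ}

lemma extProd_units_smul_left (ε : ℤˣ) (u : HomCochain K B m) (w : HomCochain L E n) (l : ℤ)
    (h : m + n = l) : T.extProd (ε • u) w l h = ε • T.extProd u w l h := by
  let F : HomCochain K B m →+ HomCochain (T.tensorComplex K L) (T.ob B E) l :=
    AddMonoidHom.mk' (fun u => T.extProd u w l h) fun u u' => T.extProd_add_left u u' w l h
  exact map_zsmul_unit F ε u

lemma extProd_units_smul_right (ε : ℤˣ) (u : HomCochain K B m) (w : HomCochain L E n) (l : ℤ)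
    (h : m + n = l) : T.extProd u (ε • w) l h = ε • T.extProd u w l h := by
  let F : HomCochain L E n →+ HomCochain (T.tensorComplex K L) (T.ob B E) l :=
    AddMonoidHom.mk' (fun w => T.extProd u w l h) fun w w' => T.extProd_add_right u w w' l h
  exact map_zsmul_unit F ε w

end ExtProdSmul

variable {A B A' B' : C} {PA : ProjectiveResolution A} {PA' : ProjectiveResolution A'}
  {PB : ProjectiveResolution B} {PB' : ProjectiveResolution B'}

section Cochains

variable {m n : ℤ} (φ : Hyp PA.complex PB.complex m) (ψ : Hyp PA'.complex PB'.complex n)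

/-- The component of `φ ⊗ᵒ ψ`, up to sign, at the pair of indices `s`. -/
def prodComp (b : Bool) (s : ℕ × ℕ) (l : ℤ) :
    HomCochain (T.tensorComplex PA.complex PA'.complex) (T.stepOb PB PB' b s) l :=
  fun i => T.desc i.1 (T.stepProd PA PA' PB PB' φ ψ b s)

/-- `stepProd` involves no sign, whereas `extProd` does: this is the factor that appears here. -/
lemma prodComp_true (p q : ℕ) (l : ℤ) (h : m + p + (n + q) = l) :
    T.prodComp φ ψ true (p, q) l = ((m + p) * (n + q)).negOnePow •
      T.extProd (hypComp φ p (m + p) rfl) (syzComp PA' PB' ψ q) l h := by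
  funext i
  refine Eq.trans (T.desc_congr fun a b _ => ?_) (T.desc_units_smul _ _ _)
  rw [stepProd]
  split_ifs with h₁ h₂ h₂
  · exact (units_smul_smul_self _ _).symm
  · exact absurd ⟨h₁.1.trans (add_comm _ _), h₁.2.trans (add_comm _ _)⟩ h₂
  · exact absurd ⟨h₂.1.trans (add_comm _ _), h₂.2.trans (add_comm _ _)⟩ h₁
  · exact (smul_zero _).symm

lemma prodComp_false (p q : ℕ) (l : ℤ) (h : m + p + (n + q) = l) :
    T.prodComp φ ψ false (p, q) l = ((m + p) * (n + q)).negOnePow •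
      T.extProd (syzComp PA PB φ p) (hypComp ψ q (n + q) rfl) l h := by
  funext i
  refine Eq.trans (T.desc_congr fun a b _ => ?_) (T.desc_units_smul _ _ _)
  rw [stepProd]
  split_ifs with h₁ h₂ h₂
  · exact (units_smul_smul_self _ _).symm
  · exact absurd ⟨h₁.1.trans (add_comm _ _), h₁.2.trans (add_comm _ _)⟩ h₂
  · exact absurd ⟨h₂.1.trans (add_comm _ _), h₂.2.trans (add_comm _ _)⟩ h₁
  · exact (smul_zero _).symm

lemma homPost_stepPi_prodComp (b : Bool) (s : ℕ × ℕ) (l : ℤ) (h : m + s.1 + (n + s.2) = l) :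
    homPost _ (T.stepPi PB PB' b s) l (T.prodComp φ ψ b s l) =
      ((m + s.1) * (n + s.2)).negOnePow •
        T.extProd (syzComp PA PB φ s.1) (syzComp PA' PB' ψ s.2) l h := by
  obtain ⟨p, q⟩ := s
  cases b
  · rw [T.prodComp_false φ ψ p q l h]
    refine (map_zsmul_unit _ _ _).trans (congrArg _ ?_)
    refine (T.homPost_extProd _ _ _ _ _ _).trans ?_
    rw [homPost_id]
    rfl
  · rw [T.prodComp_true φ ψ p q l h]
    refine (map_zsmul_unit _ _ _).trans (congrArg _ ?_)
    refine (T.homPost_extProd _ _ _ _ _ _).trans ?_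
    rw [homPost_id]
    rfl

lemma homPost_syzIota_syzComp {φ : Hyp PA.complex PB.complex m} {p : ℕ} (hφ : CocycleFrom φ p)
    (l l' : ℤ) (hl : l = m + p) (hl' : l + 1 = l') (h : m + (p + 1 : ℕ) = l') :
    homPost PA.complex (syzIota PB p) l' (recast h (syzComp PA PB φ (p + 1))) =
      m.negOnePow • homD _ _ l l' hl' (hypComp φ p l hl) := by
  subst h
  rw [recast_rfl, syzComp_eq, homPost_comp, syzPi_syzIota]
  exact hφ.eq le_rfl _ _ _ _

variable {φ ψ}

/-- The cocycle condition for `φ ⊗ᵒ ψ` in one step, before the signs `hypSign` are inserted. -/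
lemma homPost_stepIota_extProd {s : ℕ × ℕ} (hφ : CocycleFrom φ s.1) (hψ : CocycleFrom ψ s.2)
    (b : Bool) (l l' : ℤ) (h : m + s.1 + (n + s.2) = l) (hl : l + 1 = l')
    (h' : m + (step b s).1 + (n + (step b s).2) = l') :
    (hypStepSign n b s * ((m + (step b s).1) * (n + (step b s).2)).negOnePow) •
      homPost _ (T.stepIota PB PB' b s) l'
        (T.extProd (syzComp PA PB φ (step b s).1) (syzComp PA' PB' ψ (step b s).2) l' h') =
      (m + n).negOnePow • homD _ _ l l' hl (T.prodComp φ ψ b s l) := by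
  obtain ⟨p, q⟩ := s
  replace hφ : CocycleFrom φ p := hφ
  replace hψ : CocycleFrom ψ q := hψ
  cases b
  · rw [T.prodComp_false φ ψ p q l h]
    replace h' : m + p + (n + (q + 1 : ℕ)) = l' := h'
    have e₁ := T.homPost_extProd (𝟙 (syz PB p)) (syzIota PB' q) (syzComp PA PB φ p)
      (syzComp PA' PB' ψ (q + 1)) l' h'
    have e₂ := homPost_syzIota_syzComp hψ (n + q) (n + (q + 1 : ℕ)) rfl (by push_cast; lia) rfl
    rw [recast_rfl] at e₂
    rw [homPost_id, e₂, extProd_units_smul_right] at e₁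
    have e₃ := T.homD_extProd (syzComp PA PB φ p) (hypComp ψ q (n + q) rfl) h hl rfl
      (by push_cast; lia : n + q + 1 = n + (q + 1 : ℕ))
    have e₄ : homD PA.complex (syz PB p) (m + p) (m + p + 1) rfl (syzComp PA PB φ p) = 0 :=
      hφ.syzComp_mem
    rw [e₄, extProd_zero_left, smul_zero, zero_add] at e₃
    refine (congrArg _ e₁).trans (Eq.trans ?_ (congrArg _ (map_zsmul_unit _ _ _)).symm)
    refine Eq.trans ?_ (congrArg (fun t => (m + n).negOnePow •
      ((m + p) * (n + q)).negOnePow • t) e₃).symm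
    refine units_smul_smul_congr ?_ _
    simp only [hypStepSign, step]
    have hp : (-1 : ℤˣ) ^ p = (p : ℤ).negOnePow := rfl
    rw [hp, ← Int.negOnePow_add, ← Int.negOnePow_add, ← Int.negOnePow_add, Int.negOnePow_eq_iff]
    refine ⟨(p : ℤ), ?_⟩
    push_cast
    ring
  · rw [T.prodComp_true φ ψ p q l h]
    replace h' : m + (p + 1 : ℕ) + (n + q) = l' := h'
    have e₁ := T.homPost_extProd (syzIota PB p) (𝟙 (syz PB' q)) (syzComp PA PB φ (p + 1))
      (syzComp PA' PB' ψ q) l' h'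
    have e₂ := homPost_syzIota_syzComp hφ (m + p) (m + (p + 1 : ℕ)) rfl (by push_cast; lia) rfl
    rw [recast_rfl] at e₂
    rw [homPost_id, e₂, extProd_units_smul_left] at e₁
    have e₃ := T.homD_extProd (hypComp φ p (m + p) rfl) (syzComp PA' PB' ψ q) h hl
      (by push_cast; lia : m + p + 1 = m + (p + 1 : ℕ)) rfl
    have e₄ : homD PA'.complex (syz PB' q) (n + q) (n + q + 1) rfl (syzComp PA' PB' ψ q) = 0 :=
      hψ.syzComp_mem
    rw [e₄, extProd_zero_right, add_zero] at e₃
    refine (congrArg _ e₁).trans (Eq.trans ?_ (congrArg _ (map_zsmul_unit _ _ _)).symm)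
    refine Eq.trans ?_ (congrArg (fun t => (m + n).negOnePow •
      ((m + p) * (n + q)).negOnePow • t) e₃).symm
    refine (units_smul_smul_congr ?_ _).trans (congrArg _ (mul_smul _ _ _))
    simp only [hypStepSign, step]
    rw [← Int.negOnePow_add, ← Int.negOnePow_add, ← Int.negOnePow_add, ← Int.negOnePow_add,
      Int.negOnePow_eq_iff]
    refine ⟨0, ?_⟩
    push_cast
    ring

/-- If `φ` and `ψ` satisfy the cocycle condition from the degrees on that are reached after `k`
steps, then `φ ⊗ᵒ ψ` satisfies it from degree `k` on. -/
lemma cocycleFrom_oProd (o : ℕ → Bool) {k : ℕ} (hφ : CocycleFrom φ (counts o k).1)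
    (hψ : CocycleFrom ψ (counts o k).2) : CocycleFrom (T.oProd PA PA' PB PB' o φ ψ) k := by
  refine cocycleFrom_of_eq fun j hj l l' hl hl' => ?_
  have h := T.homPost_stepIota_extProd (hφ.mono (counts_mono o hj).1)
    (hψ.mono (counts_mono o hj).2) (o j) l l' ((counts_degree o j m n).trans hl.symm) hl'
    ((counts_degree o (j + 1) m n).trans (by push_cast; lia))
  have h' := T.homPost_stepPi_prodComp φ ψ (o (j + 1)) (counts o (j + 1)) l'
    ((counts_degree o (j + 1) m n).trans (by push_cast; lia))
  rw [mul_smul, ← map_zsmul_unit] at h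
  have h'' := (congrArg (fun t => hypStepSign n (o j) (counts o j) •
    homPost _ (T.oIota PB PB' o j) l' t) h').trans h
  have e : homPost _ ((T.oComplex PB PB' o).d (j + 1) j) l'
      (hypComp (T.oProd PA PA' PB PB' o φ ψ) (j + 1) l' (by push_cast; lia)) =
      hypSign m n o (j + 1) • homPost _ (T.oIota PB PB' o j) l'
        (homPost _ (T.oPi PB PB' o (j + 1)) l'
          (T.prodComp φ ψ (o (j + 1)) (counts o (j + 1)) l')) := by
    rw [homPost_comp, ← T.oComplex_d, ← map_zsmul_unit]
    rfl
  have e' : homD _ _ l l' hl' (hypComp (T.oProd PA PA' PB PB' o φ ψ) j l hl) =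
      hypSign m n o j • homD _ _ l l' hl' (T.prodComp φ ψ (o j) (counts o j) l) := by
    rw [← map_zsmul_unit]
    rfl
  rw [e, e', hypSign_succ, mul_smul]
  exact (congrArg _ h'').trans (units_smul_smul_congr (mul_comm _ _) _)

/-- The projection to the syzygy of a component of `φ ⊗ᵒ ψ`, carried to `Q` by a lift of the
identity, is an external product of cocycles with values in syzygies, up to sign. -/
lemma syzComp_hypPost_oProd {o : ℕ → Bool} {Q : ProjectiveResolution (T.ob B B')}
    (hA : QuasiIso (T.tensorAug PA PA')) (ℓ : T.OLift PB PB' o Q) (k : ℕ) :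
    syzComp (T.tensorRes PA PA' hA) Q (hypPost ℓ.f (T.oProd PA PA' PB PB' o φ ψ)) k =
      (hypSign m n o k * ((m + (counts o k).1) * (n + (counts o k).2)).negOnePow) •
        homPost (T.tensorComplex PA.complex PA'.complex) (ℓ.g k) (m + n + k)
          (T.extProd (syzComp PA PB φ (counts o k).1) (syzComp PA' PB' ψ (counts o k).2) _
            (counts_degree o k m n)) := by
  have h' := T.homPost_stepPi_prodComp φ ψ (o k) (counts o k) _ (counts_degree o k m n)
  have h'' := (homPost_comp _ (ℓ.f.f k) (syzPi Q k) _ _).trans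
    ((congrArg (fun t => homPost (T.tensorComplex PA.complex PA'.complex) t (m + n + k)
      (T.prodComp φ ψ (o k) (counts o k) (m + n + k))) (ℓ.pi_comm k)).symm.trans
      ((homPost_comp _ (T.oPi PB PB' o k) (ℓ.g k) _ _).symm.trans
        ((congrArg _ h').trans (map_zsmul_unit _ _ _))))
  rw [mul_smul]
  refine Eq.trans ?_ (congrArg (fun t => hypSign m n o k • t) h'')
  refine Eq.trans (congrArg (homPost (T.tensorComplex PA.complex PA'.complex) (syzPi Q k)
    (m + n + k)) (map_zsmul_unit (homPost (T.tensorComplex PA.complex PA'.complex) (ℓ.f.f k)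
      (m + n + k)) (hypSign m n o k) (T.prodComp φ ψ (o k) (counts o k) (m + n + k))))
    (map_zsmul_unit _ _ _)

end Cochains

variable {hA : QuasiIso (T.tensorAug PA PA')} {Q : ProjectiveResolution (T.ob B B')} {m n : ℤ}

variable {T} in
/-- The canonical isomorphisms carry the external product of the resolution construction to that of
the hypercohomology construction. -/
theorem IsResProduct.isHypProduct
    {v : ResExt PA PB m →+ ResExt PA' PB' n →+ ResExt (T.tensorRes PA PA' hA) Q (m + n)}
    (hv : T.IsResProduct v) {Φ : HypExt PA.complex PB.complex m ≃+ ResExt PA PB m}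
    {Ψ : HypExt PA'.complex PB'.complex n ≃+ ResExt PA' PB' n}
    {Θ : HypExt (T.tensorRes PA PA' hA).complex Q.complex (m + n) ≃+
      ResExt (T.tensorRes PA PA' hA) Q (m + n)}
    (hΦ : IsComparison PA PB Φ) (hΨ : IsComparison PA' PB' Ψ)
    (hΘ : IsComparison (T.tensorRes PA PA' hA) Q Θ)
    {w : HypExt PA.complex PB.complex m →+ HypExt PA'.complex PB'.complex n →+
      HypExt (T.tensorRes PA PA' hA).complex Q.complex (m + n)}
    (hw : ∀ x y, Θ (w x y) = v (Φ x) (Ψ y)) : T.IsHypProduct w := by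
  intro o ho φ hφ ψ hψ
  -- after sufficiently many steps, both factors are given by genuine cocycles
  obtain ⟨a, ha⟩ := hφ.exists_cocycleFrom
  obtain ⟨b, hb⟩ := hψ.exists_cocycleFrom
  obtain ⟨k, hka, hkb⟩ := ho.exists_le_counts a b
  replace ha := ha.mono hka
  replace hb := hb.mono hkb
  have hc := T.cocycleFrom_oProd o ha hb
  refine ⟨hc.isAlmostCocycle, fun ℓ => ⟨(hc.hypPost ℓ.f).isAlmostCocycle, ?_⟩⟩
  apply Θ.injective
  obtain ⟨h₁, e₁⟩ := hΦ φ hφ _ ha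
  obtain ⟨h₂, e₂⟩ := hΨ ψ hψ _ hb
  obtain ⟨h₃, e₃⟩ := hΘ _ (hc.hypPost ℓ.f).isAlmostCocycle k (hc.hypPost ℓ.f)
  obtain ⟨h₄, e₄⟩ := hv o ho ℓ k ⟨_, h₁⟩ ⟨_, h₂⟩
  have e₅ : (⟨_, h₃⟩ : homCocycles (T.tensorRes PA PA' hA).complex (syz Q k) (m + n + k)) =
      (hypSign m n o k * ((m + (counts o k).1) * (n + (counts o k).2)).negOnePow) • ⟨_, h₄⟩ :=
    Subtype.ext (T.syzComp_hypPost_oProd hA ℓ k)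
  rw [hw, e₁, e₂, map_zsmul_unit, map_zsmul_unit, AddMonoidHom.smul_apply, e₄, e₃, e₅,
    map_zsmul_unit, map_zsmul_unit, smul_smul, smul_smul, smul_smul, mul_assoc, hypSign_eq]
  rw [mul_left_comm]

/-- The external product in the hypercohomology construction is unique. -/
theorem IsHypProduct.unique (hB : ∀ k, T.ExactProjective (syz PB k))
    (hB' : ∀ k, T.ExactProjective (syz PB' k))
    {w w' : HypExt PA.complex PB.complex m →+ HypExt PA'.complex PB'.complex n →+
      HypExt (T.tensorRes PA PA' hA).complex Q.complex (m + n)}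
    (hw : T.IsHypProduct w) (hw' : T.IsHypProduct w') : w = w' := by
  refine AddMonoidHom.ext fun x => AddMonoidHom.ext fun y => ?_
  obtain ⟨φ, hφ, rfl⟩ := hypMk_surjective x
  obtain ⟨ψ, hψ, rfl⟩ := hypMk_surjective y
  obtain ⟨o, -, ho, -⟩ := exists_admissible 0 0
  obtain ⟨ℓ⟩ := T.exists_oLift PB PB' hB hB' o Q
  obtain ⟨_, h⟩ := (hw o ho φ hφ ψ hψ).2 ℓ
  obtain ⟨_, h'⟩ := (hw' o ho φ hφ ψ hψ).2 ℓ
  exact h.trans h'.symm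

/-- External products of completed `Ext` groups exist in every abelian category with a tensor
product. -/
theorem hasExternalProducts : T.HasExternalProducts := by
  intro A A' B B' PA PA' hA PB PB' hB hB'
  refine ⟨fun o _ => ⟨T.oComplex_projective PB PB' hB hB' o, T.quasiIso_oAug PB PB' hB hB' o⟩,
    fun Q => ⟨fun o _ => T.exists_oLift PB PB' hB hB' o Q, fun m n => ?_⟩⟩
  obtain ⟨v, hv⟩ := T.exists_isResProduct hB hB' hA Q m n
  obtain ⟨Φ, hΦ⟩ := exists_isComparison PA PB m
  obtain ⟨Ψ, hΨ⟩ := exists_isComparison PA' PB' n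
  obtain ⟨Θ, hΘ⟩ := exists_isComparison (T.tensorRes PA PA' hA) Q (m + n)
  let w : HypExt PA.complex PB.complex m →+ HypExt PA'.complex PB'.complex n →+
      HypExt (T.tensorRes PA PA' hA).complex Q.complex (m + n) :=
    AddMonoidHom.mk' (fun x => Θ.symm.toAddMonoidHom.comp ((v (Φ x)).comp Ψ.toAddMonoidHom))
      fun x x' => by
        ext y
        simp
  have hw : ∀ x y, Θ (w x y) = v (Φ x) (Ψ y) := fun x y => Θ.apply_symm_apply _
  have hw' := hv.isHypProduct hΦ hΨ hΘ hw
  exact ⟨v, w, hv, fun v' hv' => IsResProduct.unique T hB hB' hv' hv, hw',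
    fun w' h => IsHypProduct.unique T hB hB' h hw', Φ, Ψ, Θ, hΦ, hΨ, hΘ, hw⟩

end TensorProd

/-! ### Tensor products of resolutions of projective objects -/

namespace TensorProd

variable {R : C} (T : TensorProd R)

section ProjectiveObjects

variable {A A' : C} (P : ProjectiveResolution A) (P' : ProjectiveResolution A')

lemma tensorAug_f_zero :
    (T.tensorAug P P').f 0 = T.desc 0 (fun i j => T.mor (aug P i) (aug P' j)) :=
  ChainComplex.toSingle₀Equiv_symm_apply_f_zero _ _

/-- The chain map `A ⊗ A' ⟶ K ⊗ L` from a complex concentrated in degree `0` that is given by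
morphisms `A ⟶ K₀` and `A' ⟶ L₀`. -/
def singleTensor {K L : ChainComplex C ℕ} (s : A ⟶ K.X 0) (s' : A' ⟶ L.X 0) :
    (ChainComplex.single₀ C).obj (T.ob A A') ⟶ T.tensorComplex K L :=
  (ChainComplex.fromSingle₀Equiv _ _).symm (T.mor s s' ≫ T.incl K L 0 0 0 rfl)

lemma singleTensor_f_zero {K L : ChainComplex C ℕ} (s : A ⟶ K.X 0) (s' : A' ⟶ L.X 0) :
    (T.singleTensor s s').f 0 = T.mor s s' ≫ T.incl K L 0 0 0 rfl :=
  ChainComplex.fromSingle₀Equiv_symm_apply_f_zero _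

lemma singleTensor_tensorAug {s : A ⟶ P.complex.X 0} {s' : A' ⟶ P'.complex.X 0}
    (hs : s ≫ aug P 0 = 𝟙 A) (hs' : s' ≫ aug P' 0 = 𝟙 A') :
    T.singleTensor s s' ≫ T.tensorAug P P' = 𝟙 _ := by
  apply HomologicalComplex.from_single_hom_ext
  have : (T.mor s s' ≫ T.incl P.complex P'.complex 0 0 0 rfl) ≫
      T.desc 0 (fun i j => T.mor (aug P i) (aug P' j)) = 𝟙 (T.ob A A') := by
    rw [Category.assoc, incl_desc, mor_comp, hs, hs']
    simp [mor]
  rw [HomologicalComplex.comp_f, tensorAug_f_zero, singleTensor_f_zero]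
  exact this

/-- The composite of the augmentation of `P ⊗ P'` with `A ⊗ A' ⟶ P ⊗ P'` is the tensor product of
the composites of the factors. -/
lemma tensorAug_singleTensor (s : A ⟶ P.complex.X 0) (s' : A' ⟶ P'.complex.X 0) :
    T.tensorAug P P' ≫ T.singleTensor s s' =
      HomologicalComplex.mapBifunctorMap (P.π ≫ (ChainComplex.fromSingle₀Equiv _ _).symm s)
        (P'.π ≫ (ChainComplex.fromSingle₀Equiv _ _).symm s') T.F (ComplexShape.down ℕ) := by
  ext n : 1
  refine T.tensor_hom_ext fun i j h => ?_
  rw [HomologicalComplex.ι_mapBifunctorMap]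
  cases n with
  | zero =>
    obtain rfl : i = 0 := by lia
    obtain rfl : j = 0 := by lia
    have e : T.incl P.complex P'.complex 0 0 0 h ≫
        T.desc 0 (fun i j => T.mor (aug P i) (aug P' j)) ≫
          T.mor s s' ≫ T.incl P.complex P'.complex 0 0 0 rfl =
        T.mor (aug P 0 ≫ s) (aug P' 0 ≫ s') ≫ T.incl P.complex P'.complex 0 0 0 rfl := by
      rw [← Category.assoc, incl_desc, ← Category.assoc, mor_comp]
    rw [HomologicalComplex.comp_f, tensorAug_f_zero, singleTensor_f_zero]
    refine e.trans ((Category.assoc _ _ _).trans ?_)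
    rw [HomologicalComplex.comp_f, HomologicalComplex.comp_f,
      ChainComplex.fromSingle₀Equiv_symm_apply_f_zero,
      ChainComplex.fromSingle₀Equiv_symm_apply_f_zero]
    rfl
  | succ n =>
    have h₁ : (T.tensorAug P P' ≫ T.singleTensor s s').f (n + 1) = 0 := by
      rw [HomologicalComplex.comp_f]
      exact (congrArg (fun t => t ≫ _)
        ((HomologicalComplex.isZero_single_obj_X _ _ _ _ (by simp)).eq_of_tgt _ 0)).trans zero_comp
    rw [h₁, comp_zero]
    cases i with
    | succ i =>
      rw [HomologicalComplex.comp_f, P.π_f_succ, zero_comp, CategoryTheory.Functor.map_zero,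
        NatTrans.app_zero, zero_comp]
    | zero =>
      obtain ⟨j, rfl⟩ : ∃ j', j = j' + 1 := ⟨n, by lia⟩
      rw [HomologicalComplex.comp_f P'.π, P'.π_f_succ, zero_comp, CategoryTheory.Functor.map_zero,
        zero_comp, comp_zero]

/-- The tensor product of projective resolutions of projective objects is a resolution, since both
resolutions are homotopy equivalent to the objects. -/
theorem quasiIso_tensorAug_of_projective [Projective A] [Projective A'] :
    QuasiIso (T.tensorAug P P') := by
  -- a section of the augmentation; the idempotent of `Q` that it defines lifts the identity
  have key : ∀ {X : C} [Projective X] (Q : ProjectiveResolution X),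
      ∃ s : X ⟶ Q.complex.X 0, s ≫ aug Q 0 = 𝟙 X ∧
        Nonempty (Homotopy (Q.π ≫ (ChainComplex.fromSingle₀Equiv _ _).symm s) (𝟙 _)) := by
    intro X _ Q
    have : Epi (aug Q 0) := inferInstanceAs (Epi (Q.π.f 0))
    let s : X ⟶ Q.complex.X 0 := Projective.factorThru (𝟙 X) (aug Q 0)
    have hs : s ≫ aug Q 0 = 𝟙 X := Projective.factorThru_comp _ _
    have hs' : (ChainComplex.fromSingle₀Equiv _ _).symm s ≫ Q.π = 𝟙 _ := by
      apply HomologicalComplex.from_single_hom_ext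
      rw [HomologicalComplex.comp_f, ChainComplex.fromSingle₀Equiv_symm_apply_f_zero]
      exact hs
    refine ⟨s, hs, ⟨ProjectiveResolution.liftHomotopy (𝟙 X) _ _ ?_ ?_⟩⟩
    · rw [Category.assoc, hs', CategoryTheory.Functor.map_id]
    · rw [CategoryTheory.Functor.map_id, Category.comp_id, Category.id_comp]
  obtain ⟨s, hs, ⟨H⟩⟩ := key P
  obtain ⟨s', hs', ⟨H'⟩⟩ := key P'
  let E : HomotopyEquiv (T.tensorComplex P.complex P'.complex)
      ((ChainComplex.single₀ C).obj (T.ob A A')) :=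
    { hom := T.tensorAug P P'
      inv := T.singleTensor s s'
      homotopyHomInvId := (Homotopy.ofEq (T.tensorAug_singleTensor P P' s s')).trans
        ((HomologicalComplex.mapBifunctorMapHomotopy₁ H _ T.F _).trans
          ((HomologicalComplex.mapBifunctorMapHomotopy₂ _ H' T.F _).trans (Homotopy.ofEq (by
            ext n : 1
            refine T.tensor_hom_ext fun i j h => ?_
            rw [HomologicalComplex.ι_mapBifunctorMap]
            simp))))
      homotopyInvHomId := Homotopy.ofEq (T.singleTensor_tensorAug P P' hs hs') }
  exact E.quasiIso_hom

end ProjectiveObjects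

/-! ### Exact functors that are compatible with tensor products -/

section Components

variable (K L : ChainComplex C ℕ)

/-- The inclusion of `Kᵢ ⊗ Lⱼ` in degree `n`, or zero if `i + j ≠ n`. -/
def inclAt (n i j : ℕ) : T.ob (K.X i) (L.X j) ⟶ (T.tensorComplex K L).X n :=
  if h : i + j = n then T.incl K L i j n h else 0

lemma inclAt_eq {n i j : ℕ} (h : i + j = n) : T.inclAt K L n i j = T.incl K L i j n h :=
  dif_pos h

lemma desc_inclAt (n : ℕ) : T.desc n (T.inclAt K L n) = 𝟙 _ :=
  T.tensor_hom_ext fun i j h => by rw [incl_desc, inclAt_eq _ _ _ h, Category.comp_id]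

lemma inclAt_d {n i j : ℕ} (h : i + j = n + 1) :
    T.inclAt K L (n + 1) i j ≫ (T.tensorComplex K L).d (n + 1) n =
      T.dLeft (T.inclAt K L n) i j + (-1 : ℤˣ) ^ i • T.dRight (T.inclAt K L n) i j := by
  have := T.d_desc n (T.inclAt K L n)
  rw [desc_inclAt, Category.comp_id] at this
  rw [inclAt_eq _ _ _ h, this, incl_desc]

/-- The projection to the summand `Kᵢ ⊗ Lⱼ`. -/
def proj (n i j : ℕ) : (T.tensorComplex K L).X n ⟶ T.ob (K.X i) (L.X j) :=
  T.desc n fun a b => if h : a = i ∧ b = j then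
    eqToHom (congrArg₂ (fun a b => T.ob (K.X a) (L.X b)) h.1 h.2) else 0

lemma incl_proj_self (n i j : ℕ) (h : i + j = n) :
    T.incl K L i j n h ≫ T.proj K L n i j = 𝟙 _ := by
  rw [proj, incl_desc, dif_pos ⟨rfl, rfl⟩, eqToHom_refl]

lemma incl_proj_of_ne (n : ℕ) {i j a b : ℕ} (h : a + b = n) (h' : (a, b) ≠ (i, j)) :
    T.incl K L a b n h ≫ T.proj K L n i j = 0 := by
  rw [proj, incl_desc, dif_neg (fun e => h' (Prod.ext e.1 e.2))]

lemma sum_proj_inclAt (n : ℕ) :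
    ∑ p ∈ Finset.HasAntidiagonal.antidiagonal n,
      T.proj K L n p.1 p.2 ≫ T.inclAt K L n p.1 p.2 = 𝟙 _ := by
  refine T.tensor_hom_ext fun i j h => ?_
  rw [Preadditive.comp_sum, Finset.sum_eq_single (i, j), ← Category.assoc, incl_proj_self,
    Category.id_comp, Category.comp_id, inclAt_eq _ _ _ h]
  · intro p _ hp
    rw [← Category.assoc, incl_proj_of_ne _ _ _ _ _ hp.symm, zero_comp]
  · intro hp
    exact absurd (Finset.HasAntidiagonal.mem_antidiagonal.2 h) hp

end Components

section Functor

variable {D : Type*} [Category.{v} D] [Abelian D] {R₀ : D} (T₀ : TensorProd R₀) (U : C ⥤ D)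
  (e : T.F ⋙ (Functor.whiskeringRight C C D).obj U ≅
    U ⋙ T₀.F ⋙ (Functor.whiskeringLeft C D D).obj U)

variable {T T₀ U}

/-- The isomorphism `U X ⊗ U Y ≅ U (X ⊗ Y)`. -/
def compatIso (X Y : C) : T₀.ob (U.obj X) (U.obj Y) ≅ U.obj (T.ob X Y) :=
  (e.symm.app X).app Y

lemma map_app_compatIso {X X' : C} (f : X ⟶ X') (Y : C) :
    (T₀.F.map (U.map f)).app (U.obj Y) ≫ (compatIso e X' Y).hom =
      (compatIso e X Y).hom ≫ U.map ((T.F.map f).app Y) :=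
  NatTrans.congr_app (e.inv.naturality f) Y

lemma map_compatIso (X : C) {Y Y' : C} (g : Y ⟶ Y') :
    (T₀.F.obj (U.obj X)).map (U.map g) ≫ (compatIso e X Y').hom =
      (compatIso e X Y).hom ≫ U.map ((T.F.obj X).map g) :=
  (e.inv.app X).naturality g

lemma mor_compatIso {X X' Y Y' : C} (f : X ⟶ X') (g : Y ⟶ Y') :
    T₀.mor (U.map f) (U.map g) ≫ (compatIso e X' Y').hom =
      (compatIso e X Y).hom ≫ U.map (T.mor f g) := by
  rw [mor, Category.assoc, map_compatIso, ← Category.assoc, map_app_compatIso, Category.assoc,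
    ← U.map_comp]
  rfl

variable [U.Additive] (K L : ChainComplex C ℕ)

/-- The image of a chain complex under an additive functor. -/
abbrev mapCx (U : C ⥤ D) [U.Additive] (K : ChainComplex C ℕ) : ChainComplex D ℕ :=
  (U.mapHomologicalComplex (ComplexShape.down ℕ)).obj K

/-- The isomorphism `U Kᵢ ⊗ U Lⱼ ≅ U (Kᵢ ⊗ Lⱼ)`. -/
def compatAt (i j : ℕ) : T₀.ob ((mapCx U K).X i) ((mapCx U L).X j) ≅ U.obj (T.ob (K.X i) (L.X j)) :=
  compatIso e (K.X i) (L.X j)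

lemma map_d_app_compatAt (i j : ℕ) :
    (T₀.F.map ((mapCx U K).d (i + 1) i)).app ((mapCx U L).X j) ≫ (compatAt e K L i j).hom =
      (compatAt e K L (i + 1) j).hom ≫ U.map ((T.F.map (K.d (i + 1) i)).app (L.X j)) :=
  map_app_compatIso e (K.d (i + 1) i) (L.X j)

lemma map_d_compatAt (i j : ℕ) :
    (T₀.F.obj ((mapCx U K).X i)).map ((mapCx U L).d (j + 1) j) ≫ (compatAt e K L i j).hom =
      (compatAt e K L i (j + 1)).hom ≫ U.map ((T.F.obj (K.X i)).map (L.d (j + 1) j)) :=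
  map_compatIso e (K.X i) (L.d (j + 1) j)

/-- The components of the comparison `U K ⊗ U L ⟶ U (K ⊗ L)`. -/
def compatX (n : ℕ) : (T₀.tensorComplex (mapCx U K) (mapCx U L)).X n ⟶
    U.obj ((T.tensorComplex K L).X n) :=
  T₀.desc n fun i j => (compatAt e K L i j).hom ≫ U.map (T.inclAt K L n i j)

/-- The terms of `K ⊗ L` are finite direct sums, so an additive functor preserves them; the inverse
is the sum over the summands. -/
lemma isIso_compatX (n : ℕ) : IsIso (compatX e K L n) := by
  let inv : U.obj ((T.tensorComplex K L).X n) ⟶ (T₀.tensorComplex (mapCx U K) (mapCx U L)).X n :=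
    ∑ p ∈ Finset.HasAntidiagonal.antidiagonal n, U.map (T.proj K L n p.1 p.2) ≫
      (compatAt e K L p.1 p.2).inv ≫ T₀.inclAt (mapCx U K) (mapCx U L) n p.1 p.2
  refine ⟨inv, ?_, ?_⟩
  · refine T₀.tensor_hom_ext fun i j h => ?_
    rw [← Category.assoc, compatX, incl_desc, Category.comp_id, Preadditive.comp_sum,
      Finset.sum_eq_single (i, j)]
    · have h₁ : U.map (T.inclAt K L n i j) ≫ U.map (T.proj K L n i j) = 𝟙 _ := by
        rw [← U.map_comp, inclAt_eq _ _ _ h, incl_proj_self, U.map_id]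
      rw [Category.assoc, reassoc_of% h₁, Iso.hom_inv_id_assoc, inclAt_eq _ _ _ h]
    · intro p _ hp
      have h₁ : U.map (T.inclAt K L n i j) ≫ U.map (T.proj K L n p.1 p.2) = 0 := by
        rw [← U.map_comp, inclAt_eq _ _ _ h, incl_proj_of_ne _ _ _ _ _ hp.symm, U.map_zero]
      rw [Category.assoc, reassoc_of% h₁, zero_comp, comp_zero]
    · intro hp
      exact absurd (Finset.HasAntidiagonal.mem_antidiagonal.2 h) hp
  · rw [Preadditive.sum_comp, ← U.map_id, ← sum_proj_inclAt, U.map_sum]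
    refine Finset.sum_congr rfl fun p hp => ?_
    rw [Finset.HasAntidiagonal.mem_antidiagonal] at hp
    rw [Category.assoc, Category.assoc, inclAt_eq _ _ _ hp, compatX, incl_desc,
      Iso.inv_hom_id_assoc, U.map_comp]

lemma map_units_smul {X Y : C} (ε : ℤˣ) (f : X ⟶ Y) : U.map (ε • f) = ε • U.map f := by
  rcases Int.units_eq_one_or ε with rfl | rfl
  · rw [one_smul, one_smul]
  · rw [Units.neg_smul, Units.neg_smul, one_smul, one_smul, U.map_neg]

lemma compatX_comm (n : ℕ) :
    compatX e K L (n + 1) ≫ U.map ((T.tensorComplex K L).d (n + 1) n) =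
      (T₀.tensorComplex (mapCx U K) (mapCx U L)).d (n + 1) n ≫ compatX e K L n := by
  rw [compatX, compatX, d_desc, desc_comp]
  refine T₀.desc_congr fun i j h => ?_
  rw [Category.assoc, ← U.map_comp, inclAt_d _ _ _ h, U.map_add, Preadditive.comp_add,
    map_units_smul, Linear.comp_units_smul]
  congr 1
  · cases i with
    | zero => exact (congrArg _ (U.map_zero _ _)).trans comp_zero
    | succ i =>
      refine (congrArg _ (U.map_comp _ _)).trans ?_
      rw [← Category.assoc, ← map_d_app_compatAt, Category.assoc]
      rfl
  · congr 1
    cases j with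
    | zero => exact (congrArg _ (U.map_zero _ _)).trans comp_zero
    | succ j =>
      refine (congrArg _ (U.map_comp _ _)).trans ?_
      rw [← Category.assoc, ← map_d_compatAt, Category.assoc]
      rfl

/-- The isomorphism of chain complexes `U K ⊗ U L ≅ U (K ⊗ L)`. -/
def compatCx : T₀.tensorComplex (mapCx U K) (mapCx U L) ≅ mapCx U (T.tensorComplex K L) :=
  HomologicalComplex.Hom.isoOfComponents
    (fun n => @asIso _ _ _ _ (compatX e K L n) (isIso_compatX e K L n)) (by
    rintro i j (h : j + 1 = i)
    subst h
    exact compatX_comm e K L j)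

end Functor

lemma singleMapHomologicalComplex_hom_app_zero {D : Type*} [Category.{v} D] [Abelian D] (U : C ⥤ D)
    [U.Additive] (X : C) :
    ((HomologicalComplex.singleMapHomologicalComplex U (ComplexShape.down ℕ) 0).hom.app X).f 0 =
      𝟙 (U.obj X) := by
  rw [HomologicalComplex.singleMapHomologicalComplex_hom_app_self]
  exact (congrArg (fun t => t ≫ _) (U.map_id X)).trans (Category.id_comp _)

/-- A faithful exact functor that preserves projective objects and is compatible with the tensor
products detects that `P ⊗ P'` is a resolution, provided that it sends the resolved objects to
projective ones. -/
theorem quasiIso_tensorAug_of_functor {D : Type*} [Category.{v} D] [Abelian D] {R₀ : D}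
    (T₀ : TensorProd R₀) (U : C ⥤ D) [U.Additive]
    (e : T.F ⋙ (Functor.whiskeringRight C C D).obj U ≅
      U ⋙ T₀.F ⋙ (Functor.whiskeringLeft C D D).obj U)
    [U.PreservesHomology] [U.Faithful] [U.PreservesProjectiveObjects] {A A' : C}
    (P : ProjectiveResolution A) (P' : ProjectiveResolution A')
    [Projective (U.obj A)] [Projective (U.obj A')] : QuasiIso (T.tensorAug P P') := by
  have : U.ReflectsIsomorphisms :=
    reflectsIsomorphisms_of_reflectsMonomorphisms_of_reflectsEpimorphisms U
  rw [← HomologicalComplex.quasiIso_map_iff_of_preservesHomology (T.tensorAug P P') U]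
  have h₀ : QuasiIso (T₀.tensorAug (U.mapProjectiveResolution P) (U.mapProjectiveResolution P')) :=
    T₀.quasiIso_tensorAug_of_projective _ _
  let σ := (HomologicalComplex.singleMapHomologicalComplex U (ComplexShape.down ℕ) 0)
  have haug : ∀ {X : C} (Q : ProjectiveResolution X),
      aug (U.mapProjectiveResolution Q) 0 = U.map (aug Q 0) := fun Q =>
    (congrArg (fun t => U.map (aug Q 0) ≫ t)
      (singleMapHomologicalComplex_hom_app_zero U _)).trans (Category.comp_id _)
  have comm : (compatCx e P.complex P'.complex).hom ≫
      (U.mapHomologicalComplex _).map (T.tensorAug P P') ≫ σ.hom.app (T.ob A A') =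
      T₀.tensorAug (U.mapProjectiveResolution P) (U.mapProjectiveResolution P') ≫
        (ChainComplex.single₀ D).map (compatIso e A A').hom := by
    apply HomologicalComplex.to_single_hom_ext
    refine T₀.tensor_hom_ext fun i j h => ?_
    obtain rfl : i = 0 := by lia
    obtain rfl : j = 0 := by lia
    have h₁ : T₀.incl (mapCx U P.complex) (mapCx U P'.complex) 0 0 0 h ≫
        compatX e P.complex P'.complex 0 ≫
          U.map (T.desc 0 (fun i j => T.mor (aug P i) (aug P' j))) =
        T₀.mor (U.map (aug P 0)) (U.map (aug P' 0)) ≫ (compatIso e A A').hom := by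
      rw [← Category.assoc, compatX, incl_desc, Category.assoc, ← U.map_comp, inclAt_eq _ _ _ h,
        incl_desc, mor_compatIso]
      rfl
    have h₂ : T₀.incl (mapCx U P.complex) (mapCx U P'.complex) 0 0 0 h ≫
        T₀.desc 0 (fun i j => T₀.mor (aug (U.mapProjectiveResolution P) i)
          (aug (U.mapProjectiveResolution P') j)) =
        T₀.mor (U.map (aug P 0)) (U.map (aug P' 0)) := by
      refine (T₀.incl_desc 0 _ 0 0 h).trans ?_
      rw [haug, haug]
      rfl
    have h₃ : ((compatCx e P.complex P'.complex).hom ≫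
        (U.mapHomologicalComplex _).map (T.tensorAug P P') ≫ σ.hom.app (T.ob A A')).f 0 =
        compatX e P.complex P'.complex 0 ≫
          U.map (T.desc 0 (fun i j => T.mor (aug P i) (aug P' j))) := by
      refine congrArg (fun t => compatX e P.complex P'.complex 0 ≫ t) ?_
      refine (congrArg (fun t => U.map ((T.tensorAug P P').f 0) ≫ t)
        (singleMapHomologicalComplex_hom_app_zero U (T.ob A A'))).trans ?_
      exact (Category.comp_id _).trans (congrArg _ (T.tensorAug_f_zero P P'))
    refine (congrArg _ h₃).trans (h₁.trans ?_)
    refine (congrArg (fun t => t ≫ (compatIso e A A').hom) h₂.symm).trans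
      ((Category.assoc _ _ _).trans (congrArg _ ?_))
    rw [HomologicalComplex.comp_f, tensorAug_f_zero]
    exact congrArg _ (ChainComplex.single₀_map_f_zero _).symm
  have h₁ : QuasiIso ((compatCx e P.complex P'.complex).hom ≫
      (U.mapHomologicalComplex _).map (T.tensorAug P P') ≫ σ.hom.app (T.ob A A')) := by
    rw [comm]
    exact quasiIso_comp (hφ := h₀) _ _
  rw [quasiIso_iff_comp_left, quasiIso_iff_comp_right] at h₁
  exact h₁

end TensorProd

/-! ### Cup products -/

section Pre

variable {A A' B : C} {P : ProjectiveResolution A} {P' : ProjectiveResolution A'}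
  (Q : ProjectiveResolution B)

/-- Homotopic chain maps induce the same map on `Ext`. -/
lemma extPre_eq_of_homotopy {K' K : ChainComplex C ℕ} {f g : K' ⟶ K} (h : Homotopy f g) (B : C)
    (n : ℤ) : extPre f B n = extPre g B n := by
  refine AddMonoidHom.ext fun x => ?_
  obtain ⟨u, rfl⟩ := extMk_surjective x
  have hmem : ∀ f : K' ⟶ K, homPre f B n u.1 ∈ homCocycles K' B n := fun f => by
    rw [AddMonoidHom.mem_ker, homD_pre, u.2, map_zero]
  rw [extPre_mk f B n u ⟨_, hmem f⟩ rfl, extPre_mk g B n u ⟨_, hmem g⟩ rfl, extMk_eq_iff]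
  refine ⟨fun j => h.hom j.1 (j.1 + 1) ≫ u.1 ⟨j.1 + 1, by have := j.2; push_cast; lia⟩, ?_⟩
  rw [eq_sub_iff_add_eq]
  ext ⟨i, hi⟩
  have hd : K.d (i + 1) i ≫ u.1 ⟨i, hi⟩ = 0 := congrFun u.2 ⟨i + 1, by push_cast; lia⟩
  change _ + g.f i ≫ u.1 ⟨i, hi⟩ = f.f i ≫ u.1 ⟨i, hi⟩
  rw [h.comm i, Preadditive.add_comp, Preadditive.add_comp, Homotopy.prevD_chainComplex,
    Category.assoc, hd, comp_zero, add_zero]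
  congr 1
  cases i with
  | zero =>
    rw [Homotopy.dNext_zero_chainComplex, zero_comp]
    rfl
  | succ i =>
    rw [Homotopy.dNext_succ_chainComplex, Category.assoc]
    rfl

lemma resPre_iota (f : P'.complex ⟶ P.complex) (n : ℤ) (k : ℕ)
    (x : ExtGrp P.complex (syz Q k) (n + k)) :
    resPre Q f n (resIota P Q n k x) = resIota P' Q n k (extPre f _ _ x) := by
  change (colimit.ι (resSystem P Q n) k ≫ colimMap _).hom x = _
  rw [ι_colimMap]
  rfl

lemma resPre_eq_of_homotopy {f g : P'.complex ⟶ P.complex} (h : Homotopy f g) (n : ℤ) :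
    resPre Q f n = resPre Q g n := by
  refine AddMonoidHom.ext fun x => ?_
  obtain ⟨k, x, rfl⟩ := resIota_surjective P Q n x
  rw [resPre_iota, resPre_iota, extPre_eq_of_homotopy h]

/-- The canonical isomorphism between the two constructions is natural with respect to chain maps of
resolutions. -/
lemma IsComparison.pre {n : ℤ} {Θ : HypExt P.complex Q.complex n ≃+ ResExt P Q n}
    {Θ' : HypExt P'.complex Q.complex n ≃+ ResExt P' Q n} (hΘ : IsComparison P Q Θ)
    (hΘ' : IsComparison P' Q Θ') (f : P'.complex ⟶ P.complex) (z : HypExt P.complex Q.complex n) :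
    Θ' (hypExtPre f Q.complex n z) = resPre Q f n (Θ z) := by
  obtain ⟨φ, hφ, rfl⟩ := hypMk_surjective z
  obtain ⟨k, hk⟩ := hφ.exists_cocycleFrom
  have hk' : CocycleFrom (hypPre f Q.complex n φ) k := fun p hp => by
    rw [hypD_pre]
    exact (congrArg (fun t => f.f p.1.1 ≫ t) (hk p hp)).trans comp_zero
  obtain ⟨h₁, e₁⟩ := hΘ φ hφ k hk
  obtain ⟨h₂, e₂⟩ := hΘ' _ hk'.isAlmostCocycle k hk'
  refine e₂.trans ?_
  rw [e₁, map_zsmul_unit, resPre_iota, extPre_mk f _ _ ⟨_, h₁⟩ ⟨_, h₂⟩]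
  funext i
  exact Category.assoc _ _ _

end Pre

namespace TensorProd

variable {R : C} (T : TensorProd R)

section Cup

variable (P₁ P₂ P₃ : ProjectiveResolution R) (h : QuasiIso (T.tensorAug P₁ P₂))

variable {T P₁ P₂ P₃} in
lemma IsDiagonal.comp_tensorAug {Δ : P₃.complex ⟶ T.tensorComplex P₁.complex P₂.complex}
    (hΔ : T.IsDiagonal P₁ P₂ P₃ Δ) :
    Δ ≫ T.tensorAug P₁ P₂ = P₃.π ≫ (ChainComplex.single₀ C).map (T.leftUnit.inv.app R) := by
  rw [← hΔ, Category.assoc, Category.assoc, ← CategoryTheory.Functor.map_comp,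
    Iso.hom_inv_id_app, CategoryTheory.Functor.map_id]
  exact congrArg _ (Category.comp_id _).symm

/-- A diagonal approximation exists because `P₁ ⊗ P₂` is a resolution of `R ⊗ R ≅ R`. -/
lemma exists_isDiagonal (h : QuasiIso (T.tensorAug P₁ P₂)) : ∃ Δ, T.IsDiagonal P₁ P₂ P₃ Δ := by
  have := ProjectiveResolution.lift_commutes (T.leftUnit.inv.app R) P₃ (T.tensorRes P₁ P₂ h)
  refine ⟨ProjectiveResolution.lift (T.leftUnit.inv.app R) P₃ (T.tensorRes P₁ P₂ h), ?_⟩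
  refine (Category.assoc _ _ _).symm.trans ((congrArg (fun t => t ≫
    (ChainComplex.single₀ C).map (T.leftUnit.hom.app R)) this).trans ?_)
  rw [Category.assoc, ← CategoryTheory.Functor.map_comp, Iso.inv_hom_id_app,
    CategoryTheory.Functor.map_id]
  exact Category.comp_id _

variable {T P₁ P₂ P₃} in
lemma IsDiagonal.nonempty_homotopy {Δ Δ' : P₃.complex ⟶ (T.tensorRes P₁ P₂ h).complex}
    (hΔ : T.IsDiagonal P₁ P₂ P₃ Δ) (hΔ' : T.IsDiagonal P₁ P₂ P₃ Δ') : Nonempty (Homotopy Δ Δ') :=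
  ⟨ProjectiveResolution.liftHomotopy (T.leftUnit.inv.app R) (P := P₃) (Q := T.tensorRes P₁ P₂ h)
    _ _ hΔ.comp_tensorAug hΔ'.comp_tensorAug⟩

/-- The cup products are the external products followed by the map that is induced by a diagonal
approximation, which does not depend on the choice of the latter. -/
theorem exists_cup {M N : C} (PM : ProjectiveResolution M) (PN : ProjectiveResolution N)
    (hM : ∀ k, T.ExactProjective (syz PM k)) (hN : ∀ k, T.ExactProjective (syz PN k))
    (Q : ProjectiveResolution (T.ob M N)) (m n : ℤ) :
    ∃ (vRes : ResExt P₁ PM m →+ ResExt P₂ PN n →+ ResExt (T.tensorRes P₁ P₂ h) Q (m + n))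
      (vHyp : HypExt P₁.complex PM.complex m →+ HypExt P₂.complex PN.complex n →+
        HypExt (T.tensorRes P₁ P₂ h).complex Q.complex (m + n))
      (cupRes : ResExt P₁ PM m →+ ResExt P₂ PN n →+ ResExt P₃ Q (m + n))
      (cupHyp : HypExt P₁.complex PM.complex m →+ HypExt P₂.complex PN.complex n →+
        HypExt P₃.complex Q.complex (m + n)),
      T.IsResProduct vRes ∧ T.IsHypProduct vHyp ∧
      (∀ Δ, T.IsDiagonal P₁ P₂ P₃ Δ → ∀ x y,
        cupRes x y = resPre (P := T.tensorRes P₁ P₂ h) Q Δ (m + n) (vRes x y)) ∧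
      (∀ Δ, T.IsDiagonal P₁ P₂ P₃ Δ → ∀ x y,
        cupHyp x y = hypExtPre Δ Q.complex (m + n) (vHyp x y)) ∧
      ∃ (Φ : HypExt P₁.complex PM.complex m ≃+ ResExt P₁ PM m)
        (Ψ : HypExt P₂.complex PN.complex n ≃+ ResExt P₂ PN n)
        (Θ : HypExt P₃.complex Q.complex (m + n) ≃+ ResExt P₃ Q (m + n)),
        IsComparison P₁ PM Φ ∧ IsComparison P₂ PN Ψ ∧ IsComparison P₃ Q Θ ∧
        ∀ x y, Θ (cupHyp x y) = cupRes (Φ x) (Ψ y) := by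
  obtain ⟨-, h'⟩ := T.hasExternalProducts P₁ P₂ h PM PN hM hN
  obtain ⟨vRes, vHyp, h₁, -, h₂, -, Φ, Ψ, Θ, hΦ, hΨ, hΘ, hv⟩ := (h' Q).2 m n
  obtain ⟨Θ₃, hΘ₃⟩ := exists_isComparison P₃ Q (m + n)
  obtain ⟨Δ₀, hΔ₀⟩ := T.exists_isDiagonal P₁ P₂ P₃ h
  have hres : ∀ Δ, T.IsDiagonal P₁ P₂ P₃ Δ →
      resPre (P := T.tensorRes P₁ P₂ h) Q Δ₀ (m + n) =
        resPre (P := T.tensorRes P₁ P₂ h) Q Δ (m + n) := fun Δ hΔ => by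
    obtain ⟨H⟩ := IsDiagonal.nonempty_homotopy h hΔ₀ hΔ
    exact resPre_eq_of_homotopy Q H (m + n)
  refine ⟨vRes, vHyp, vRes.compr₂ (resPre (P := T.tensorRes P₁ P₂ h) Q Δ₀ (m + n)),
    vHyp.compr₂ (hypExtPre Δ₀ Q.complex (m + n)), h₁, h₂, fun Δ hΔ x y => ?_,
    fun Δ hΔ x y => ?_, Φ, Ψ, Θ₃, hΦ, hΨ, hΘ₃, fun x y => ?_⟩
  · rw [← hres Δ hΔ]
    rfl
  · -- the hypercohomology groups are compared through the canonical isomorphisms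
    apply Θ₃.injective
    refine (hΘ.pre Q hΘ₃ Δ₀ (vHyp x y)).trans (Eq.trans ?_ (hΘ.pre Q hΘ₃ Δ (vHyp x y)).symm)
    rw [hres Δ hΔ]
  · refine (hΘ.pre Q hΘ₃ Δ₀ (vHyp x y)).trans ?_
    rw [hv]
    rfl

end Cup

end TensorProd

end

end CompletedExt

open CompletedExt in
theorem theorem5p2 {S : Type u} [Category.{v} S] [CartesianMonoidalCategory S]
    [BraidedCategory S] (R G : S) [RingObj R] [GrpObj G] :
    -- external products in the category of `R`-module objects
    (∀ [Abelian (RMod R)] (T : TensorProd (RMod.self R)), T.HasExternalProducts) ∧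
    -- external products in the category of `R`-module objects with a compatible action of `G`
    (∀ [Abelian (RGMod R G)] (T : TensorProd (RGMod.trivial R G)), T.HasExternalProducts) ∧
    -- cup products
    (∀ [Abelian (RMod R)] [Abelian (RGMod R G)]
      (T₀ : TensorProd (RMod.self R)) (T : TensorProd (RGMod.trivial R G)),
      -- the `R`-module object underlying `M ⊗ N` is the tensor product of the underlying ones
      Nonempty (T.F ⋙ (Functor.whiskeringRight _ _ _).obj (RGMod.forget R G) ≅
        RGMod.forget R G ⋙ T₀.F ⋙ (Functor.whiskeringLeft _ _ _).obj (RGMod.forget R G)) →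
      -- the restriction functor is exact and preserves projectives
      PreservesFiniteLimits (RGMod.forget R G) → PreservesFiniteColimits (RGMod.forget R G) →
      (RGMod.forget R G).PreservesProjectiveObjects →
      Projective (RMod.self R) →
      ∀ P₁ P₂ : ProjectiveResolution (RGMod.trivial R G),
        ∃ h : QuasiIso (T.tensorAug P₁ P₂),
        ∀ P₃ : ProjectiveResolution (RGMod.trivial R G),
          (∃ Δ, T.IsDiagonal P₁ P₂ P₃ Δ) ∧
          ∀ {M N : RGMod R G} (PM : ProjectiveResolution M) (PN : ProjectiveResolution N),
            (∀ k, T.ExactProjective (syz PM k)) → (∀ k, T.ExactProjective (syz PN k)) →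
            ∀ (Q : ProjectiveResolution (T.ob M N)) (m n : ℤ),
              ∃ (vRes : ResExt P₁ PM m →+ ResExt P₂ PN n →+
                  ResExt (T.tensorRes P₁ P₂ h) Q (m + n))
                (vHyp : HypExt P₁.complex PM.complex m →+ HypExt P₂.complex PN.complex n →+
                  HypExt (T.tensorRes P₁ P₂ h).complex Q.complex (m + n))
                (cupRes : ResCoh P₁ PM m →+ ResCoh P₂ PN n →+ ResCoh P₃ Q (m + n))
                (cupHyp : HypCoh P₁ PM m →+ HypCoh P₂ PN n →+ HypCoh P₃ Q (m + n)),
                T.IsResProduct vRes ∧ T.IsHypProduct vHyp ∧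
                (∀ Δ, T.IsDiagonal P₁ P₂ P₃ Δ → ∀ x y,
                  cupRes x y = resPre (P := T.tensorRes P₁ P₂ h) Q Δ (m + n) (vRes x y)) ∧
                (∀ Δ, T.IsDiagonal P₁ P₂ P₃ Δ → ∀ x y,
                  cupHyp x y = hypExtPre Δ Q.complex (m + n) (vHyp x y)) ∧
                ∃ (Φ : HypCoh P₁ PM m ≃+ ResCoh P₁ PM m) (Ψ : HypCoh P₂ PN n ≃+ ResCoh P₂ PN n)
                  (Θ : HypCoh P₃ Q (m + n) ≃+ ResCoh P₃ Q (m + n)),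
                  IsComparison P₁ PM Φ ∧ IsComparison P₂ PN Ψ ∧ IsComparison P₃ Q Θ ∧
                  ∀ x y, Θ (cupHyp x y) = cupRes (Φ x) (Ψ y)) := by
  refine ⟨fun T => T.hasExternalProducts, fun T => T.hasExternalProducts, ?_⟩
  rintro _ _ T₀ T ⟨e⟩ _ _ _ hR P₁ P₂
  -- exactness makes the restriction functor additive
  have : (RGMod.forget R G).PreservesZeroMorphisms :=
    Functor.preservesZeroMorphisms_of_preserves_terminal_object
  have : (RGMod.forget R G).Additive := Functor.additive_of_preserves_binary_products _
  have : (RGMod.forget R G).Faithful := ⟨fun h => RGMod.Hom.ext (congrArg RMod.Hom.hom h)⟩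
  have : Projective ((RGMod.forget R G).obj (RGMod.trivial R G)) := hR
  have h := T.quasiIso_tensorAug_of_functor T₀ (RGMod.forget R G) e P₁ P₂
  exact ⟨h, fun P₃ => ⟨T.exists_isDiagonal P₁ P₂ P₃ h, fun PM PN hM hN Q m n =>
    T.exists_cup P₁ P₂ P₃ h PM PN hM hN Q m n⟩⟩
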